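/- Let $n$ be the number of qubits, and let $X_j,Y_j,Z_j$ be the Pauli operators on qubit $j$. The Majorana operators on $(\mathbb C^2)^{\otimes n}$ are $\gamma_{2k-1}=Z_1\cdots Z_{k-1}X_k$ and $\gamma_{2k}=Z_1\cdots Z_{k-1}Y_k$ for $k=1,\dots,n$. A unitary $U$ is free-fermionic, associated with $Q\in\mathrm O(2n)$, if $U^\dagger\gamma_\mu U=\sum_{\nu=1}^{2n}Q_{\mu\nu}\gamma_\nu$ for all $\mu$. A free-fermionic state is an operator of the form $\rho=U\big(\bigotimes_{j=1}^n\frac{I+\lambda_jZ_j}{2}\big)U^\dagger$ with $\lambda_j\in[-1,1]$ and $U$ a free-fermionic unitary; it is pure if $\rho=|u\rangle\langle u|$ for a vector $u$. The correlation matrix of $\rho$ is the $2n\times 2n$ matrix $\Gamma(\rho)_{jk}=-\frac i2\operatorname{Tr}([\gamma_j,\gamma_k]\rho)$. Write $\|A\|_p=\operatorname{Tr}(|A|^p)^{1/p}$, $|A|=\sqrt{A^\dagger A}$, for the Schatten norms, $\|A\|_\infty$ for the operator norm, and $F(\rho,\sigma)=\big(\operatorname{Tr}\sqrt{\sqrt\sigma\,\rho\,\sqrt\sigma}\big)^2$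 for the fidelity. (1) Let $\psi=|u\rangle\langle u|$ and $\phi=|v\rangle\langle v|$ be pure free-fermionic states on $n$ qubits. Then $\|\Gamma(\psi)-\Gamma(\phi)\|_\infty\le 2$. If $\|\Gamma(\psi)-\Gamma(\phi)\|_\infty<2$, then $$\|\psi-\phi\|_1\le\tfrac12\|\Gamma(\psi)-\Gamma(\phi)\|_2\quad\text{and}\quad |\langle u|v\rangle|^2\ge 1-\tfrac1{16}\|\Gamma(\psi)-\Gamma(\phi)\|_2^2 .$$ If $\|\Gamma(\psi)-\Gamma(\phi)\|_\infty=2$, then $\|\psi-\phi\|_1=2$ and $|\langle u|v\rangle|^2=0$. (2) Let $\rho$ and $\sigma$ be (possibly mixed) free-fermionic states on $n$ qubits. Then $$\|\rho-\sigma\|_1\le\tfrac12\|\Gamma(\rho)-\Gamma(\sigma)\|_1$$ and $$F(\rho,\sigma)\ \ge\ \max\!\big(0,\,1-\tfrac14\|\Gamma(\rho)-\Gamma(\sigma)\|_1\big)^2\ \ge\ 1-\tfrac12\|\Gamma(\rho)-\Gamma(\sigma)\|_1 .$$ -/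

import Mathlib

open scoped MatrixOrder ComplexOrder

namespace FreeFermion

noncomputable section

/-- Computational basis labels of `n` qubits. -/
abbrev Basis (n : ℕ) : Type := Fin n → Fin 2

/-- Operators on the `n`-qubit space `(ℂ²)^{⊗ n}`, as `2ⁿ × 2ⁿ` complex matrices. -/
abbrev Op (n : ℕ) : Type := Matrix (Basis n) (Basis n) ℂ

/-- Labels of the `2n` Majorana operators: `(k, 0)` is the odd index `2k - 1` and
`(k, 1)` the even index `2k`, for the `k`-th mode (modes counted from one). -/
abbrev MajIdx (n : ℕ) : Type := Fin n × Fin 2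

/-- The Pauli matrices. -/
def pauliX : Matrix (Fin 2) (Fin 2) ℂ := !![0, 1; 1, 0]

def pauliY : Matrix (Fin 2) (Fin 2) ℂ := !![0, -Complex.I; Complex.I, 0]

def pauliZ : Matrix (Fin 2) (Fin 2) ℂ := !![1, 0; 0, -1]

/-- The tensor product `A₁ ⊗ ⋯ ⊗ Aₙ` of single-qubit operators. -/
def tensor {n : ℕ} (A : Fin n → Matrix (Fin 2) (Fin 2) ℂ) : Op n :=
  Matrix.of fun x y => ∏ j, A j (x j) (y j)

/-- The Majorana operators `γ_{2k-1} = Z₁ ⋯ Z_{k-1} X_k` and `γ_{2k} = Z₁ ⋯ Z_{k-1} Y_k`. -/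
def majorana {n : ℕ} (μ : MajIdx n) : Op n :=
  tensor fun j =>
    if j < μ.1 then pauliZ
    else if j = μ.1 then (if μ.2 = 0 then pauliX else pauliY)
    else 1

/-- `U` is a free-fermionic unitary associated with the real orthogonal matrix `Q`:
`U† γ_μ U = ∑_ν Q_{μν} γ_ν`. -/
def IsFreeFermionicUnitary {n : ℕ} (Q : Matrix (MajIdx n) (MajIdx n) ℝ) (U : Op n) : Prop :=
  Q ∈ Matrix.orthogonalGroup (MajIdx n) ℝ ∧ U ∈ Matrix.unitaryGroup (Basis n) ℂ ∧
    ∀ μ : MajIdx n,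
      U.conjTranspose * majorana μ * U = ∑ ν : MajIdx n, (Q μ ν : ℂ) • majorana ν

/-- A (possibly mixed) free-fermionic state:
`ρ = U_Q (⨂_j (I + λ_j Z_j) / 2) U_Q†` with `Q ∈ O(2n)` and `λ_j ∈ [-1, 1]`. -/
def IsFreeFermionicState {n : ℕ} (ρ : Op n) : Prop :=
  ∃ (Q : Matrix (MajIdx n) (MajIdx n) ℝ) (U : Op n) (lam : Fin n → ℝ),
    IsFreeFermionicUnitary Q U ∧ (∀ j, |lam j| ≤ 1) ∧
      ρ = U * tensor (fun j => (1 / 2 : ℂ) • (1 + (lam j : ℂ) • pauliZ)) * U.conjTranspose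

/-- The correlation matrix `Γ(ρ)_{jk} = -(i/2) Tr([γ_j, γ_k] ρ)`. -/
def corrMatrix {n : ℕ} (ρ : Op n) : Matrix (MajIdx n) (MajIdx n) ℂ :=
  Matrix.of fun j k =>
    -(Complex.I / 2) *
      ((majorana j * majorana k - majorana k * majorana j) * ρ).trace

/-- The operator `|v⟩⟨v|`. -/
def ketbra {n : ℕ} (v : Basis n → ℂ) : Op n := Matrix.vecMulVec v (star v)

/-- The Schatten `p`-norm `(Tr |A|^p)^{1/p}`, where `|A| = √(A† A)`; the trace is that of a
positive semidefinite matrix, hence real. -/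
def schattenNorm {ι : Type} [Fintype ι] [DecidableEq ι] (p : ℝ) (A : Matrix ι ι ℂ) : ℝ :=
  (((CFC.sqrt (A.conjTranspose * A)) ^ p : Matrix ι ι ℂ).trace.re) ^ (1 / p)

/-- The operator norm (largest singular value). -/
def opNorm {ι : Type} [Fintype ι] [DecidableEq ι] (A : Matrix ι ι ℂ) : ℝ :=
  ‖Matrix.toEuclideanCLM (n := ι) (𝕜 := ℂ) A‖

/-- The fidelity `F(ρ, σ) = (Tr √(√σ ρ √σ))²`. -/
def fidelity {ι : Type} [Fintype ι] [DecidableEq ι] (ρ σ : Matrix ι ι ℂ) : ℝ :=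
  ((CFC.sqrt (CFC.sqrt σ * ρ * CFC.sqrt σ)).trace.re) ^ 2

end

end FreeFermion

namespace FreeFermion

/-! ### Trace norm, its duality with unitaries, and fidelity -/

section MatrixAnalysis

open Matrix

variable {ι : Type} [Fintype ι] [DecidableEq ι]

/-! Identify the Clifford algebra of the Majorana operators with the exterior algebra. A
free-fermionic state with real correlation matrix `K` is then `2⁻ⁿ exp(ω)`, where `ω` is the
bivector `-(i/2) ∑ K_ab e_a ∧ e_b` and the exponential is taken for the wedge product (`gaussian`,
`IsFreeFermionicUnitary.gaussian_eq`). Bivectors commute, so this exponential can be differentiated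
along any line in `K`, which the Clifford exponential does not allow so simply.

Mixed states. Join `L` to `K` by a segment. Skew contractions form a convex set, and each of them is
the correlation matrix of a state (`gaussian_posSemidef_and_trace`, from the skew normal form and
the implementation of reflections by unitaries). The derivative at a state `G` is the bivector of `K
- L` wedged with `G`. In normal form this is a sum of `λ_j x_j ∧ y_j` with unit vectors. Each `x_j ∧
y_j ∧ G` is an average of four terms of the form unitary times `G` times unitary, up to phases, so
its trace norm is at most `1`. As `∑ |λ_j|` is half the trace norm of `K - L`, the mean value
inequality gives `schattenNorm_gaussian_sub_le`. The fidelity bound follows by the Powers-Størmer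
inequality.

Pure states. Here `K² = L² = -1`, and `(K-L)ᵀ(K-L) + (K+L)ᵀ(K+L) = 4`. Hence the operator norm of `K
- L` is at most `2`, with equality exactly when `K + L` is singular. If `K + L` is invertible, so is
the whole segment. The expectation of the parity operator, a Pfaffian up to sign, then never
vanishes on it, so both states have the same parity. Seen in the frame of `u`, the state `v` is
distributed over bit strings that differ from that of `u` in no place or in at least two. Thus twice
the infidelity is at most the expected number of differences, which equals `‖K - L‖₂²/8`
(`overlap_lower_bound`); for pure states this also controls the trace norm. If `K + L` kills some `x
≠ 0`, the observable `-i γ(x) γ(Kx)` takes opposite extreme values in the two states, which are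
therefore orthogonal. -/

theorem exists_unitary_diagonalization {A : Matrix ι ι ℂ} (hA : A.IsHermitian) :
    ∃ (V : Matrix ι ι ℂ) (d : ι → ℝ), Vᴴ * V = 1 ∧ V * Vᴴ = 1 ∧
      A = V * Matrix.diagonal (fun i => (d i : ℂ)) * Vᴴ := by
  refine ⟨hA.eigenvectorUnitary, hA.eigenvalues, ?_, ?_, ?_⟩
  · exact Unitary.coe_star_mul_self hA.eigenvectorUnitary
  · exact Unitary.coe_mul_star_self hA.eigenvectorUnitary
  · conv_lhs => rw [hA.spectral_theorem, Unitary.conjStarAlgAut_apply]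
    rfl

theorem trace_conj_of_mul_eq_one {V : Matrix ι ι ℂ} (hV : V * Vᴴ = 1) (A : Matrix ι ι ℂ) :
    (Vᴴ * A * V).trace = A.trace := by
  rw [Matrix.trace_mul_cycle, hV, one_mul]

theorem conjTranspose_mul_apply_self {κ : Type} [Fintype κ] (M : Matrix κ κ ℂ) (i : κ) :
    (Mᴴ * M) i i = ((∑ k, ‖M k i‖ ^ 2 : ℝ) : ℂ) := by
  rw [Matrix.mul_apply]
  push_cast
  refine Finset.sum_congr rfl fun k _ => ?_
  rw [Matrix.conjTranspose_apply, Complex.star_def, Complex.conj_mul']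

/-- In an eigenbasis of `|N|` the columns of `N` have the singular values as Euclidean lengths, and
a diagonal entry is no longer than its column. No polar decomposition is needed, so singular `N` is
not a special case. -/
theorem trace_re_le_trace_sqrt (N : Matrix ι ι ℂ) :
    N.trace.re ≤ (CFC.sqrt (Nᴴ * N)).trace.re := by
  have hT : (CFC.sqrt (Nᴴ * N)).PosSemidef :=
    Matrix.nonneg_iff_posSemidef.mp (CFC.sqrt_nonneg _)
  have hTT : CFC.sqrt (Nᴴ * N) * CFC.sqrt (Nᴴ * N) = Nᴴ * N :=
    CFC.sqrt_mul_sqrt_self _ (Matrix.nonneg_iff_posSemidef.mpr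
      (Matrix.posSemidef_conjTranspose_mul_self N))
  set T := CFC.sqrt (Nᴴ * N)
  obtain ⟨V, t, hV, hV', hd⟩ := exists_unitary_diagonalization hT.isHermitian
  have hdiag : Vᴴ * T * V = Matrix.diagonal fun i => (t i : ℂ) := by
    rw [hd, mul_assoc, mul_assoc, mul_assoc, hV, mul_one, ← mul_assoc, hV, one_mul]
  have ht : ∀ i, 0 ≤ t i := by
    intro i
    have h := (hT.conjTranspose_mul_mul_same V).diag_nonneg (i := i)
    rw [hdiag, Matrix.diagonal_apply_eq] at h
    exact_mod_cast h
  have hM : (Vᴴ * N * V)ᴴ * (Vᴴ * N * V) = Matrix.diagonal fun i => ((t i ^ 2 : ℝ) : ℂ) := by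
    have h1 : (Vᴴ * N * V)ᴴ * (Vᴴ * N * V) = Vᴴ * (Nᴴ * N) * V := by
      simp only [Matrix.conjTranspose_mul, Matrix.conjTranspose_conjTranspose]
      calc Vᴴ * (Nᴴ * V) * (Vᴴ * N * V) = Vᴴ * Nᴴ * (V * Vᴴ) * N * V := by noncomm_ring
        _ = _ := by rw [hV']; noncomm_ring
    have h2 : Vᴴ * (T * T) * V = (Vᴴ * T * V) * (Vᴴ * T * V) := by
      calc Vᴴ * (T * T) * V = Vᴴ * T * (1 : Matrix ι ι ℂ) * T * V := by noncomm_ring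
        _ = _ := by rw [← hV']; noncomm_ring
    rw [h1, ← hTT, h2, hdiag, Matrix.diagonal_mul_diagonal]
    congr 1; ext i; push_cast; ring
  rw [← trace_conj_of_mul_eq_one hV' N, ← trace_conj_of_mul_eq_one hV' T, hdiag]
  simp only [Matrix.trace, Matrix.diag, Matrix.diagonal_apply_eq, Complex.re_sum,
    Complex.ofReal_re]
  refine Finset.sum_le_sum fun i _ => ?_
  have h := congrFun (congrFun hM i) i
  rw [conjTranspose_mul_apply_self, Matrix.diagonal_apply_eq, Complex.ofReal_inj] at h
  have h3 : ‖(Vᴴ * N * V) i i‖ ^ 2 ≤ t i ^ 2 := by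
    rw [← h]
    exact Finset.single_le_sum (f := fun k => ‖(Vᴴ * N * V) k i‖ ^ 2)
      (fun _ _ => by positivity) (Finset.mem_univ i)
  exact (Complex.re_le_norm _).trans (abs_le_of_sq_le_sq' h3 (ht i)).2

theorem schattenNorm_one (A : Matrix ι ι ℂ) :
    schattenNorm 1 A = (CFC.sqrt (Aᴴ * A)).trace.re := by
  unfold schattenNorm
  rw [CFC.rpow_one _ (CFC.sqrt_nonneg _)]
  simp

theorem schattenNorm_one_of_sq {A S : Matrix ι ι ℂ} (hS : S.PosSemidef) (h : S * S = Aᴴ * A) :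
    schattenNorm 1 A = S.trace.re := by
  rw [schattenNorm_one, CFC.sqrt_unique h (Matrix.nonneg_iff_posSemidef.mpr hS)]

theorem trace_conjTranspose_mul_self_re_nonneg {κ : Type} [Fintype κ] (A : Matrix κ κ ℂ) : 0 ≤ (Aᴴ * A).trace.re :=
  (Complex.le_def.mp (Matrix.posSemidef_conjTranspose_mul_self A).trace_nonneg).1

theorem schattenNorm_two_sq (A : Matrix ι ι ℂ) :
    schattenNorm 2 A ^ 2 = (Aᴴ * A).trace.re := by
  unfold schattenNorm
  have h : (CFC.sqrt (Aᴴ * A) ^ (2 : ℝ) : Matrix ι ι ℂ) = Aᴴ * A := by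
    have := CFC.rpow_natCast (CFC.sqrt (Aᴴ * A)) 2 (CFC.sqrt_nonneg _)
    rw [Nat.cast_ofNat] at this
    rw [this, pow_two]
    exact CFC.sqrt_mul_sqrt_self _ (Matrix.nonneg_iff_posSemidef.mpr
      (Matrix.posSemidef_conjTranspose_mul_self A))
  rw [h, ← Real.sqrt_eq_rpow, Real.sq_sqrt (trace_conjTranspose_mul_self_re_nonneg A)]

theorem schattenNorm_two_nonneg (A : Matrix ι ι ℂ) : 0 ≤ schattenNorm 2 A := by
  unfold schattenNorm
  have h : (CFC.sqrt (Aᴴ * A) ^ (2 : ℝ) : Matrix ι ι ℂ).PosSemidef :=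
    Matrix.nonneg_iff_posSemidef.mp CFC.rpow_nonneg
  exact Real.rpow_nonneg (Complex.le_def.mp h.trace_nonneg).1 _

theorem trace_unitary_mul_re_le_schattenNorm {W : Matrix ι ι ℂ} (hW : Wᴴ * W = 1)
    (A : Matrix ι ι ℂ) : (W * A).trace.re ≤ schattenNorm 1 A := by
  have h := trace_re_le_trace_sqrt (W * A)
  rwa [Matrix.conjTranspose_mul, mul_assoc, ← mul_assoc Wᴴ, hW, one_mul, ← schattenNorm_one] at h

/-- A sign `±1` with `sgn x * x = |x|`. -/
noncomputable def sgn (x : ℝ) : ℝ := if 0 ≤ x then 1 else -1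

theorem sgn_mul_self (x : ℝ) : sgn x * x = |x| := by
  unfold sgn; split_ifs with h
  · rw [abs_of_nonneg h, one_mul]
  · rw [abs_of_neg (not_le.mp h)]; ring

theorem sgn_mul_sgn (x : ℝ) : sgn x * sgn x = 1 := by
  unfold sgn; split_ifs <;> norm_num

/-- The convention `sgn 0 = 1` makes the sign of a Hermitian matrix unitary even when the matrix is
singular. -/
theorem unitary_conj_diagonal_sgn {V : Matrix ι ι ℂ} (hV : Vᴴ * V = 1) (hV' : V * Vᴴ = 1)
    (d : ι → ℝ) :
    (V * Matrix.diagonal (fun i => (sgn (d i) : ℂ)) * Vᴴ)ᴴ *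
      (V * Matrix.diagonal (fun i => (sgn (d i) : ℂ)) * Vᴴ) = 1 := by
  have hD : (Matrix.diagonal (fun i => (sgn (d i) : ℂ)))ᴴ =
      Matrix.diagonal (fun i => (sgn (d i) : ℂ)) := by
    rw [Matrix.diagonal_conjTranspose]; congr 1; ext i; simp
  have hDD : Matrix.diagonal (fun i => (sgn (d i) : ℂ)) *
      Matrix.diagonal (fun i => (sgn (d i) : ℂ)) = 1 := by
    rw [Matrix.diagonal_mul_diagonal, ← Matrix.diagonal_one]; congr 1; ext i
    rw [← Complex.ofReal_mul, sgn_mul_sgn, Complex.ofReal_one]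
  rw [Matrix.conjTranspose_mul, Matrix.conjTranspose_mul, Matrix.conjTranspose_conjTranspose, hD]
  set D := Matrix.diagonal (fun i => (sgn (d i) : ℂ))
  calc V * (D * Vᴴ) * (V * D * Vᴴ) = V * D * (Vᴴ * V) * D * Vᴴ := by noncomm_ring
    _ = V * (D * D) * Vᴴ := by rw [hV]; noncomm_ring
    _ = 1 := by rw [hDD, mul_one, hV']

/-- The sign of `A` attains the supremum in the duality, so a trace norm bound reduces to a bound on
one linear functional. -/
theorem exists_unitary_trace_mul_eq_schattenNorm {A : Matrix ι ι ℂ} (hA : A.IsHermitian) :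
    ∃ W : Matrix ι ι ℂ, Wᴴ * W = 1 ∧ (W * A).trace.re = schattenNorm 1 A := by
  obtain ⟨V, d, hV, hV', hd⟩ := exists_unitary_diagonalization hA
  refine ⟨V * Matrix.diagonal (fun i => (sgn (d i) : ℂ)) * Vᴴ,
    unitary_conj_diagonal_sgn hV hV' d, ?_⟩
  have hWA : V * Matrix.diagonal (fun i => (sgn (d i) : ℂ)) * Vᴴ * A =
      V * Matrix.diagonal (fun i => ((|d i| : ℝ) : ℂ)) * Vᴴ := by
    conv_lhs => rw [hd]
    have : Matrix.diagonal (fun i => ((|d i| : ℝ) : ℂ)) =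
        Matrix.diagonal (fun i => (sgn (d i) : ℂ)) * Matrix.diagonal (fun i => (d i : ℂ)) := by
      rw [Matrix.diagonal_mul_diagonal]; congr 1; ext i
      rw [← Complex.ofReal_mul, sgn_mul_self]
    rw [this]
    set D := Matrix.diagonal (fun i => (sgn (d i) : ℂ))
    set E := Matrix.diagonal (fun i => (d i : ℂ))
    calc V * D * Vᴴ * (V * E * Vᴴ) = V * D * (Vᴴ * V) * E * Vᴴ := by noncomm_ring
      _ = _ := by rw [hV]; noncomm_ring
  rw [hWA]
  symm
  apply schattenNorm_one_of_sq
  · apply Matrix.PosSemidef.mul_mul_conjTranspose_same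
    rw [Matrix.posSemidef_diagonal_iff]
    intro i; exact_mod_cast abs_nonneg _
  · rw [hA.eq]
    conv_rhs => rw [hd]
    have h1 : ∀ E : Matrix ι ι ℂ, V * E * Vᴴ * (V * E * Vᴴ) = V * (E * E) * Vᴴ := by
      intro E
      calc V * E * Vᴴ * (V * E * Vᴴ) = V * E * (Vᴴ * V) * E * Vᴴ := by noncomm_ring
        _ = _ := by rw [hV]; noncomm_ring
    rw [h1, h1, Matrix.diagonal_mul_diagonal, Matrix.diagonal_mul_diagonal]
    congr 3; ext i
    rw [← Complex.ofReal_mul, abs_mul_abs_self, Complex.ofReal_mul]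

/-- In an eigenbasis of `ρ` the trace is a sum of diagonal entries of a unitary, weighted by
nonnegative eigenvalues. -/
theorem norm_trace_unitary_mul_le {W ρ : Matrix ι ι ℂ} (hW : W ∈ Matrix.unitaryGroup ι ℂ)
    (hρ : ρ.PosSemidef) : ‖(W * ρ).trace‖ ≤ ρ.trace.re := by
  obtain ⟨V, d, hV, hV', hd⟩ := exists_unitary_diagonalization hρ.isHermitian
  have hdiag : Vᴴ * ρ * V = Matrix.diagonal fun i => (d i : ℂ) := by
    rw [hd, mul_assoc, mul_assoc, mul_assoc, hV, mul_one, ← mul_assoc, hV, one_mul]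
  have hd0 : ∀ i, 0 ≤ d i := by
    intro i
    have h := (hρ.conjTranspose_mul_mul_same V).diag_nonneg (i := i)
    rw [hdiag, Matrix.diagonal_apply_eq] at h
    exact_mod_cast h
  have hVu : V ∈ Matrix.unitaryGroup ι ℂ := Matrix.mem_unitaryGroup_iff.mpr hV'
  have hWV : Vᴴ * W * V ∈ Matrix.unitaryGroup ι ℂ :=
    mul_mem (mul_mem (Unitary.star_mem hVu) hW) hVu
  have h1 : (W * ρ).trace = ∑ i, (Vᴴ * W * V) i i * (d i : ℂ) := by
    rw [← trace_conj_of_mul_eq_one hV' (W * ρ)]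
    have : Vᴴ * (W * ρ) * V = (Vᴴ * W * V) * (Vᴴ * ρ * V) := by
      calc Vᴴ * (W * ρ) * V = Vᴴ * W * (1 : Matrix ι ι ℂ) * ρ * V := by noncomm_ring
        _ = _ := by rw [← hV']; noncomm_ring
    rw [this, hdiag]
    simp [Matrix.trace, Matrix.mul_diagonal]
  have h2 : ρ.trace.re = ∑ i, d i := by
    rw [← trace_conj_of_mul_eq_one hV' ρ, hdiag]
    simp [Matrix.trace]
  rw [h1, h2]
  refine (norm_sum_le _ _).trans (Finset.sum_le_sum fun i _ => ?_)
  rw [norm_mul, Complex.norm_real, Real.norm_of_nonneg (hd0 i)]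
  exact mul_le_of_le_one_left (hd0 i) (entry_norm_bound_of_unitary hWV i i)

/-- The Powers-Størmer inequality. -/
theorem trace_sub_sq_le_schattenNorm {A B : Matrix ι ι ℂ} (hA : A.PosSemidef)
    (hB : B.PosSemidef) :
    ((A - B) * (A - B)).trace.re ≤ schattenNorm 1 (A * A - B * B) := by
  obtain ⟨V, c, hV, hV', hd⟩ := exists_unitary_diagonalization
    (hA.isHermitian.sub hB.isHermitian)
  -- Test `A² - B²` against the sign of `A - B` and compare diagonal entries in an eigenbasis of `A
  -- - B`.
  have hW := unitary_conj_diagonal_sgn hV hV' c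
  refine le_trans ?_ (trace_unitary_mul_re_le_schattenNorm hW _)
  have hmul : ∀ X Y : Matrix ι ι ℂ, Vᴴ * (X * Y) * V = (Vᴴ * X * V) * (Vᴴ * Y * V) := by
    intro X Y
    calc Vᴴ * (X * Y) * V = Vᴴ * X * (1 : Matrix ι ι ℂ) * Y * V := by noncomm_ring
      _ = _ := by rw [← hV']; noncomm_ring
  have hdiag : ∀ D : Matrix ι ι ℂ, Vᴴ * (V * D * Vᴴ) * V = D := by
    intro D
    rw [mul_assoc, mul_assoc, mul_assoc, hV, mul_one, ← mul_assoc, hV, one_mul]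
  rw [← trace_conj_of_mul_eq_one hV' ((A - B) * (A - B)),
    ← trace_conj_of_mul_eq_one hV' (_ * (A * A - B * B)), hmul (A - B), hmul _ (A * A - B * B),
    mul_sub Vᴴ (A * A), sub_mul _ _ V, hmul A A, hmul B B, hdiag, hd, hdiag]
  have hA' := hA.conjTranspose_mul_mul_same V
  have hB' := hB.conjTranspose_mul_mul_same V
  have hAB : Vᴴ * A * V - Vᴴ * B * V = Matrix.diagonal fun i => (c i : ℂ) := by
    rw [← sub_mul, ← mul_sub, hd, hdiag]
  set A' := Vᴴ * A * V
  set B' := Vᴴ * B * V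
  have hsq : ∀ X : Matrix ι ι ℂ, X.IsHermitian → ∀ i,
      (X * X) i i = ((∑ k, ‖X k i‖ ^ 2 : ℝ) : ℂ) := by
    intro X hX i
    rw [← conjTranspose_mul_apply_self, hX.eq]
  have hreal : ∀ X : Matrix ι ι ℂ, X.PosSemidef → ∀ i, 0 ≤ (X i i).re ∧
      ‖X i i‖ = (X i i).re := by
    intro X hX i
    have h := hX.diag_nonneg (i := i)
    exact ⟨(Complex.le_def.mp h).1, (Complex.eq_re_of_ofReal_le h ▸ by
      rw [Complex.norm_of_nonneg (Complex.le_def.mp h).1, Complex.ofReal_re])⟩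
  simp only [Matrix.trace, Matrix.diag, Complex.re_sum,
    Matrix.diagonal_apply_eq, Matrix.diagonal_mul, Matrix.sub_apply]
  refine Finset.sum_le_sum fun i _ => ?_
  rw [hsq A' hA'.isHermitian, hsq B' hB'.isHermitian, ← Complex.ofReal_sub,
    ← Complex.ofReal_mul, ← Complex.ofReal_mul, Complex.ofReal_re, Complex.ofReal_re,
    ← Finset.sum_sub_distrib]
  have hci : c i = (A' i i).re - (B' i i).re := by
    have := congrFun (congrFun hAB i) i
    rw [Matrix.sub_apply, Matrix.diagonal_apply_eq] at this
    rw [← Complex.sub_re, this, Complex.ofReal_re]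
  -- `A' - B'` is diagonal, so the off-diagonal entries of `A'` and `B'` agree and cancel.
  have hs : ∑ k, (‖A' k i‖ ^ 2 - ‖B' k i‖ ^ 2) = (A' i i).re ^ 2 - (B' i i).re ^ 2 := by
    rw [Finset.sum_eq_single i]
    · rw [(hreal A' hA' i).2, (hreal B' hB' i).2]
    · intro k _ hk
      have := congrFun (congrFun hAB k) i
      rw [Matrix.sub_apply, Matrix.diagonal_apply_ne _ hk, sub_eq_zero] at this
      rw [this, sub_self]
    · simp
  have ha := (hreal A' hA' i).1
  have hb := (hreal B' hB' i).1
  rw [hs]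
  have h1 : (A' i i).re ^ 2 - (B' i i).re ^ 2 = c i * ((A' i i).re + (B' i i).re) := by
    rw [hci]; ring
  -- What remains is `|a - b|² ≤ |a - b| (a + b)` for nonnegative diagonal entries `a`, `b`.
  rw [h1, ← mul_assoc, sgn_mul_self, ← abs_mul_abs_self (c i)]
  refine mul_le_mul_of_nonneg_left ?_ (abs_nonneg _)
  rw [hci, abs_le]; constructor <;> linarith

/-- A Fuchs-van de Graaf inequality. -/
theorem one_sub_half_schattenNorm_le {ρ σ : Matrix ι ι ℂ} (hρ : ρ.PosSemidef)
    (hσ : σ.PosSemidef) (hρ1 : ρ.trace = 1) (hσ1 : σ.trace = 1) :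
    1 - 1 / 2 * schattenNorm 1 (ρ - σ) ≤
      (CFC.sqrt (CFC.sqrt σ * ρ * CFC.sqrt σ)).trace.re := by
  have hA : (CFC.sqrt ρ).PosSemidef := Matrix.nonneg_iff_posSemidef.mp (CFC.sqrt_nonneg _)
  have hB : (CFC.sqrt σ).PosSemidef := Matrix.nonneg_iff_posSemidef.mp (CFC.sqrt_nonneg _)
  have hAA : CFC.sqrt ρ * CFC.sqrt ρ = ρ :=
    CFC.sqrt_mul_sqrt_self _ (Matrix.nonneg_iff_posSemidef.mpr hρ)
  have hBB : CFC.sqrt σ * CFC.sqrt σ = σ :=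
    CFC.sqrt_mul_sqrt_self _ (Matrix.nonneg_iff_posSemidef.mpr hσ)
  set A := CFC.sqrt ρ
  set B := CFC.sqrt σ
  -- The left side here is `2 - 2 Re Tr(√ρ √σ)`, and `Re Tr(√ρ √σ)` is at most `Tr |√ρ √σ|`, the
  -- root fidelity.
  have h1 := trace_sub_sq_le_schattenNorm hA hB
  have h2 := trace_re_le_trace_sqrt (A * B)
  rw [hAA, hBB] at h1
  have h3 : (A * B)ᴴ * (A * B) = B * ρ * B := by
    rw [Matrix.conjTranspose_mul, hA.isHermitian.eq, hB.isHermitian.eq, ← hAA]; noncomm_ring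
  have h4 : ((A - B) * (A - B)).trace = 2 - 2 * (A * B).trace := by
    have : (A - B) * (A - B) = A * A - A * B - B * A + B * B := by noncomm_ring
    rw [this, Matrix.trace_add, Matrix.trace_sub, Matrix.trace_sub, hAA, hBB, hρ1, hσ1,
      Matrix.trace_mul_comm B A]
    ring
  rw [h3] at h2
  rw [h4] at h1
  simp at h1
  linarith

end MatrixAnalysis

/-! ### Majorana operators, parity and irreducibility -/

section Clifford

open Matrix

variable {n : ℕ}

theorem tensor_apply (A : Fin n → Matrix (Fin 2) (Fin 2) ℂ) (x y : Basis n) :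
    tensor A x y = ∏ j, A j (x j) (y j) := rfl

theorem tensor_mul (A B : Fin n → Matrix (Fin 2) (Fin 2) ℂ) :
    tensor A * tensor B = tensor fun j => A j * B j := by
  ext x y
  simp only [Matrix.mul_apply, tensor_apply]
  rw [Finset.prod_univ_sum, Fintype.piFinset_univ]
  exact Finset.sum_congr rfl fun z _ => Finset.prod_mul_distrib.symm

theorem tensor_one : tensor (fun _ : Fin n => (1 : Matrix (Fin 2) (Fin 2) ℂ)) = 1 := by
  ext x y
  rw [tensor_apply]
  by_cases h : x = y
  · subst h; simp
  · obtain ⟨j, hj⟩ := Function.ne_iff.mp h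
    rw [Matrix.one_apply_ne h]
    exact Finset.prod_eq_zero (Finset.mem_univ j) (Matrix.one_apply_ne hj)

theorem tensor_conjTranspose (A : Fin n → Matrix (Fin 2) (Fin 2) ℂ) :
    (tensor A)ᴴ = tensor fun j => (A j)ᴴ := by
  ext x y
  simp [tensor_apply, Matrix.conjTranspose_apply]

theorem trace_tensor (A : Fin n → Matrix (Fin 2) (Fin 2) ℂ) :
    (tensor A).trace = ∏ j, (A j).trace := by
  simp only [Matrix.trace, Matrix.diag, tensor_apply]
  rw [Finset.prod_univ_sum, Fintype.piFinset_univ]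

theorem tensor_diagonal (d : Fin n → Fin 2 → ℂ) :
    tensor (fun j => Matrix.diagonal (d j)) = Matrix.diagonal fun x => ∏ j, d j (x j) := by
  ext x y
  rw [tensor_apply]
  by_cases h : x = y
  · subst h; simp
  · obtain ⟨j, hj⟩ := Function.ne_iff.mp h
    rw [Matrix.diagonal_apply_ne _ h]
    exact Finset.prod_eq_zero (Finset.mem_univ j) (Matrix.diagonal_apply_ne _ hj)

theorem tensor_smul_at {A B : Fin n → Matrix (Fin 2) (Fin 2) ℂ} {c : ℂ} (k : Fin n)
    (hk : A k = c • B k) (h : ∀ j ≠ k, A j = B j) : tensor A = c • tensor B := by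
  ext x y
  rw [Matrix.smul_apply, tensor_apply, tensor_apply,
    ← Finset.mul_prod_erase _ _ (Finset.mem_univ k),
    ← Finset.mul_prod_erase Finset.univ (fun j => B j (x j) (y j)) (Finset.mem_univ k), hk,
    Matrix.smul_apply, smul_eq_mul, smul_eq_mul, mul_assoc]
  congr 2
  exact Finset.prod_congr rfl fun j hj => by rw [h j (Finset.ne_of_mem_erase hj)]

theorem tensor_add_at {A B C : Fin n → Matrix (Fin 2) (Fin 2) ℂ} (k : Fin n)
    (hk : A k = B k + C k) (hB : ∀ j ≠ k, A j = B j) (hC : ∀ j ≠ k, A j = C j) :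
    tensor A = tensor B + tensor C := by
  ext x y
  rw [Matrix.add_apply, tensor_apply, tensor_apply, tensor_apply,
    ← Finset.mul_prod_erase _ _ (Finset.mem_univ k),
    ← Finset.mul_prod_erase Finset.univ (fun j => B j (x j) (y j)) (Finset.mem_univ k),
    ← Finset.mul_prod_erase Finset.univ (fun j => C j (x j) (y j)) (Finset.mem_univ k), hk,
    Matrix.add_apply, add_mul]
  congr 2
  · exact Finset.prod_congr rfl fun j hj => by rw [hB j (Finset.ne_of_mem_erase hj)]
  · exact Finset.prod_congr rfl fun j hj => by rw [hC j (Finset.ne_of_mem_erase hj)]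

theorem tensor_smul (c : ℂ) (A : Fin n → Matrix (Fin 2) (Fin 2) ℂ) :
    tensor (fun j => c • A j) = c ^ n • tensor A := by
  ext x y
  simp [tensor_apply, Finset.prod_mul_distrib]

theorem tensor_commute {A B : Fin n → Matrix (Fin 2) (Fin 2) ℂ}
    (h : ∀ j, A j * B j = B j * A j) : tensor A * tensor B = tensor B * tensor A := by
  rw [tensor_mul, tensor_mul]
  congr 1; ext1 j; exact h j

/-- A single anticommuting site contributes the only sign. All anticommutation relations of
Majorana, parity and `Z` operators come from this. -/
theorem tensor_anticommute {A B : Fin n → Matrix (Fin 2) (Fin 2) ℂ} (k : Fin n)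
    (hk : A k * B k = -(B k * A k)) (h : ∀ j ≠ k, A j * B j = B j * A j) :
    tensor A * tensor B = -(tensor B * tensor A) := by
  rw [tensor_mul, tensor_mul, ← neg_one_smul ℂ]
  exact tensor_smul_at k (by rw [hk, neg_one_smul]) h

theorem pauliX_mul_self : pauliX * pauliX = 1 := by
  ext i j; fin_cases i <;> fin_cases j <;> simp [pauliX]
theorem pauliY_mul_self : pauliY * pauliY = 1 := by
  ext i j; fin_cases i <;> fin_cases j <;> simp [pauliY]
theorem pauliZ_mul_self : pauliZ * pauliZ = 1 := by
  ext i j; fin_cases i <;> fin_cases j <;> simp [pauliZ]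
theorem pauliX_mul_pauliY : pauliX * pauliY = -(pauliY * pauliX) := by
  ext i j; fin_cases i <;> fin_cases j <;> simp [pauliX, pauliY]
theorem pauliX_mul_pauliY_eq : pauliX * pauliY = Complex.I • pauliZ := by
  ext i j; fin_cases i <;> fin_cases j <;> simp [pauliX, pauliY, pauliZ]
theorem pauliX_mul_pauliZ : pauliX * pauliZ = -(pauliZ * pauliX) := by
  ext i j; fin_cases i <;> fin_cases j <;> simp [pauliX, pauliZ]
theorem pauliY_mul_pauliZ : pauliY * pauliZ = -(pauliZ * pauliY) := by
  ext i j; fin_cases i <;> fin_cases j <;> simp [pauliY, pauliZ]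
theorem pauliX_conjTranspose : pauliXᴴ = pauliX := by
  ext i j; fin_cases i <;> fin_cases j <;> simp [pauliX]
theorem pauliY_conjTranspose : pauliYᴴ = pauliY := by
  ext i j; fin_cases i <;> fin_cases j <;> simp [pauliY]
theorem pauliZ_conjTranspose : pauliZᴴ = pauliZ := by
  ext i j; fin_cases i <;> fin_cases j <;> simp [pauliZ]
theorem pauliZ_eq_diagonal : pauliZ = Matrix.diagonal fun i : Fin 2 => (-1 : ℂ) ^ (i : ℕ) := by
  ext i j; fin_cases i <;> fin_cases j <;> simp [pauliZ]

/-- The local factors of a Majorana operator. -/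
noncomputable def majoranaFactor (μ : MajIdx n) (j : Fin n) : Matrix (Fin 2) (Fin 2) ℂ :=
  if j < μ.1 then pauliZ else if j = μ.1 then (if μ.2 = 0 then pauliX else pauliY) else 1

theorem majorana_eq (μ : MajIdx n) : majorana μ = tensor (majoranaFactor μ) := rfl

theorem majoranaFactor_lt {μ : MajIdx n} {j : Fin n} (h : j < μ.1) :
    majoranaFactor μ j = pauliZ := by simp [majoranaFactor, h]

theorem majoranaFactor_gt {μ : MajIdx n} {j : Fin n} (h : μ.1 < j) :
    majoranaFactor μ j = 1 := by simp [majoranaFactor, h.ne', not_lt.mpr h.le]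

theorem majoranaFactor_zero (k : Fin n) : majoranaFactor (k, 0) k = pauliX := by
  simp [majoranaFactor]

theorem majoranaFactor_one (k : Fin n) : majoranaFactor (k, 1) k = pauliY := by
  simp [majoranaFactor]

theorem majoranaFactor_mul_pauliZ (μ : MajIdx n) :
    majoranaFactor μ μ.1 * pauliZ = -(pauliZ * majoranaFactor μ μ.1) := by
  obtain ⟨k, a⟩ := μ
  fin_cases a
  · exact (majoranaFactor_zero k).symm ▸ pauliX_mul_pauliZ
  · exact (majoranaFactor_one k).symm ▸ pauliY_mul_pauliZ

theorem majoranaFactor_mul_self (μ : MajIdx n) (j : Fin n) :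
    majoranaFactor μ j * majoranaFactor μ j = 1 := by
  unfold majoranaFactor
  split_ifs <;> simp [pauliX_mul_self, pauliY_mul_self, pauliZ_mul_self]

theorem majoranaFactor_conjTranspose (μ : MajIdx n) (j : Fin n) :
    (majoranaFactor μ j)ᴴ = majoranaFactor μ j := by
  unfold majoranaFactor
  split_ifs <;> simp [pauliX_conjTranspose, pauliY_conjTranspose, pauliZ_conjTranspose]

theorem majoranaFactor_commute_pauliZ {μ : MajIdx n} {j : Fin n} (h : j ≠ μ.1) :
    majoranaFactor μ j * pauliZ = pauliZ * majoranaFactor μ j := by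
  rcases lt_or_gt_of_ne h with h | h
  · rw [majoranaFactor_lt h]
  · rw [majoranaFactor_gt h, mul_one, one_mul]

theorem majorana_mul_self (μ : MajIdx n) : majorana μ * majorana μ = 1 := by
  rw [majorana_eq, tensor_mul, ← tensor_one]
  congr 1; ext1 j; exact majoranaFactor_mul_self μ j

theorem majorana_conjTranspose (μ : MajIdx n) : (majorana μ)ᴴ = majorana μ := by
  rw [majorana_eq, tensor_conjTranspose]
  congr 1; ext1 j; exact majoranaFactor_conjTranspose μ j

theorem majorana_anticommute_of_lt {μ ν : MajIdx n} (h : μ.1 < ν.1) :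
    majorana μ * majorana ν = -(majorana ν * majorana μ) := by
  refine tensor_anticommute μ.1 ?_ fun j hj => ?_
  · change majoranaFactor μ μ.1 * majoranaFactor ν μ.1 =
      -(majoranaFactor ν μ.1 * majoranaFactor μ μ.1)
    rw [majoranaFactor_lt h, majoranaFactor_mul_pauliZ]
  · change majoranaFactor μ j * majoranaFactor ν j = majoranaFactor ν j * majoranaFactor μ j
    rcases lt_or_gt_of_ne hj with hj | hj
    · rw [majoranaFactor_lt hj, majoranaFactor_lt (hj.trans h)]
    · rw [majoranaFactor_gt hj, mul_one, one_mul]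

theorem majorana_zero_one_anticommute (k : Fin n) :
    majorana (k, 0) * majorana (k, 1) = -(majorana (k, 1) * majorana (k, 0)) := by
  refine tensor_anticommute k ?_ fun j hj => ?_
  · change majoranaFactor (k, 0) k * majoranaFactor (k, 1) k =
      -(majoranaFactor (k, 1) k * majoranaFactor (k, 0) k)
    rw [majoranaFactor_zero, majoranaFactor_one, pauliX_mul_pauliY]
  · simp only [if_neg hj]

theorem majorana_anticommute {μ ν : MajIdx n} (h : μ ≠ ν) :
    majorana μ * majorana ν = -(majorana ν * majorana μ) := by
  rcases lt_trichotomy μ.1 ν.1 with h1 | h1 | h1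
  · exact majorana_anticommute_of_lt h1
  · obtain ⟨k, a⟩ := μ
    obtain ⟨l, b⟩ := ν
    obtain rfl : k = l := h1
    fin_cases a <;> fin_cases b
    · exact absurd rfl h
    · exact majorana_zero_one_anticommute k
    · exact (neg_eq_iff_eq_neg.mpr (majorana_zero_one_anticommute k)).symm
    · exact absurd rfl h
  · rw [majorana_anticommute_of_lt h1, neg_neg]

theorem majorana_mul_add (μ ν : MajIdx n) :
    majorana μ * majorana ν + majorana ν * majorana μ = (if μ = ν then (2 : ℂ) else 0) • 1 := by
  split_ifs with h
  · rw [h, majorana_mul_self, two_smul]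
  · rw [majorana_anticommute h, neg_add_cancel, zero_smul]

/-- The fermion parity operator. -/
noncomputable def parity (n : ℕ) : Op n := tensor fun _ => pauliZ

theorem parity_mul_self : parity n * parity n = 1 := by
  rw [parity, tensor_mul, ← tensor_one]
  congr 1; ext1 j; exact pauliZ_mul_self

theorem parity_conjTranspose : (parity n)ᴴ = parity n := by
  rw [parity, tensor_conjTranspose]
  congr 1; ext1 j; exact pauliZ_conjTranspose

theorem majorana_mul_parity (μ : MajIdx n) :
    majorana μ * parity n = -(parity n * majorana μ) :=
  tensor_anticommute μ.1 (majoranaFactor_mul_pauliZ μ) fun _ hj => majoranaFactor_commute_pauliZ hj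

/-- The Pauli operator `Z` on qubit `k`. -/
noncomputable def pauliZAt (k : Fin n) : Op n := tensor fun j => if j = k then pauliZ else 1

theorem majorana_zero_mul_one (k : Fin n) :
    majorana (k, 0) * majorana (k, 1) = Complex.I • pauliZAt k := by
  rw [majorana_eq, majorana_eq, tensor_mul]
  refine tensor_smul_at k ?_ fun j hj => ?_
  · rw [majoranaFactor_zero, majoranaFactor_one, if_pos rfl, pauliX_mul_pauliY_eq]
  · rw [if_neg hj]
    rcases lt_or_gt_of_ne hj with h | h
    · rw [majoranaFactor_lt h, majoranaFactor_lt (μ := (k, 1)) h, pauliZ_mul_self]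
    · rw [majoranaFactor_gt h, majoranaFactor_gt (μ := (k, 1)) h, mul_one]

theorem pauliZAt_eq (k : Fin n) :
    pauliZAt k = -Complex.I • (majorana (k, 0) * majorana (k, 1)) := by
  rw [majorana_zero_mul_one, smul_smul]; simp

theorem pauliZAt_eq_diagonal (k : Fin n) :
    pauliZAt k = Matrix.diagonal fun x : Basis n => (-1 : ℂ) ^ (x k : ℕ) := by
  have : (fun j : Fin n => if j = k then pauliZ else 1) = fun j => Matrix.diagonal
      fun i : Fin 2 => if j = k then (-1 : ℂ) ^ (i : ℕ) else 1 := by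
    ext1 j; split_ifs
    · exact pauliZ_eq_diagonal
    · exact Matrix.diagonal_one.symm
  rw [pauliZAt, this, tensor_diagonal]
  congr 1; ext x
  rw [Finset.prod_ite_eq' Finset.univ k fun j => (-1 : ℂ) ^ (x j : ℕ)]
  simp

/-- The product `∏_{j ∈ s} (1 + λ_j Z_j)`. -/
noncomputable def zProd (lam : Fin n → ℝ) (s : Finset (Fin n)) : Op n :=
  tensor fun j => if j ∈ s then 1 + (lam j : ℂ) • pauliZ else 1

theorem zProd_empty (lam : Fin n → ℝ) : zProd lam ∅ = 1 := by
  simp [zProd, tensor_one]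

/-- The recursion in modes that the wedge exponential is later shown to satisfy. -/
theorem zProd_insert (lam : Fin n → ℝ) {s : Finset (Fin n)} {k : Fin n} (hk : k ∉ s) :
    zProd lam (insert k s) = zProd lam s + (lam k : ℂ) • (pauliZAt k * zProd lam s) := by
  have h : pauliZAt k * zProd lam s = tensor fun j => if j = k then pauliZ else
      if j ∈ s then 1 + (lam j : ℂ) • pauliZ else 1 := by
    rw [pauliZAt, zProd, tensor_mul]
    congr 1; ext1 j
    by_cases hj : j = k
    · subst hj; simp [hk]
    · simp [hj]
  have h2 : (lam k : ℂ) • (pauliZAt k * zProd lam s) = tensor fun j =>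
      if j = k then (lam k : ℂ) • pauliZ else if j ∈ s then 1 + (lam j : ℂ) • pauliZ else 1 := by
    rw [h]
    refine (tensor_smul_at k ?_ fun j hj => ?_).symm
    · simp
    · simp [hj]
  rw [h2]
  refine tensor_add_at k ?_ (fun j hj => ?_) fun j hj => ?_
  · simp [hk]
  · simp [hj]
  · simp [hj]

theorem zProd_commute_majorana (lam : Fin n → ℝ) {s : Finset (Fin n)} {μ : MajIdx n}
    (h : μ.1 ∉ s) : zProd lam s * majorana μ = majorana μ * zProd lam s := by
  refine tensor_commute fun j => ?_
  change _ * majoranaFactor μ j = majoranaFactor μ j * _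
  by_cases hj : j = μ.1
  · subst hj; simp [h]
  · split_ifs
    · rw [add_mul, mul_add, smul_mul_assoc, mul_smul_comm, majoranaFactor_commute_pauliZ hj,
        one_mul, mul_one]
    · rw [one_mul, mul_one]

theorem zProd_commute_parity (lam : Fin n → ℝ) (s : Finset (Fin n)) :
    zProd lam s * parity n = parity n * zProd lam s := by
  refine tensor_commute fun j => ?_
  split_ifs
  · rw [add_mul, mul_add, smul_mul_assoc, mul_smul_comm, one_mul, mul_one]
  · rw [one_mul, mul_one]

theorem zProd_univ (lam : Fin n → ℝ) :
    tensor (fun j => (1 / 2 : ℂ) • (1 + (lam j : ℂ) • pauliZ)) =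
      ((1 / 2 : ℂ) ^ n) • zProd lam Finset.univ := by
  rw [tensor_smul, zProd]; simp

/-- The Majorana operators act irreducibly. -/
theorem exists_smul_one_of_commute_majorana {A : Op n}
    (h : ∀ μ, A * majorana μ = majorana μ * A) : ∃ c : ℂ, A = c • 1 := by
  -- Each `Z_k` is a product of two Majorana operators; commuting with all of them forces `A` to be
  -- diagonal.
  have hZ : ∀ k, A * pauliZAt k = pauliZAt k * A := by
    intro k
    rw [pauliZAt_eq, mul_smul_comm, smul_mul_assoc, ← mul_assoc, h, mul_assoc, h, mul_assoc]
  have hoff : ∀ x y, x ≠ y → A x y = 0 := by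
    intro x y hxy
    obtain ⟨k, hk⟩ := Function.ne_iff.mp hxy
    have h1 := congrFun (congrFun (hZ k) x) y
    rw [pauliZAt_eq_diagonal, Matrix.mul_diagonal, Matrix.diagonal_mul] at h1
    have h2 : ((-1 : ℂ) ^ (x k : ℕ) - (-1) ^ (y k : ℕ)) ≠ 0 := by
      generalize x k = a at hk
      generalize y k = b at hk
      fin_cases a <;> fin_cases b <;> first | exact absurd rfl hk | norm_num
    have h3 : ((-1 : ℂ) ^ (x k : ℕ) - (-1) ^ (y k : ℕ)) * A x y = 0 := by
      rw [sub_mul, ← h1]; ring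
    exact (mul_eq_zero.mp h3).resolve_left h2
  have hA : A = Matrix.diagonal fun x => A x x := by
    ext x y
    by_cases hxy : x = y
    · subst hxy; simp
    · rw [hoff x y hxy, Matrix.diagonal_apply_ne _ hxy]
  -- The operator `γ_(k,0)` has a nonzero entry between `x` and `x` with bit `k` flipped, so
  -- commuting with it equates the two diagonal entries.
  have hflip : ∀ x k c, A (Function.update x k c) (Function.update x k c) = A x x := by
    intro x k c
    by_cases hc : c = x k
    · rw [hc, Function.update_eq_self]
    · have h1 := congrFun (congrFun (h (k, 0)) x) (Function.update x k c)
      rw [hA, Matrix.mul_diagonal, Matrix.diagonal_mul] at h1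
      have h2 : majorana (k, 0) x (Function.update x k c) ≠ 0 := by
        rw [majorana_eq, tensor_apply, Finset.prod_ne_zero_iff]
        intro j _
        rcases lt_trichotomy j k with hj | hj | hj
        · rw [majoranaFactor_lt hj, Function.update_of_ne hj.ne, pauliZ_eq_diagonal]; simp
        · subst hj
          rw [majoranaFactor_zero, Function.update_self]
          generalize x j = a at hc
          fin_cases a <;> fin_cases c <;> simp [pauliX] at hc ⊢
        · rw [majoranaFactor_gt hj, Function.update_of_ne hj.ne']; simp
      rw [mul_comm] at h1
      exact (mul_left_cancel₀ h2 h1).symm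
  have hconst : ∀ x y, A x x = A y y := by
    intro x y
    have : ∀ s : Finset (Fin n), A (s.piecewise x y) (s.piecewise x y) = A y y := by
      intro s
      induction s using Finset.induction_on with
      | empty => simp
      | insert k s hk ih => rw [Finset.piecewise_insert, hflip, ih]
    simpa using this Finset.univ
  refine ⟨A 0 0, ?_⟩
  rw [hA, Matrix.smul_one_eq_diagonal]
  congr 1; ext x
  simp [hconst x 0]

end Clifford

/-! ### Exterior multiplication on the Clifford algebra -/

section Bivectors

open Matrix

variable {n : ℕ}

/-- The Majorana operator of a real vector. -/
noncomputable def gam (x : MajIdx n → ℝ) : Op n := ∑ a, (x a : ℂ) • majorana a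

theorem gam_single (a : MajIdx n) : gam (Pi.single a 1) = majorana a := by
  rw [gam, Finset.sum_eq_single a]
  · simp
  · intro b _ hb; simp [Pi.single_eq_of_ne hb]
  · simp

theorem gam_mul_add (x y : MajIdx n → ℝ) :
    gam x * gam y + gam y * gam x = ((2 * (x ⬝ᵥ y) : ℝ) : ℂ) • 1 := by
  have h1 : gam x * gam y = ∑ a, ∑ b, ((x a : ℂ) * y b) • (majorana a * majorana b) := by
    simp only [gam, Finset.sum_mul_sum, smul_mul_smul_comm]
  have h2 : gam y * gam x = ∑ a, ∑ b, ((x a : ℂ) * y b) • (majorana b * majorana a) := by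
    simp only [gam, Finset.sum_mul_sum, smul_mul_smul_comm]
    rw [Finset.sum_comm]
    refine Finset.sum_congr rfl fun a _ => Finset.sum_congr rfl fun b _ => ?_
    rw [mul_comm (y b : ℂ)]
  rw [h1, h2, ← Finset.sum_add_distrib]
  simp only [← Finset.sum_add_distrib, ← smul_add, majorana_mul_add, smul_smul]
  simp only [mul_ite, mul_zero, ite_smul, zero_smul, Finset.sum_ite_eq, Finset.mem_univ, if_true]
  rw [← Finset.sum_smul, dotProduct, Finset.mul_sum]
  push_cast
  congr 1
  exact Finset.sum_congr rfl fun a _ => by ring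

theorem gam_mul_self (x : MajIdx n → ℝ) : gam x * gam x = ((x ⬝ᵥ x : ℝ) : ℂ) • 1 := by
  have h := gam_mul_add x x
  rw [← two_smul ℂ, Complex.ofReal_mul, mul_smul] at h
  exact smul_right_injective _ (two_ne_zero (α := ℂ)) (by simpa using h)

theorem gam_anticommute {x y : MajIdx n → ℝ} (h : x ⬝ᵥ y = 0) :
    gam x * gam y = -(gam y * gam x) := by
  have h1 := gam_mul_add x y
  rw [h, mul_zero, Complex.ofReal_zero, zero_smul] at h1
  exact eq_neg_of_add_eq_zero_left h1

theorem gam_conjTranspose (x : MajIdx n → ℝ) : (gam x)ᴴ = gam x := by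
  simp [gam, Matrix.conjTranspose_sum, Matrix.conjTranspose_smul, majorana_conjTranspose]

theorem gam_mul_parity (x : MajIdx n → ℝ) : gam x * parity n = -(parity n * gam x) := by
  simp only [gam, Finset.sum_mul, Finset.mul_sum, smul_mul_assoc, majorana_mul_parity,
    mul_smul_comm, smul_neg, Finset.sum_neg_distrib]

theorem gam_mem_unitaryGroup {x : MajIdx n → ℝ} (h : x ⬝ᵥ x = 1) :
    gam x ∈ Matrix.unitaryGroup (Basis n) ℂ := by
  rw [Matrix.mem_unitaryGroup_iff, Matrix.star_eq_conjTranspose, gam_conjTranspose, gam_mul_self, h]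
  simp

theorem parity_mem_unitaryGroup : parity n ∈ Matrix.unitaryGroup (Basis n) ℂ := by
  rw [Matrix.mem_unitaryGroup_iff, Matrix.star_eq_conjTranspose, parity_conjTranspose,
    parity_mul_self]

/-- Exterior multiplication by a Majorana operator, under the identification of the Clifford
algebra with the exterior algebra. -/
noncomputable def wedgeMaj (a : MajIdx n) : Module.End ℂ (Op n) :=
  (1 / 2 : ℂ) • (LinearMap.mulLeft ℂ (majorana a) +
    LinearMap.mulRight ℂ (majorana a) ∘ₗ LinearMap.mulRight ℂ (parity n) ∘ₗ
      LinearMap.mulLeft ℂ (parity n))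

/-- Exterior multiplication by a vector. -/
noncomputable def wedge (x : MajIdx n → ℝ) : Module.End ℂ (Op n) := ∑ a, (x a : ℂ) • wedgeMaj a

/-- Conjugation by parity is the grading involution `α`, so this is the formula `x ∧ A = (xA +
α(A)x)/2`. -/
theorem wedge_apply (x : MajIdx n → ℝ) (A : Op n) :
    wedge x A = (1 / 2 : ℂ) • (gam x * A + parity n * A * parity n * gam x) := by
  simp only [wedge, wedgeMaj, gam, LinearMap.sum_apply, LinearMap.smul_apply, LinearMap.add_apply,
    LinearMap.comp_apply, LinearMap.mulLeft_apply, LinearMap.mulRight_apply, Finset.sum_mul,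
    Finset.mul_sum, smul_mul_assoc, mul_smul_comm]
  rw [← Finset.sum_add_distrib, Finset.smul_sum]
  exact Finset.sum_congr rfl fun a _ => by rw [← smul_add, smul_comm]

/-- Simultaneous exterior multiplication by two vectors, in closed form. -/
theorem wedge_wedge_apply (x y : MajIdx n → ℝ) (A : Op n) :
    wedge x (wedge y A) = (1 / 4 : ℂ) • (gam x * gam y * A +
      gam x * (parity n * A * parity n) * gam y - gam y * (parity n * A * parity n) * gam x
        - A * gam y * gam x) := by
  have h1 : parity n * (gam y * A) * parity n = -(gam y * (parity n * A * parity n)) := by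
    have := gam_mul_parity y
    rw [← mul_assoc, ← neg_eq_iff_eq_neg.mpr this]; noncomm_ring
  have h2 : parity n * (parity n * A * parity n * gam y) * parity n = -(A * gam y) := by
    have := gam_mul_parity y
    have hP : ∀ B : Op n, parity n * (parity n * B) = B := fun B => by
      rw [← mul_assoc, parity_mul_self, one_mul]
    simp only [mul_assoc, this, mul_neg, hP]
  rw [wedge_apply y, map_smul, wedge_apply, smul_smul, mul_add, mul_add, add_mul (parity n * _),
    h1, h2]
  rw [show (1 / 2 * (1 / 2) : ℂ) = 1 / 4 by norm_num]
  congr 1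
  simp only [add_mul, neg_mul, mul_assoc]
  abel

/-- The terms with `A` in the middle are antisymmetric in `x`, `y` already; the outer ones produce
the scalar `2 x·y` once on each side of `A`, with opposite signs. -/
theorem wedge_anticommute (x y : MajIdx n → ℝ) : wedge x * wedge y = -(wedge y * wedge x) := by
  apply LinearMap.ext
  intro A
  rw [LinearMap.neg_apply, Module.End.mul_apply, Module.End.mul_apply, wedge_wedge_apply,
    wedge_wedge_apply, ← smul_neg]
  congr 1
  have h := gam_mul_add x y
  have h' : gam x * gam y = ((2 * (x ⬝ᵥ y) : ℝ) : ℂ) • 1 - gam y * gam x := eq_sub_of_add_eq h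
  rw [h', mul_assoc A (gam x) (gam y), h', mul_sub, sub_mul, smul_mul_assoc, mul_smul_comm,
    one_mul, mul_one]
  noncomm_ring

theorem wedge_mul_self (x : MajIdx n → ℝ) : wedge x * wedge x = 0 := by
  have h := wedge_anticommute x x
  have h2 : (2 : ℂ) • (wedge x * wedge x) = 0 := by
    rw [two_smul]; nth_rewrite 1 [h]; exact neg_add_cancel _
  exact (smul_eq_zero.mp h2).resolve_left two_ne_zero

/-- Exterior multiplication by the bivector `-i x ∧ y`. -/
noncomputable def biv (x y : MajIdx n → ℝ) : Module.End ℂ (Op n) :=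
  -Complex.I • (wedge x * wedge y)

theorem mul_mul_comm_of_anticommute {R : Type*} [Ring R] {x y z w : R} (h1 : y * z = -(z * y))
    (h2 : x * z = -(z * x)) (h3 : y * w = -(w * y)) (h4 : x * w = -(w * x)) :
    x * y * (z * w) = z * w * (x * y) := by
  calc x * y * (z * w) = x * (y * z) * w := by noncomm_ring
    _ = -((x * z) * (y * w)) := by rw [h1]; noncomm_ring
    _ = -(z * (x * w) * y) := by rw [h2, h3]; noncomm_ring
    _ = _ := by rw [h4]; noncomm_ring

theorem mul_mul_self_eq_zero_of_anticommute {R : Type*} [Ring R] {x y : R}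
    (h : y * x = -(x * y)) (hx : x * x = 0) : x * y * (x * y) = 0 := by
  calc x * y * (x * y) = x * (y * x) * y := by noncomm_ring
    _ = -((x * x) * (y * y)) := by rw [h]; noncomm_ring
    _ = 0 := by rw [hx, zero_mul, neg_zero]

/-- This is the gain over the Clifford product: with commuting bivectors, sums of correlation
matrices become products of exponentials. -/
theorem biv_commute (x y z w : MajIdx n → ℝ) : Commute (biv x y) (biv z w) := by
  unfold biv
  refine Commute.smul_left (Commute.smul_right ?_ _) _
  exact mul_mul_comm_of_anticommute (wedge_anticommute y z) (wedge_anticommute x z)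
    (wedge_anticommute y w) (wedge_anticommute x w)

theorem biv_mul_self (x y : MajIdx n → ℝ) : biv x y * biv x y = 0 := by
  unfold biv
  rw [smul_mul_smul_comm, mul_mul_self_eq_zero_of_anticommute (wedge_anticommute y x)
    (wedge_mul_self x), smul_zero]

/-- Exterior multiplication by the bivector of the matrix `K`. -/
noncomputable def bivMat (K : Matrix (MajIdx n) (MajIdx n) ℝ) : Module.End ℂ (Op n) :=
  ∑ a, ∑ b, ((1 / 2 * K a b : ℝ) : ℂ) • biv (Pi.single a 1) (Pi.single b 1)

theorem wedge_single (a : MajIdx n) : wedge (Pi.single a 1) = wedgeMaj a := by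
  rw [wedge, Finset.sum_eq_single a]
  · simp
  · intro b _ hb; simp [Pi.single_eq_of_ne hb]
  · simp

theorem biv_eq_sum (x y : MajIdx n → ℝ) :
    biv x y = ∑ a, ∑ b, ((x a * y b : ℝ) : ℂ) • biv (Pi.single a 1) (Pi.single b 1) := by
  simp only [biv, wedge_single]
  rw [wedge, wedge, Finset.sum_mul, Finset.smul_sum]
  refine Finset.sum_congr rfl fun a _ => ?_
  rw [Finset.mul_sum, Finset.smul_sum]
  refine Finset.sum_congr rfl fun b _ => ?_
  rw [smul_mul_smul_comm, smul_comm, Complex.ofReal_mul]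

theorem bivMat_add (K L : Matrix (MajIdx n) (MajIdx n) ℝ) :
    bivMat (K + L) = bivMat K + bivMat L := by
  simp only [bivMat, ← Finset.sum_add_distrib, ← add_smul, Matrix.add_apply, mul_add,
    Complex.ofReal_add]

theorem bivMat_smul (c : ℝ) (K : Matrix (MajIdx n) (MajIdx n) ℝ) :
    bivMat (c • K) = (c : ℂ) • bivMat K := by
  simp only [bivMat, Finset.smul_sum, smul_smul, Matrix.smul_apply, smul_eq_mul]
  refine Finset.sum_congr rfl fun a _ => Finset.sum_congr rfl fun b _ => ?_
  congr 1; push_cast; ring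

theorem bivMat_commute (K L : Matrix (MajIdx n) (MajIdx n) ℝ) :
    Commute (bivMat K) (bivMat L) := by
  unfold bivMat
  refine Commute.sum_left _ _ _ fun a _ => Commute.sum_left _ _ _ fun b _ =>
    Commute.sum_right _ _ _ fun c _ => Commute.sum_right _ _ _ fun d _ => ?_
  exact ((biv_commute _ _ _ _).smul_left _).smul_right _

/-- The standard antisymmetric block matrix with blocks `[[0, λ_j], [-λ_j, 0]]`. -/
noncomputable def blockMat (lam : Fin n → ℝ) : Matrix (MajIdx n) (MajIdx n) ℝ :=
  Matrix.of fun μ ν => if μ.1 = ν.1 then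
    (if μ.2 = 0 ∧ ν.2 = 1 then lam μ.1 else if μ.2 = 1 ∧ ν.2 = 0 then -lam μ.1 else 0) else 0

/-- The coefficient ring is left free because both complex combinations of endomorphisms and real
bilinear sums are needed. -/
theorem sum_blockMat {R M : Type*} [Ring R] [AddCommGroup M] [Module R M] (φ : ℝ →+* R)
    (lam : Fin n → ℝ) (f : MajIdx n → MajIdx n → M) :
    ∑ μ, ∑ ν, φ (blockMat lam μ ν) • f μ ν =
      ∑ j, φ (lam j) • (f (j, 0) (j, 1) - f (j, 1) (j, 0)) := by
  rw [Fintype.sum_prod_type]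
  refine Finset.sum_congr rfl fun j _ => ?_
  rw [Fin.sum_univ_two, Fintype.sum_prod_type, Fintype.sum_prod_type,
    Finset.sum_eq_single j, Finset.sum_eq_single j]
  · simp [blockMat, sub_eq_add_neg]
  all_goals simp +contextual [blockMat, eq_comm]

theorem mul_mul_transpose_apply (Q K : Matrix (MajIdx n) (MajIdx n) ℝ) (a b : MajIdx n) :
    (Q * K * Qᵀ) a b = ∑ μ, ∑ ν, K μ ν * (Q a μ * Q b ν) := by
  simp only [Matrix.mul_apply, Matrix.transpose_apply, Finset.sum_mul]
  rw [Finset.sum_comm]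
  exact Finset.sum_congr rfl fun μ _ => Finset.sum_congr rfl fun ν _ => by ring

theorem bivMat_mul_mul_transpose (Q K : Matrix (MajIdx n) (MajIdx n) ℝ) :
    bivMat (Q * K * Qᵀ) = ∑ μ, ∑ ν, Complex.ofRealHom (K μ ν) •
      ((1 / 2 : ℂ) • biv (fun a => Q a μ) (fun a => Q a ν)) := by
  have h : ∀ p q : MajIdx n × MajIdx n, ((1 / 2 * (K q.1 q.2 * (Q p.1 q.1 * Q p.2 q.2)) : ℝ) : ℂ) •
      biv (n := n) (Pi.single p.1 1) (Pi.single p.2 1) = Complex.ofRealHom (K q.1 q.2) •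
      ((1 / 2 : ℂ) • (((Q p.1 q.1 * Q p.2 q.2 : ℝ) : ℂ) •
        biv (n := n) (Pi.single p.1 1) (Pi.single p.2 1))) := by
    intro p q
    rw [smul_smul, smul_smul, Complex.ofRealHom_eq_coe]
    congr 1; push_cast; ring
  have hl : bivMat (Q * K * Qᵀ) = ∑ p : MajIdx n × MajIdx n, ∑ q : MajIdx n × MajIdx n,
      ((1 / 2 * (K q.1 q.2 * (Q p.1 q.1 * Q p.2 q.2)) : ℝ) : ℂ) •
        biv (n := n) (Pi.single p.1 1) (Pi.single p.2 1) := by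
    rw [Fintype.sum_prod_type, bivMat]
    refine Finset.sum_congr rfl fun a _ => Finset.sum_congr rfl fun b _ => ?_
    rw [Fintype.sum_prod_type, mul_mul_transpose_apply]
    simp only [Finset.mul_sum, Complex.ofReal_sum, Finset.sum_smul]
  rw [hl, Finset.sum_comm, Fintype.sum_prod_type]
  refine Finset.sum_congr rfl fun μ _ => Finset.sum_congr rfl fun ν _ => ?_
  rw [biv_eq_sum, Finset.smul_sum, Finset.smul_sum, Fintype.sum_prod_type]
  refine Finset.sum_congr rfl fun a _ => ?_
  rw [Finset.smul_sum, Finset.smul_sum]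
  exact Finset.sum_congr rfl fun b _ => h (a, b) (μ, ν)

/-- Each block contributes two ordered pairs with equal terms, which absorbs the `1/2` in `bivMat`.
The result is a sum of commuting square-zero operators. -/
theorem bivMat_conj_blockMat (Q : Matrix (MajIdx n) (MajIdx n) ℝ) (lam : Fin n → ℝ) :
    bivMat (Q * blockMat lam * Qᵀ) =
      ∑ j, (lam j : ℂ) • biv (fun a => Q a (j, 0)) (fun a => Q a (j, 1)) := by
  rw [bivMat_mul_mul_transpose]
  refine (sum_blockMat Complex.ofRealHom lam fun μ ν =>
    (1 / 2 : ℂ) • biv (fun a => Q a μ) (fun a => Q a ν)).trans ?_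
  refine Finset.sum_congr rfl fun j _ => ?_
  have h2 : ∀ x y : MajIdx n → ℝ, biv y x = -biv x y := by
    intro x y; rw [biv, biv, wedge_anticommute, smul_neg]
  rw [h2 (fun a => Q a (j, 0)), smul_neg, sub_neg_eq_add, ← add_smul, Complex.ofRealHom_eq_coe,
    show (1 / 2 + 1 / 2 : ℂ) = 1 by norm_num, one_smul]

end Bivectors

/-! ### Gaussian operators as wedge exponentials -/

section Gaussian

open Matrix

variable {n : ℕ}

/-- Endomorphisms of a finite-dimensional space as continuous endomorphisms of a coordinate space. -/
noncomputable def endEquiv (V : Type*) [AddCommGroup V] [Module ℂ V] [FiniteDimensional ℂ V] :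
    Module.End ℂ V ≃ₐ[ℂ] ((Fin (Module.finrank ℂ V) → ℂ) →L[ℂ] (Fin (Module.finrank ℂ V) → ℂ)) :=
  ((Module.finBasis ℂ V).equivFun.conjAlgEquiv ℂ).trans (Module.End.toContinuousLinearMap _)

section Exponential

variable {V : Type*} [AddCommGroup V] [Module ℂ V] [FiniteDimensional ℂ V]

/-- The exponential of an endomorphism of a finite-dimensional complex vector space. -/
noncomputable def expEnd (T : Module.End ℂ V) : Module.End ℂ V :=
  (endEquiv V).symm (NormedSpace.exp (endEquiv V T))

theorem expEnd_zero : expEnd (0 : Module.End ℂ V) = 1 := by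
  rw [expEnd, map_zero, NormedSpace.exp_zero, map_one]

theorem expEnd_add {S T : Module.End ℂ V} (h : Commute S T) :
    expEnd (S + T) = expEnd S * expEnd T := by
  let : NormedAlgebra ℚ ((Fin (Module.finrank ℂ V) → ℂ) →L[ℂ] (Fin (Module.finrank ℂ V) → ℂ)) :=
    .restrictScalars ℚ ℂ _
  rw [expEnd, map_add, NormedSpace.exp_add_of_commute (h.map (endEquiv V)), map_mul]
  rfl

theorem expEnd_of_mul_self_eq_zero {T : Module.End ℂ V} (h : T * T = 0) : expEnd T = 1 + T := by
  have h2 : ∀ k ∉ Finset.range 2, ((k.factorial : ℂ)⁻¹) • (endEquiv V T) ^ k = 0 := by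
    intro k hk
    obtain ⟨m, rfl⟩ := Nat.exists_eq_add_of_le (not_lt.mp (Finset.mem_range.not.mp hk))
    rw [← map_pow, pow_add, pow_two, h, zero_mul, map_zero]
    ext1 v
    exact smul_zero (M := ℂ) (A := Fin (Module.finrank ℂ V) → ℂ) _
  rw [expEnd, NormedSpace.exp_eq_tsum ℂ]
  change (endEquiv V).symm (∑' k : ℕ, ((k.factorial : ℂ)⁻¹) • (endEquiv V T) ^ k) = _
  rw [tsum_eq_sum h2, Finset.sum_range_succ, Finset.sum_range_one]
  simp

/-- Composing with a functional makes the curve scalar, so no norm on `V` has to be chosen; traces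
against a fixed operator are all that is used. -/
theorem hasDerivAt_expEnd_smul (T : Module.End ℂ V) (A : V) (f : V →ₗ[ℂ] ℂ) (t : ℝ) :
    HasDerivAt (fun t : ℝ => f (expEnd ((t : ℂ) • T) A)) (f (T (expEnd ((t : ℂ) • T) A))) t := by
  let g : ((Fin (Module.finrank ℂ V) → ℂ) →L[ℂ] (Fin (Module.finrank ℂ V) → ℂ)) →L[ℂ] ℂ :=
    LinearMap.toContinuousLinearMap
      (f ∘ₗ LinearMap.applyₗ A ∘ₗ ((endEquiv V).symm.toLinearEquiv : _ →ₗ[ℂ] Module.End ℂ V))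
  have hg : ∀ B, g B = f ((endEquiv V).symm B A) := fun B => rfl
  have h1 := hasDerivAt_exp_smul_const' (𝕂 := ℂ) (endEquiv V T) (t : ℂ)
  have h2 := (g.hasFDerivAt.comp_hasDerivAt (t : ℂ) h1).comp_ofReal
  have h3 : (fun t : ℝ => f (expEnd ((t : ℂ) • T) A)) =
      fun t : ℝ => (g ∘ fun u : ℂ => NormedSpace.exp (u • endEquiv V T)) t := by
    ext t
    rw [Function.comp_apply, hg, expEnd, map_smul]
  rw [h3]
  convert h2 using 1
  rw [hg, map_mul, expEnd, map_smul, Module.End.mul_apply, AlgEquiv.symm_apply_apply]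

end Exponential

/-- The Gaussian operator with correlation matrix `K`. -/
noncomputable def gaussian (K : Matrix (MajIdx n) (MajIdx n) ℝ) : Op n :=
  expEnd (bivMat K) ((1 / 2 : ℂ) ^ n • 1)

theorem gaussian_add (K L : Matrix (MajIdx n) (MajIdx n) ℝ) :
    gaussian (K + L) = expEnd (bivMat K) (gaussian L) := by
  rw [gaussian, bivMat_add, expEnd_add (bivMat_commute K L), gaussian, Module.End.mul_apply]

theorem hasDerivAt_gaussian (K X : Matrix (MajIdx n) (MajIdx n) ℝ) (f : Op n →ₗ[ℂ] ℂ) (t : ℝ) :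
    HasDerivAt (fun t : ℝ => f (gaussian (t • X + K)))
      (f (bivMat X (gaussian (t • X + K)))) t := by
  have h : ∀ t : ℝ, gaussian (t • X + K) = expEnd ((t : ℂ) • bivMat X) (gaussian K) := by
    intro t; rw [gaussian_add, bivMat_smul]
  simp only [h]
  exact hasDerivAt_expEnd_smul _ _ f t

section Conjugation

variable {Q : Matrix (MajIdx n) (MajIdx n) ℝ} {U : Op n}

theorem IsFreeFermionicUnitary.conjTranspose_mul_self (h : IsFreeFermionicUnitary Q U) :
    Uᴴ * U = 1 := Matrix.mem_unitaryGroup_iff'.mp h.2.1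

theorem IsFreeFermionicUnitary.mul_conjTranspose_self (h : IsFreeFermionicUnitary Q U) :
    U * Uᴴ = 1 := Matrix.mem_unitaryGroup_iff.mp h.2.1

theorem IsFreeFermionicUnitary.transpose_mul_self (h : IsFreeFermionicUnitary Q U) :
    Qᵀ * Q = 1 := (Matrix.mem_orthogonalGroup_iff' _ _).mp h.1

/-- Conjugating in the direction opposite to the definition inverts `Q`, so columns replace rows. -/
theorem IsFreeFermionicUnitary.conj_majorana (h : IsFreeFermionicUnitary Q U) (μ : MajIdx n) :
    U * majorana μ * Uᴴ = gam fun a => Q a μ := by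
  have hQ := h.transpose_mul_self
  have h1 : Uᴴ * gam (fun a => Q a μ) * U = majorana μ := by
    simp only [gam, Finset.mul_sum, Finset.sum_mul, mul_smul_comm, smul_mul_assoc, h.2.2,
      Finset.smul_sum, smul_smul]
    rw [Finset.sum_comm]
    simp only [← Finset.sum_smul]
    have h2 : ∀ ν, ∑ a, (Q a μ : ℂ) * (Q a ν : ℂ) = if μ = ν then 1 else 0 := by
      intro ν
      have := congrFun (congrFun hQ μ) ν
      rw [Matrix.mul_apply, Matrix.one_apply] at this
      simp only [Matrix.transpose_apply] at this
      split_ifs at this ⊢ <;> exact_mod_cast this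
    simp [h2]
  rw [← h1]
  calc U * (Uᴴ * gam (fun a => Q a μ) * U) * Uᴴ = (U * Uᴴ) * gam (fun a => Q a μ) * (U * Uᴴ) := by
        noncomm_ring
    _ = _ := by rw [h.mul_conjTranspose_self, one_mul, mul_one]

theorem IsFreeFermionicUnitary.conj_mul (h : IsFreeFermionicUnitary Q U) (A B : Op n) :
    U * (A * B) * Uᴴ = (U * A * Uᴴ) * (U * B * Uᴴ) := by
  calc U * (A * B) * Uᴴ = U * A * 1 * B * Uᴴ := by noncomm_ring
    _ = _ := by rw [← h.conjTranspose_mul_self]; noncomm_ring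

/-- Both parity and its conjugate anticommute with every Majorana operator, so their product is a
scalar by irreducibility; both square to one, which leaves a sign. -/
theorem IsFreeFermionicUnitary.conj_parity (h : IsFreeFermionicUnitary Q U) :
    ∃ ε : ℂ, (ε = 1 ∨ ε = -1) ∧ U * parity n * Uᴴ = ε • parity n := by
  have hcomm : ∀ μ, (parity n * (U * parity n * Uᴴ)) * majorana μ =
      majorana μ * (parity n * (U * parity n * Uᴴ)) := by
    intro μ
    have h1 : (Uᴴ * majorana μ * U) * parity n = -(parity n * (Uᴴ * majorana μ * U)) := by
      rw [h.2.2, ← gam, gam_mul_parity]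
    have h2 : (U * parity n * Uᴴ) * majorana μ = -(majorana μ * (U * parity n * Uᴴ)) := by
      calc (U * parity n * Uᴴ) * majorana μ
          = U * (parity n * (Uᴴ * majorana μ * U)) * Uᴴ := by
            rw [h.conj_mul]
            calc U * parity n * Uᴴ * majorana μ
                = U * parity n * Uᴴ * (1 * majorana μ * 1) := by noncomm_ring
              _ = _ := by rw [← h.mul_conjTranspose_self]; noncomm_ring
        _ = -(U * ((Uᴴ * majorana μ * U) * parity n) * Uᴴ) := by
            rw [h1]; noncomm_ring
        _ = -((U * Uᴴ) * majorana μ * (U * parity n * Uᴴ)) := by noncomm_ring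
        _ = _ := by rw [h.mul_conjTranspose_self, one_mul]
    rw [mul_assoc (parity n) (U * parity n * Uᴴ), h2, mul_neg,
      ← mul_assoc (parity n) (majorana μ), ← mul_assoc (majorana μ) (parity n),
      majorana_mul_parity, neg_mul]
  obtain ⟨c, hc⟩ := exists_smul_one_of_commute_majorana hcomm
  have hUP : U * parity n * Uᴴ = c • parity n := by
    calc U * parity n * Uᴴ = (parity n * parity n) * (U * parity n * Uᴴ) := by
          rw [parity_mul_self, one_mul]
      _ = parity n * (parity n * (U * parity n * Uᴴ)) := by rw [mul_assoc]
      _ = _ := by rw [hc, mul_smul_comm, mul_one]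
  refine ⟨c, ?_, hUP⟩
  have h3 := h.conj_mul (parity n) (parity n)
  rw [parity_mul_self, mul_one, h.mul_conjTranspose_self, hUP, smul_mul_smul_comm,
    parity_mul_self] at h3
  have h4 := congrFun (congrFun h3 0) 0
  rw [Matrix.smul_apply, Matrix.one_apply_eq, smul_eq_mul, mul_one] at h4
  exact mul_self_eq_one_iff.mp h4.symm

/-- Parity enters the wedge twice, so the sign `ε` drops out and improper `Q` is covered too. -/
theorem IsFreeFermionicUnitary.wedge_conj (h : IsFreeFermionicUnitary Q U) (μ : MajIdx n)
    (A : Op n) :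
    wedge (fun a => Q a μ) (U * A * Uᴴ) = U * wedge (Pi.single μ 1) A * Uᴴ := by
  obtain ⟨ε, hε, hP⟩ := h.conj_parity
  have hε2 : ε * ε = 1 := by rcases hε with rfl | rfl <;> norm_num
  have hP' : parity n = ε • (U * parity n * Uᴴ) := by rw [hP, smul_smul, hε2, one_smul]
  have h1 : parity n * (U * A * Uᴴ) * parity n = U * (parity n * A * parity n) * Uᴴ := by
    rw [h.conj_mul, h.conj_mul, hP, smul_mul_assoc, smul_mul_smul_comm, hε2, one_smul]
  rw [wedge_apply, wedge_apply, gam_single, h1, ← h.conj_majorana, ← h.conj_mul, ← h.conj_mul,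
    mul_smul_comm, smul_mul_assoc, mul_add, add_mul]

theorem IsFreeFermionicUnitary.biv_conj (h : IsFreeFermionicUnitary Q U) (μ ν : MajIdx n)
    (A : Op n) : biv (fun a => Q a μ) (fun a => Q a ν) (U * A * Uᴴ) =
      U * biv (Pi.single μ 1) (Pi.single ν 1) A * Uᴴ := by
  rw [biv, biv, LinearMap.smul_apply, LinearMap.smul_apply, Module.End.mul_apply,
    Module.End.mul_apply, h.wedge_conj, h.wedge_conj, mul_smul_comm, smul_mul_assoc]

/-- The product is even and commutes with both Majorana operators of the fresh mode `k`, so the four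
terms of the double wedge coincide and cancel the `1/4`. -/
theorem biv_zProd (lam : Fin n → ℝ) {s : Finset (Fin n)} {k : Fin n} (hk : k ∉ s) :
    biv (Pi.single (k, 0) 1) (Pi.single (k, 1) 1) (zProd lam s) = pauliZAt k * zProd lam s := by
  have h0 := zProd_commute_majorana lam (μ := (k, 0)) hk
  have h1 := zProd_commute_majorana lam (μ := (k, 1)) hk
  have hP : parity n * zProd lam s * parity n = zProd lam s := by
    rw [← zProd_commute_parity, mul_assoc, parity_mul_self, mul_one]
  rw [biv, LinearMap.smul_apply, Module.End.mul_apply, wedge_wedge_apply, hP, gam_single,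
    gam_single, pauliZAt_eq, smul_mul_assoc]
  congr 1
  have h2 := majorana_zero_one_anticommute k
  rw [mul_assoc _ (zProd lam s) (majorana (k, 1)), h1,
    mul_assoc _ (zProd lam s) (majorana (k, 0)), h0,
    ← mul_assoc (majorana (k, 0)) (majorana (k, 1)),
    ← mul_assoc (majorana (k, 1)) (majorana (k, 0)), ← neg_eq_iff_eq_neg.mpr h2, neg_mul,
    sub_neg_eq_add, sub_neg_eq_add]
  rw [← two_smul ℂ, add_assoc, ← two_smul ℂ, ← add_smul, smul_smul]
  norm_num

/-- Exponentials of square-zero bivectors are `1 + λ_j biv`, and applying them mode by mode builds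
the factors `1 + λ_j Z_j` in the rotated frame. In particular the state depends on `Q` and `λ` only
through the correlation matrix. -/
theorem IsFreeFermionicUnitary.gaussian_eq (h : IsFreeFermionicUnitary Q U) (lam : Fin n → ℝ) :
    gaussian (Q * blockMat lam * Qᵀ) =
      U * tensor (fun j => (1 / 2 : ℂ) • (1 + (lam j : ℂ) • pauliZ)) * Uᴴ := by
  have hs : ∀ s : Finset (Fin n), expEnd (∑ j ∈ s, (lam j : ℂ) •
      biv (fun a => Q a (j, 0)) (fun a => Q a (j, 1))) 1 = U * zProd lam s * Uᴴ := by
    intro s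
    induction s using Finset.induction_on with
    | empty => rw [Finset.sum_empty, expEnd_zero, Module.End.one_apply, zProd_empty, mul_one,
        h.mul_conjTranspose_self]
    | insert k s hk ih =>
      rw [Finset.sum_insert hk, expEnd_add, Module.End.mul_apply, ih,
        expEnd_of_mul_self_eq_zero, LinearMap.add_apply, Module.End.one_apply, LinearMap.smul_apply, h.biv_conj, biv_zProd lam hk, zProd_insert lam hk, mul_add, add_mul,
        mul_smul_comm, smul_mul_assoc]
      · rw [smul_mul_smul_comm, biv_mul_self, smul_zero]
      · exact Commute.sum_right _ _ _ fun j _ => ((biv_commute _ _ _ _).smul_left _).smul_right _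
  rw [gaussian, bivMat_conj_blockMat, map_smul, hs, zProd_univ, mul_smul_comm, smul_mul_assoc]

end Conjugation

end Gaussian

/-! ### Skew normal form and implementation of orthogonal matrices -/

section NormalForm

open Matrix
open scoped RealInnerProductSpace

variable {n : ℕ}

/-- The square `T²` is symmetric, and it is nonzero if `T` is. An eigenvector `e` with nonzero
eigenvalue spans an invariant plane together with `T e`. -/
theorem exists_invariant_plane {V : Type*} [NormedAddCommGroup V] [InnerProductSpace ℝ V]
    [FiniteDimensional ℝ V] (hV : 2 ≤ Module.finrank ℝ V) (T : V →ₗ[ℝ] V)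
    (hT : ∀ x y, ⟪T x, y⟫ = -⟪x, T y⟫) :
    ∃ (e f : V) (c : ℝ), ⟪e, e⟫ = 1 ∧ ⟪f, f⟫ = 1 ∧ ⟪e, f⟫ = 0 ∧ T f = c • e ∧ T e = -c • f := by
  have hself : ∀ x, ⟪x, T x⟫ = 0 := by
    intro x
    have := hT x x
    rw [real_inner_comm] at this
    linarith
  by_cases h0 : T = 0
  · have hb := (stdOrthonormalBasis ℝ V).orthonormal
    rw [orthonormal_iff_ite] at hb
    refine ⟨stdOrthonormalBasis ℝ V ⟨0, by omega⟩, stdOrthonormalBasis ℝ V ⟨1, by omega⟩, 0,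
      ?_, ?_, ?_, ?_, ?_⟩ <;> simp [h0]
  · have hS : (T ∘ₗ T).IsSymmetric := by
      intro x y
      rw [LinearMap.comp_apply, LinearMap.comp_apply, hT, hT, neg_neg]
    have hex : ∃ i, hS.eigenvalues rfl i ≠ 0 := by
      by_contra! hall
      apply h0
      have hTT : T ∘ₗ T = 0 := by
        refine (hS.eigenvectorBasis rfl).toBasis.ext fun i => ?_
        rw [OrthonormalBasis.coe_toBasis, hS.apply_eigenvectorBasis, hall]
        simp
      ext x
      have h1 : ⟪T x, T x⟫ = 0 := by
        rw [hT, ← LinearMap.comp_apply, hTT]; simp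
      rw [inner_self_eq_zero.mp h1, LinearMap.zero_apply]
    obtain ⟨i, hi⟩ := hex
    set e := hS.eigenvectorBasis rfl i
    set μ := hS.eigenvalues rfl i
    have he : ⟪e, e⟫ = 1 := by
      rw [real_inner_self_eq_norm_sq, (hS.eigenvectorBasis rfl).orthonormal.1 i, one_pow]
    have hTe : T (T e) = μ • e := hS.apply_eigenvectorBasis rfl i
    have hμ : ‖T e‖ ^ 2 = -μ := by
      rw [← real_inner_self_eq_norm_sq, hT, hTe, inner_smul_right, he, mul_one]
    have hc : ‖T e‖ ≠ 0 := by
      intro h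
      rw [h] at hμ
      apply hi; linarith
    -- The eigenvalue is `-‖T e‖²`; the minus sign in `f` gives `T f = +‖T e‖ e`, the orientation of
    -- `blockMat`.
    refine ⟨e, (-‖T e‖⁻¹) • T e, ‖T e‖, he, ?_, ?_, ?_, ?_⟩
    · rw [inner_smul_left, inner_smul_right, real_inner_self_eq_norm_sq]
      simp only [conj_trivial]
      field_simp
    · rw [inner_smul_right, hself, mul_zero]
    · rw [map_smul, hTe, smul_smul]
      congr 1
      have : μ = -(‖T e‖ ^ 2) := by linarith
      rw [this]; field_simp
    · rw [smul_smul]; field_simp; simp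

/-- The normal form of a skew-adjoint operator on an even-dimensional real space. -/
theorem exists_skew_normal_form : ∀ (n : ℕ) {V : Type*} [NormedAddCommGroup V]
    [InnerProductSpace ℝ V] [FiniteDimensional ℝ V] (_ : Module.finrank ℝ V = 2 * n)
    (T : V →ₗ[ℝ] V) (_ : ∀ x y, ⟪T x, y⟫ = -⟪x, T y⟫),
    ∃ (b : Fin n × Fin 2 → V) (lam : Fin n → ℝ), Orthonormal ℝ b ∧
      ∀ j, T (b (j, 1)) = lam j • b (j, 0) ∧ T (b (j, 0)) = -lam j • b (j, 1)
  | 0, V, _, _, _, _, T, _ => ⟨fun p => p.1.elim0, fun j => j.elim0,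
      ⟨fun p => p.1.elim0, fun p => p.1.elim0⟩, fun j => j.elim0⟩
  | n + 1, V, _, _, _, hV, T, hT => by
    obtain ⟨e, f, c, he, hf, hef, hTf, hTe⟩ := exists_invariant_plane (by omega) T hT
    have hfe : ⟪f, e⟫ = 0 := by rw [real_inner_comm, hef]
    set S : Submodule ℝ V := Submodule.span ℝ (Set.range ![e, f])
    have hon : Orthonormal ℝ ![e, f] := by
      rw [orthonormal_iff_ite]
      intro i j
      fin_cases i <;> fin_cases j <;> simp [he, hf, hef, hfe, -inner_self_eq_norm_sq_to_K]
    have hdim : Module.finrank ℝ S = 2 := by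
      rw [finrank_span_eq_card hon.linearIndependent, Fintype.card_fin]
    have hdim' : Module.finrank ℝ Sᗮ = 2 * n := by
      have := S.finrank_add_finrank_orthogonal
      omega
    have hmem : ∀ w, w ∈ Sᗮ ↔ ⟪e, w⟫ = 0 ∧ ⟪f, w⟫ = 0 := by
      intro w
      rw [Submodule.mem_orthogonal]
      constructor
      · intro h
        exact ⟨h e (Submodule.subset_span ⟨0, rfl⟩), h f (Submodule.subset_span ⟨1, rfl⟩)⟩
      · rintro ⟨h1, h2⟩ u hu
        induction hu using Submodule.span_induction with
        | mem x hx =>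
          obtain ⟨i, rfl⟩ := hx
          fin_cases i
          · exact h1
          · exact h2
        | zero => exact inner_zero_left _
        | add x y _ _ hx hy => rw [inner_add_left, hx, hy, add_zero]
        | smul a x _ hx => rw [inner_smul_left, hx, mul_zero]
    -- Skewness passes invariance from the plane to its orthogonal complement, where induction
    -- applies.
    have hinv : ∀ w ∈ Sᗮ, T w ∈ Sᗮ := by
      intro w hw
      obtain ⟨h1, h2⟩ := (hmem w).mp hw
      refine (hmem _).mpr ⟨?_, ?_⟩
      · rw [← neg_eq_iff_eq_neg.mpr (hT e w), hTe, inner_smul_left, h2, mul_zero, neg_zero]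
      · rw [← neg_eq_iff_eq_neg.mpr (hT f w), hTf, inner_smul_left, h1, mul_zero, neg_zero]
    obtain ⟨b, lam, hb, hTb⟩ := exists_skew_normal_form n hdim' (T.restrict hinv)
      fun x y => hT x y
    have hb' : ∀ p q, ⟪(b p : V), (b q : V)⟫ = if p = q then 1 else 0 :=
      fun p q => orthonormal_iff_ite.mp hb p q
    have heb : ∀ p, ⟪e, (b p : V)⟫ = 0 := fun p => ((hmem _).mp (b p).2).1
    have hfb : ∀ p, ⟪f, (b p : V)⟫ = 0 := fun p => ((hmem _).mp (b p).2).2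
    have hbe : ∀ p, ⟪(b p : V), e⟫ = 0 := fun p => by rw [real_inner_comm, heb]
    have hbf : ∀ p, ⟪(b p : V), f⟫ = 0 := fun p => by rw [real_inner_comm, hfb]
    refine ⟨fun p => Fin.cases (![e, f] p.2) (fun j => (b (j, p.2) : V)) p.1,
      Fin.cases c lam, ?_, ?_⟩
    · rw [orthonormal_iff_ite]
      rintro ⟨j, a⟩ ⟨k, d⟩
      induction j using Fin.cases with
      | zero =>
        induction k using Fin.cases with
        | zero => simpa using orthonormal_iff_ite.mp hon a d
        | succ k => fin_cases a <;> simp [heb, hfb, (Fin.succ_ne_zero k).symm]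
      | succ j =>
        induction k using Fin.cases with
        | zero => fin_cases d <;> simp [hbe, hbf, Fin.succ_ne_zero]
        | succ k => simpa using hb' (j, a) (k, d)
    · intro j
      induction j using Fin.cases with
      | zero => exact ⟨hTf, hTe⟩
      | succ j => exact ⟨congrArg Subtype.val (hTb j).1, congrArg Subtype.val (hTb j).2⟩

theorem exists_orthogonal_eq_conj_blockMat {K : Matrix (MajIdx n) (MajIdx n) ℝ} (hK : Kᵀ = -K) :
    ∃ Q ∈ Matrix.orthogonalGroup (MajIdx n) ℝ, ∃ lam : Fin n → ℝ,
      K = Q * blockMat lam * Qᵀ := by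
  have hinner : ∀ x y : EuclideanSpace ℝ (MajIdx n), ⟪x, y⟫ = x.ofLp ⬝ᵥ y.ofLp := by
    intro x y
    rw [EuclideanSpace.inner_eq_star_dotProduct, star_trivial, dotProduct_comm]
  obtain ⟨b, lam, hb, hT⟩ := exists_skew_normal_form n (V := EuclideanSpace ℝ (MajIdx n))
    (by simp [mul_comm]) (Matrix.toEuclideanLin K) (by
      intro x y
      rw [hinner, hinner, Matrix.toLpLin_apply, Matrix.toLpLin_apply]
      change K *ᵥ x.ofLp ⬝ᵥ y.ofLp = -(x.ofLp ⬝ᵥ K *ᵥ y.ofLp)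
      rw [Matrix.dotProduct_mulVec, ← Matrix.mulVec_transpose, hK, Matrix.neg_mulVec,
        neg_dotProduct, neg_neg])
  rw [orthonormal_iff_ite] at hb
  set Q : Matrix (MajIdx n) (MajIdx n) ℝ := Matrix.of fun a μ => (b μ).ofLp a with hQdef
  have hQ : Qᵀ * Q = 1 := by
    ext μ ν
    have h := hb μ ν
    rw [hinner] at h
    rw [Matrix.mul_apply, Matrix.one_apply, ← h]
    rfl
  have hQ' : Q * Qᵀ = 1 := mul_eq_one_comm.mp hQ
  refine ⟨Q, (Matrix.mem_orthogonalGroup_iff' _ _).mpr hQ, lam, ?_⟩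
  have hKQ : K * Q = Q * blockMat lam := by
    ext a ν
    obtain ⟨j, i⟩ := ν
    have h1 : ∀ μ, (K * Q) a μ = (Matrix.toEuclideanLin K (b μ)).ofLp a := fun μ => rfl
    rw [h1, Matrix.mul_apply, Fintype.sum_prod_type, Finset.sum_eq_single j]
    · fin_cases i
      · have := (hT j).2
        simp only [Fin.zero_eta, this, Fin.sum_univ_two]
        simp [blockMat, Q, mul_comm]
      · have := (hT j).1
        simp only [Fin.mk_one, this, Fin.sum_univ_two]
        simp [blockMat, Q, mul_comm]
    · intro k _ hk
      simp [blockMat, hk]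
    · simp
  rw [← hKQ, mul_assoc, hQ', mul_one]

/-- Every reflection, hence every orthogonal transformation, is implemented by a unitary. -/
theorem exists_unitary_conj_gam (l : List (EuclideanSpace ℝ (MajIdx n))) :
    ∃ U ∈ Matrix.unitaryGroup (Basis n) ℂ, ∀ x : EuclideanSpace ℝ (MajIdx n),
      Uᴴ * gam x.ofLp * U =
        gam ((l.map fun v => (ℝ ∙ v)ᗮ.reflection).prod x).ofLp := by
  induction l with
  | nil => exact ⟨1, one_mem _, fun x => by simp⟩
  | cons v l ih =>
    obtain ⟨U, hU, hUx⟩ := ih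
    have hv : ∃ W ∈ Matrix.unitaryGroup (Basis n) ℂ, ∀ x : EuclideanSpace ℝ (MajIdx n),
        Wᴴ * gam x.ofLp * W = gam ((ℝ ∙ v)ᗮ.reflection x).ofLp := by
      -- The list may contain zero vectors; their reflection is the identity.
      by_cases h0 : v = 0
      · refine ⟨1, one_mem _, fun x => ?_⟩
        have : (ℝ ∙ v)ᗮ.reflection x = x := by
          apply Submodule.reflection_mem_subspace_eq_self
          rw [Submodule.mem_orthogonal_singleton_iff_inner_right, h0, inner_zero_left]
        rw [this]; simp
      · set w := (‖v‖⁻¹ : ℝ) • v with hw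
        have hv0 : ‖v‖ ≠ 0 := norm_ne_zero_iff.mpr h0
        have hww : w.ofLp ⬝ᵥ w.ofLp = 1 := by
          have : ⟪w, w⟫ = 1 := by
            rw [hw, inner_smul_left, inner_smul_right, real_inner_self_eq_norm_sq]
            simp only [conj_trivial]; field_simp
          rw [← this, EuclideanSpace.inner_eq_star_dotProduct, star_trivial]
        -- Conjugation by `γ(w)` alone implements minus the reflection; the parity factor corrects
        -- the sign.
        refine ⟨gam w.ofLp * parity n,
          mul_mem (gam_mem_unitaryGroup hww) parity_mem_unitaryGroup, fun x => ?_⟩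
        have hrefl : ((ℝ ∙ v)ᗮ.reflection x).ofLp =
            x.ofLp - (2 * (w.ofLp ⬝ᵥ x.ofLp)) • w.ofLp := by
          rw [Submodule.reflection_orthogonal_apply, Submodule.reflection_singleton_apply]
          have : ⟪v, x⟫ = ‖v‖ * (w.ofLp ⬝ᵥ x.ofLp) := by
            rw [EuclideanSpace.inner_eq_star_dotProduct, star_trivial, hw, WithLp.ofLp_smul,
              smul_dotProduct, smul_eq_mul, dotProduct_comm]
            field_simp
          rw [this]
          ext a
          simp [hw]
          field_simp
        have hsub : ∀ (y z : MajIdx n → ℝ) (c : ℝ), gam (y - c • z) = gam y - (c : ℂ) • gam z := by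
          intro y z c
          simp only [gam, Finset.smul_sum, ← Finset.sum_sub_distrib, Pi.sub_apply, Pi.smul_apply,
            smul_eq_mul, Complex.ofReal_sub, Complex.ofReal_mul, sub_smul, smul_smul]
        rw [hrefl, hsub, Matrix.conjTranspose_mul, parity_conjTranspose, gam_conjTranspose]
        have h1 : gam w.ofLp * gam x.ofLp * gam w.ofLp =
            ((2 * (w.ofLp ⬝ᵥ x.ofLp) : ℝ) : ℂ) • gam w.ofLp - gam x.ofLp := by
          rw [eq_sub_of_add_eq (gam_mul_add w.ofLp x.ofLp), sub_mul, smul_mul_assoc, one_mul,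
            mul_assoc, gam_mul_self, hww]
          simp
        have h2 : ∀ y : MajIdx n → ℝ, parity n * gam y * parity n = -gam y := by
          intro y
          rw [mul_assoc, gam_mul_parity, mul_neg, ← mul_assoc, parity_mul_self, one_mul]
        calc parity n * gam w.ofLp * gam x.ofLp * (gam w.ofLp * parity n)
            = parity n * (gam w.ofLp * gam x.ofLp * gam w.ofLp) * parity n := by noncomm_ring
          _ = _ := by
            rw [h1, mul_sub, sub_mul, mul_smul_comm, smul_mul_assoc, h2, h2, smul_neg]
            abel
    obtain ⟨W, hW, hWx⟩ := hv
    refine ⟨U * W, mul_mem hU hW, fun x => ?_⟩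
    rw [List.map_cons, List.prod_cons, LinearIsometryEquiv.coe_mul, Function.comp_apply, ← hWx, ← hUx,
      Matrix.conjTranspose_mul]
    noncomm_ring

/-- By Cartan–Dieudonné an orthogonal map is a product of reflections. It is applied to `Qᵀ`, which
sends `e_μ` to row `μ` of `Q`, as the definition requires. -/
theorem exists_isFreeFermionicUnitary {Q : Matrix (MajIdx n) (MajIdx n) ℝ}
    (hQ : Q ∈ Matrix.orthogonalGroup (MajIdx n) ℝ) : ∃ U : Op n, IsFreeFermionicUnitary Q U := by
  have hQQ : Q * Qᵀ = 1 := (Matrix.mem_orthogonalGroup_iff _ _).mp hQ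
  have hnorm : ∀ x y : EuclideanSpace ℝ (MajIdx n),
      ⟪Matrix.toEuclideanLin Qᵀ x, Matrix.toEuclideanLin Qᵀ y⟫ = ⟪x, y⟫ := by
    intro x y
    rw [EuclideanSpace.inner_eq_star_dotProduct, EuclideanSpace.inner_eq_star_dotProduct,
      star_trivial, star_trivial]
    change Qᵀ *ᵥ y.ofLp ⬝ᵥ Qᵀ *ᵥ x.ofLp = y.ofLp ⬝ᵥ x.ofLp
    rw [Matrix.dotProduct_mulVec, ← Matrix.mulVec_transpose, Matrix.transpose_transpose,
      Matrix.mulVec_mulVec, hQQ, Matrix.one_mulVec]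
  set φ := ((Matrix.toEuclideanLin Qᵀ).isometryOfInner hnorm).toLinearIsometryEquiv rfl
  obtain ⟨l, -, hl⟩ := φ.reflections_generate_dim
  obtain ⟨U, hU, hUx⟩ := exists_unitary_conj_gam l
  refine ⟨U, hQ, hU, fun μ => ?_⟩
  have h := hUx (WithLp.toLp 2 (Pi.single μ 1))
  rw [← hl, gam_single] at h
  rw [h, gam]
  refine Finset.sum_congr rfl fun ν _ => ?_
  congr 2
  change (Qᵀ *ᵥ Pi.single μ 1) ν = Q μ ν
  simp

end NormalForm

/-! ### Free-fermionic states and skew contractions -/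

section States

open Matrix

variable {n : ℕ}

/-- The product state `⨂_j (I + λ_j Z_j) / 2`. -/
noncomputable def zState (lam : Fin n → ℝ) : Op n :=
  tensor fun j => (1 / 2 : ℂ) • (1 + (lam j : ℂ) • pauliZ)

theorem zState_eq_diagonal (lam : Fin n → ℝ) :
    zState lam = Matrix.diagonal fun x : Basis n =>
      ((∏ j, (1 + lam j * (-1) ^ (x j : ℕ)) / 2 : ℝ) : ℂ) := by
  have : (fun j => (1 / 2 : ℂ) • (1 + (lam j : ℂ) • pauliZ)) = fun j => Matrix.diagonal
      fun i : Fin 2 => (((1 + lam j * (-1) ^ (i : ℕ)) / 2 : ℝ) : ℂ) := by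
    ext1 j
    rw [pauliZ_eq_diagonal]
    ext a b
    fin_cases a <;> fin_cases b <;> simp <;> ring
  rw [zState, this, tensor_diagonal]
  congr 1; ext x; push_cast; rfl

theorem zState_posSemidef {lam : Fin n → ℝ} (h : ∀ j, |lam j| ≤ 1) : (zState lam).PosSemidef := by
  rw [zState_eq_diagonal, Matrix.posSemidef_diagonal_iff]
  intro x
  rw [Complex.zero_le_real]
  refine Finset.prod_nonneg fun j _ => ?_
  have := abs_le.mp (h j)
  rcases Nat.even_or_odd (x j : ℕ) with hx | hx
  · rw [hx.neg_one_pow]; linarith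
  · rw [hx.neg_one_pow]; linarith

theorem trace_pauliZ : pauliZ.trace = 0 := by simp [Matrix.trace, pauliZ]

theorem trace_half_one_add_pauliZ (c : ℂ) : ((1 / 2 : ℂ) • (1 + c • pauliZ)).trace = 1 := by
  simp [trace_pauliZ]

theorem trace_pauliZ_mul_half_one_add_pauliZ (c : ℂ) :
    (pauliZ * ((1 / 2 : ℂ) • (1 + c • pauliZ))).trace = c := by
  rw [mul_smul_comm, mul_add, mul_smul_comm, pauliZ_mul_self, mul_one, Matrix.trace_smul,
    Matrix.trace_add, Matrix.trace_smul, trace_pauliZ]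
  simp [mul_comm c]

theorem trace_zState (lam : Fin n → ℝ) : (zState lam).trace = 1 := by
  rw [zState, trace_tensor]
  exact Finset.prod_eq_one fun j _ => trace_half_one_add_pauliZ _

theorem trace_pauliZAt_mul_zState (lam : Fin n → ℝ) (k : Fin n) :
    (pauliZAt k * zState lam).trace = lam k := by
  rw [pauliZAt, zState, tensor_mul, trace_tensor, Finset.prod_eq_single k]
  · rw [if_pos rfl, trace_pauliZ_mul_half_one_add_pauliZ]
  · intro j _ hj
    rw [if_neg hj, one_mul, trace_half_one_add_pauliZ]
  · simp

theorem pauliZAt_mul_self (k : Fin n) : pauliZAt k * pauliZAt k = 1 := by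
  rw [pauliZAt, tensor_mul, ← tensor_one]
  congr 1; ext1 j; split_ifs <;> simp [pauliZ_mul_self]

theorem pauliZAt_mul_zState (lam : Fin n → ℝ) (k : Fin n) :
    pauliZAt k * zState lam = zState lam * pauliZAt k := by
  rw [pauliZAt_eq_diagonal, zState_eq_diagonal, Matrix.diagonal_mul_diagonal,
    Matrix.diagonal_mul_diagonal]
  congr 1; ext x; ring

theorem majorana_mul_pauliZAt_self (μ : MajIdx n) :
    majorana μ * pauliZAt μ.1 = -(pauliZAt μ.1 * majorana μ) := by
  refine tensor_anticommute μ.1 ?_ fun j hj => ?_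
  · change majoranaFactor μ μ.1 * (if μ.1 = μ.1 then pauliZ else 1) =
      -((if μ.1 = μ.1 then pauliZ else 1) * majoranaFactor μ μ.1)
    rw [if_pos rfl]; exact majoranaFactor_mul_pauliZ μ
  · change majoranaFactor μ j * (if j = μ.1 then pauliZ else 1) =
      (if j = μ.1 then pauliZ else 1) * majoranaFactor μ j
    rw [if_neg hj, mul_one, one_mul]

theorem majorana_mul_pauliZAt_of_ne {μ : MajIdx n} {k : Fin n} (h : k ≠ μ.1) :
    majorana μ * pauliZAt k = pauliZAt k * majorana μ := by
  refine tensor_commute fun j => ?_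
  by_cases hj : j = k
  · rw [if_pos hj]; exact majoranaFactor_commute_pauliZ (hj ▸ h)
  · rw [if_neg hj, mul_one, one_mul]

theorem trace_eq_zero_of_conj_eq_neg {ι : Type} [Fintype ι] [DecidableEq ι] {Z A : Matrix ι ι ℂ}
    (hZ : Z * Z = 1) (h : Z * A * Z = -A) : A.trace = 0 := by
  have h1 := congrArg Matrix.trace h
  rw [Matrix.trace_mul_cycle, hZ, one_mul, Matrix.trace_neg] at h1
  exact self_eq_neg.mp h1

theorem conj_mul_mul_eq_neg {R : Type*} [Ring R] {Z A B D : R} (hZ : Z * Z = 1)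
    (hA : A * Z = -(Z * A)) (hB : B * Z = Z * B) (hD : Z * D = D * Z) :
    Z * (A * B * D) * Z = -(A * B * D) := by
  calc Z * (A * B * D) * Z = Z * A * B * (D * Z) := by noncomm_ring
    _ = Z * A * (B * Z) * D := by rw [← hD]; noncomm_ring
    _ = Z * (A * Z) * B * D := by rw [hB]; noncomm_ring
    _ = -((Z * Z) * (A * B * D)) := by rw [hA]; noncomm_ring
    _ = _ := by rw [hZ, one_mul]

/-- Conjugation by `Z` on the qubit of `μ` flips `γ_μ` and fixes `γ_ν` and the state, so the trace
equals its negative. -/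
theorem trace_majorana_mul_majorana_mul_zState {μ ν : MajIdx n} (h : μ.1 ≠ ν.1) (lam : Fin n → ℝ) :
    (majorana μ * majorana ν * zState lam).trace = 0 :=
  trace_eq_zero_of_conj_eq_neg (pauliZAt_mul_self μ.1)
    (conj_mul_mul_eq_neg (pauliZAt_mul_self μ.1) (majorana_mul_pauliZAt_self μ)
      (majorana_mul_pauliZAt_of_ne h) (pauliZAt_mul_zState lam μ.1))

theorem trace_commutator_mul_zState (μ ν : MajIdx n) (lam : Fin n → ℝ) :
    ((majorana μ * majorana ν - majorana ν * majorana μ) * zState lam).trace =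
      2 * Complex.I * (blockMat lam μ ν : ℝ) := by
  by_cases h : μ.1 = ν.1
  · obtain ⟨k, a⟩ := μ
    obtain ⟨l, b⟩ := ν
    obtain rfl : k = l := h
    have h01 : ((majorana (k, 0) * majorana (k, 1)) * zState lam).trace = Complex.I * lam k := by
      rw [majorana_zero_mul_one, smul_mul_assoc, Matrix.trace_smul, trace_pauliZAt_mul_zState,
        smul_eq_mul]
    have h10 : ((majorana (k, 1) * majorana (k, 0)) * zState lam).trace =
        -(Complex.I * lam k) := by
      rw [← neg_eq_iff_eq_neg.mpr (majorana_zero_one_anticommute k), neg_mul, Matrix.trace_neg, h01]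
    fin_cases a <;> fin_cases b
    · simp [blockMat]
    · simp only [Fin.zero_eta, Fin.mk_one, sub_mul, Matrix.trace_sub, h01, h10]
      simp [blockMat]; ring
    · simp only [Fin.zero_eta, Fin.mk_one, sub_mul, Matrix.trace_sub, h01, h10]
      simp [blockMat]; ring
    · simp [blockMat]
  · rw [sub_mul, Matrix.trace_sub, trace_majorana_mul_majorana_mul_zState h,
      trace_majorana_mul_majorana_mul_zState (Ne.symm h)]
    simp [blockMat, h]

theorem IsFreeFermionicUnitary.corrMatrix_eq {Q : Matrix (MajIdx n) (MajIdx n) ℝ} {U : Op n}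
    (h : IsFreeFermionicUnitary Q U) (lam : Fin n → ℝ) :
    corrMatrix (U * zState lam * Uᴴ) = (Q * blockMat lam * Qᵀ).map ((↑) : ℝ → ℂ) := by
  ext a b
  have h1 : ∀ μ ν, Uᴴ * (majorana μ * majorana ν) * U =
      ∑ α, ∑ β, ((Q μ α * Q ν β : ℝ) : ℂ) • (majorana α * majorana β) := by
    intro μ ν
    have : Uᴴ * (majorana μ * majorana ν) * U =
        (Uᴴ * majorana μ * U) * (Uᴴ * majorana ν * U) := by
      calc Uᴴ * (majorana μ * majorana ν) * U = Uᴴ * majorana μ * 1 * majorana ν * U := by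
            noncomm_ring
        _ = _ := by rw [← h.mul_conjTranspose_self]; noncomm_ring
    rw [this, h.2.2, h.2.2, Finset.sum_mul_sum]
    simp only [smul_mul_smul_comm, Complex.ofReal_mul]
  have h2 : ((majorana a * majorana b - majorana b * majorana a) * (U * zState lam * Uᴴ)).trace =
      ∑ α, ∑ β, ((Q a α * Q b β : ℝ) : ℂ) *
        ((majorana α * majorana β - majorana β * majorana α) * zState lam).trace := by
    calc _ = ((Uᴴ * (majorana a * majorana b) * U - Uᴴ * (majorana b * majorana a) * U) *
        zState lam).trace := by
          rw [← sub_mul, ← mul_sub, ← mul_assoc, Matrix.trace_mul_comm]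
          congr 1; noncomm_ring
      _ = _ := by
          rw [h1, h1, Finset.sum_comm (f := fun α β => ((Q b α * Q a β : ℝ) : ℂ) •
            (majorana α * majorana β)), ← Finset.sum_sub_distrib]
          simp only [← Finset.sum_sub_distrib, Finset.sum_mul, Matrix.trace_sum]
          refine Finset.sum_congr rfl fun α _ => Finset.sum_congr rfl fun β _ => ?_
          rw [mul_comm (Q b β), ← smul_sub, smul_mul_assoc, Matrix.trace_smul, smul_eq_mul]
  rw [corrMatrix, Matrix.of_apply, h2, Matrix.map_apply, mul_mul_transpose_apply]
  simp only [trace_commutator_mul_zState]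
  push_cast
  rw [Finset.mul_sum]
  refine Finset.sum_congr rfl fun α _ => ?_
  rw [Finset.mul_sum]
  refine Finset.sum_congr rfl fun β _ => ?_
  linear_combination (-(Q a α : ℂ) * Q b β * (blockMat lam α β : ℝ)) * Complex.I_mul_I

/-- The real matrix `K` does not increase the Euclidean norm. -/
def IsContraction (K : Matrix (MajIdx n) (MajIdx n) ℝ) : Prop :=
  ∀ x, K *ᵥ x ⬝ᵥ K *ᵥ x ≤ x ⬝ᵥ x

theorem blockMat_mulVec_zero (lam : Fin n → ℝ) (x : MajIdx n → ℝ) (j : Fin n) :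
    (blockMat lam *ᵥ x) (j, 0) = lam j * x (j, 1) := by
  rw [Matrix.mulVec, dotProduct, Fintype.sum_prod_type, Finset.sum_eq_single j]
  · simp [blockMat]
  · intro k _ hk; simp [blockMat, hk.symm]
  · simp

theorem blockMat_mulVec_one (lam : Fin n → ℝ) (x : MajIdx n → ℝ) (j : Fin n) :
    (blockMat lam *ᵥ x) (j, 1) = -(lam j * x (j, 0)) := by
  rw [Matrix.mulVec, dotProduct, Fintype.sum_prod_type, Finset.sum_eq_single j]
  · simp [blockMat]
  · intro k _ hk; simp [blockMat, hk.symm]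
  · simp

theorem orthogonal_mulVec_dotProduct {Q : Matrix (MajIdx n) (MajIdx n) ℝ} (hQ : Qᵀ * Q = 1)
    (x y : MajIdx n → ℝ) : Q *ᵥ x ⬝ᵥ Q *ᵥ y = x ⬝ᵥ y := by
  rw [Matrix.dotProduct_mulVec, ← Matrix.mulVec_transpose, Matrix.mulVec_mulVec, hQ,
    Matrix.one_mulVec]

/-- Turns the bound on the `λ_j` into a condition on the correlation matrix alone, which unlike the
normal form is visibly convex. -/
theorem isContraction_conj_blockMat_iff {Q : Matrix (MajIdx n) (MajIdx n) ℝ} (hQ : Qᵀ * Q = 1)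
    (lam : Fin n → ℝ) : IsContraction (Q * blockMat lam * Qᵀ) ↔ ∀ j, |lam j| ≤ 1 := by
  have hQ' : Q * Qᵀ = 1 := mul_eq_one_comm.mp hQ
  have hsq : ∀ x : MajIdx n → ℝ, blockMat lam *ᵥ x ⬝ᵥ blockMat lam *ᵥ x =
      ∑ j, lam j ^ 2 * (x (j, 0) ^ 2 + x (j, 1) ^ 2) := by
    intro x
    rw [dotProduct, Fintype.sum_prod_type]
    refine Finset.sum_congr rfl fun j _ => ?_
    rw [Fin.sum_univ_two, blockMat_mulVec_zero, blockMat_mulVec_one]; ring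
  have hsq1 : ∀ x : MajIdx n → ℝ, x ⬝ᵥ x = ∑ j, (x (j, 0) ^ 2 + x (j, 1) ^ 2) := by
    intro x
    rw [dotProduct, Fintype.sum_prod_type]
    refine Finset.sum_congr rfl fun j _ => ?_
    rw [Fin.sum_univ_two]; ring
  constructor
  · intro h j
    have h1 := h (Q *ᵥ Pi.single (j, 0) 1)
    rw [Matrix.mulVec_mulVec, mul_assoc, hQ, mul_one, ← Matrix.mulVec_mulVec,
      orthogonal_mulVec_dotProduct hQ, orthogonal_mulVec_dotProduct hQ, hsq] at h1
    rw [Finset.sum_eq_single j] at h1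
    · simp at h1; exact h1
    · intro k _ hk; simp [hk]
    · simp
  · intro h x
    rw [← Matrix.mulVec_mulVec, ← Matrix.mulVec_mulVec, orthogonal_mulVec_dotProduct hQ, hsq]
    have h1 : x ⬝ᵥ x = Qᵀ *ᵥ x ⬝ᵥ Qᵀ *ᵥ x :=
      (orthogonal_mulVec_dotProduct (by rw [Matrix.transpose_transpose, hQ']) x x).symm
    rw [h1, hsq1]
    refine Finset.sum_le_sum fun j _ => mul_le_of_le_one_left (by positivity) ?_
    exact (sq_le_one_iff_abs_le_one _).mpr (h j)

theorem IsContraction.convex_combination {K L : Matrix (MajIdx n) (MajIdx n) ℝ}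
    (hK : IsContraction K) (hL : IsContraction L) {t : ℝ} (h0 : 0 ≤ t) (h1 : t ≤ 1) :
    IsContraction (t • (K - L) + L) := by
  intro x
  have h2 : (t • (K - L) + L) *ᵥ x = t • (K *ᵥ x) + (1 - t) • (L *ᵥ x) := by
    rw [Matrix.add_mulVec, Matrix.smul_mulVec, Matrix.sub_mulVec, smul_sub, sub_smul, one_smul]
    abel
  rw [h2]
  have h3 : (t • (K *ᵥ x) + (1 - t) • (L *ᵥ x)) ⬝ᵥ (t • (K *ᵥ x) + (1 - t) • (L *ᵥ x)) ≤
      t * (K *ᵥ x ⬝ᵥ K *ᵥ x) + (1 - t) * (L *ᵥ x ⬝ᵥ L *ᵥ x) := by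
    simp only [dotProduct, Finset.mul_sum, ← Finset.sum_add_distrib]
    refine Finset.sum_le_sum fun i _ => ?_
    simp only [Pi.add_apply, Pi.smul_apply, smul_eq_mul]
    nlinarith [mul_nonneg (mul_nonneg h0 (sub_nonneg.mpr h1))
      (sq_nonneg ((K *ᵥ x) i - (L *ᵥ x) i))]
  nlinarith [hK x, hL x]

theorem transpose_blockMat (lam : Fin n → ℝ) : (blockMat lam)ᵀ = -blockMat lam := by
  ext ⟨j, a⟩ ⟨k, b⟩
  by_cases h : j = k
  · subst h; fin_cases a <;> fin_cases b <;> simp [blockMat]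
  · simp [blockMat, h, Ne.symm h]

theorem transpose_conj_blockMat (Q : Matrix (MajIdx n) (MajIdx n) ℝ) (lam : Fin n → ℝ) :
    (Q * blockMat lam * Qᵀ)ᵀ = -(Q * blockMat lam * Qᵀ) := by
  rw [Matrix.transpose_mul, Matrix.transpose_mul, Matrix.transpose_transpose, transpose_blockMat]
  noncomm_ring

theorem IsFreeFermionicState.exists_gaussian {ρ : Op n} (h : IsFreeFermionicState ρ) :
    ∃ K : Matrix (MajIdx n) (MajIdx n) ℝ, Kᵀ = -K ∧ IsContraction K ∧ ρ = gaussian K ∧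
      corrMatrix ρ = K.map ((↑) : ℝ → ℂ) := by
  obtain ⟨Q, U, lam, hU, hlam, rfl⟩ := h
  exact ⟨Q * blockMat lam * Qᵀ, transpose_conj_blockMat Q lam,
    (isContraction_conj_blockMat_iff hU.transpose_mul_self lam).mpr hlam,
    (hU.gaussian_eq lam).symm, hU.corrMatrix_eq lam⟩

/-- Needed for the interior points of a segment between two correlation matrices, which do not come
with a state. -/
theorem gaussian_posSemidef_and_trace {K : Matrix (MajIdx n) (MajIdx n) ℝ} (hK : Kᵀ = -K)
    (hc : IsContraction K) : (gaussian K).PosSemidef ∧ (gaussian K).trace = 1 := by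
  obtain ⟨Q, hQ, lam, rfl⟩ := exists_orthogonal_eq_conj_blockMat hK
  obtain ⟨U, hU⟩ := exists_isFreeFermionicUnitary hQ
  have hlam := (isContraction_conj_blockMat_iff hU.transpose_mul_self lam).mp hc
  rw [hU.gaussian_eq lam, ← zState]
  refine ⟨(zState_posSemidef hlam).mul_mul_conjTranspose_same U, ?_⟩
  rw [Matrix.trace_mul_cycle, hU.conjTranspose_mul_self, one_mul, trace_zState]

end States

/-! ### The trace norm bound along a segment -/

section TraceNorm

open Matrix

variable {n : ℕ}

theorem schattenNorm_one_conj_blockMat {Q : Matrix (MajIdx n) (MajIdx n) ℝ} (hQ : Qᵀ * Q = 1)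
    (lam : Fin n → ℝ) :
    schattenNorm 1 ((Q * blockMat lam * Qᵀ).map ((↑) : ℝ → ℂ)) = 2 * ∑ j, |lam j| := by
  set D : Matrix (MajIdx n) (MajIdx n) ℝ := Matrix.diagonal fun μ => |lam μ.1|
  have hmap : ∀ A : Matrix (MajIdx n) (MajIdx n) ℝ,
      A.map ((↑) : ℝ → ℂ) = Complex.ofRealHom.mapMatrix A := fun A => rfl
  have hconj : ∀ A : Matrix (MajIdx n) (MajIdx n) ℝ,
      (A.map ((↑) : ℝ → ℂ))ᴴ = Aᵀ.map ((↑) : ℝ → ℂ) := by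
    intro A; ext i j; simp [Matrix.conjTranspose_apply]
  have hBB : (blockMat lam)ᵀ * blockMat lam = D * D := by
    rw [Matrix.diagonal_mul_diagonal]
    ext ⟨j, a⟩ ⟨k, b⟩
    rw [Matrix.mul_apply, Fintype.sum_prod_type, Finset.sum_eq_single j]
    · by_cases h : j = k
      · subst h; fin_cases a <;> fin_cases b <;> simp [blockMat]
      · simp [blockMat, h]
    · intro l _ hl; simp [blockMat, hl]
    · simp
  rw [schattenNorm_one_of_sq (S := (Q * D * Qᵀ).map ((↑) : ℝ → ℂ))]
  · have h1 : ((Q * D * Qᵀ).map ((↑) : ℝ → ℂ)).trace = ((Q * D * Qᵀ).trace : ℝ) := by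
      simp [Matrix.trace]
    rw [h1, Complex.ofReal_re, Matrix.trace_mul_cycle, hQ, one_mul, Matrix.trace_diagonal,
      Fintype.sum_prod_type, Finset.mul_sum]
    refine Finset.sum_congr rfl fun j _ => ?_
    rw [Fin.sum_univ_two]; ring
  · rw [hmap, map_mul, map_mul, ← hmap Qᵀ, ← hconj, ← hmap]
    refine Matrix.PosSemidef.mul_mul_conjTranspose_same ?_ _
    have : Complex.ofRealHom.mapMatrix D =
        Matrix.diagonal fun μ : MajIdx n => ((|lam μ.1| : ℝ) : ℂ) := by
      ext i j; by_cases h : i = j <;> simp [D, h]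
    rw [this, Matrix.posSemidef_diagonal_iff]
    intro μ; exact_mod_cast abs_nonneg _
  · rw [hconj, hmap, hmap, hmap, ← map_mul, ← map_mul]
    congr 1
    rw [Matrix.transpose_mul, Matrix.transpose_mul, Matrix.transpose_transpose]
    calc Q * D * Qᵀ * (Q * D * Qᵀ) = Q * D * (Qᵀ * Q) * D * Qᵀ := by noncomm_ring
      _ = Q * (D * D) * Qᵀ := by rw [hQ]; noncomm_ring
      _ = Q * (blockMat lam)ᵀ * 1 * blockMat lam * Qᵀ := by rw [← hBB]; noncomm_ring
      _ = _ := by rw [← hQ]; noncomm_ring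

/-- Up to phases, the double wedge averages four terms `A G B` with `A`, `B` unitary: `γ(x)`, `γ(y)`
and parity are all unitary for unit vectors. By cyclicity each is a unitary tested against `G`. -/
theorem norm_trace_mul_biv_le {W G : Op n} (hW : W ∈ Matrix.unitaryGroup (Basis n) ℂ)
    (hG : G.PosSemidef) {x y : MajIdx n → ℝ} (hx : x ⬝ᵥ x = 1) (hy : y ⬝ᵥ y = 1) :
    ‖(W * biv x y G).trace‖ ≤ G.trace.re := by
  have hgx := gam_mem_unitaryGroup hx
  have hgy := gam_mem_unitaryGroup hy
  have hP := parity_mem_unitaryGroup (n := n)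
  have key : ∀ A B : Op n, A ∈ Matrix.unitaryGroup (Basis n) ℂ →
      B ∈ Matrix.unitaryGroup (Basis n) ℂ → ‖(W * (A * G * B)).trace‖ ≤ G.trace.re := by
    intro A B hA hB
    have : (W * (A * G * B)).trace = (B * W * A * G).trace := by
      rw [← mul_assoc, Matrix.trace_mul_comm]; congr 1; noncomm_ring
    rw [this]
    exact norm_trace_unitary_mul_le (mul_mem (mul_mem hB hW) hA) hG
  have h1 := key (gam x * gam y) 1 (mul_mem hgx hgy) (one_mem _)
  have h2 := key (gam x * parity n) (parity n * gam y) (mul_mem hgx hP) (mul_mem hP hgy)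
  have h3 := key (gam y * parity n) (parity n * gam x) (mul_mem hgy hP) (mul_mem hP hgx)
  have h4 := key 1 (gam y * gam x) (one_mem _) (mul_mem hgy hgx)
  have hexp : (W * biv x y G).trace = (-Complex.I * (1 / 4)) *
      ((W * (gam x * gam y * G * 1)).trace
        + (W * (gam x * parity n * G * (parity n * gam y))).trace
        - (W * (gam y * parity n * G * (parity n * gam x))).trace
        - (W * (1 * G * (gam y * gam x))).trace) := by
    rw [biv, LinearMap.smul_apply, Module.End.mul_apply, wedge_wedge_apply, smul_smul,
      mul_smul_comm, Matrix.trace_smul, smul_eq_mul, ← Matrix.trace_add, ← Matrix.trace_sub,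
      ← Matrix.trace_sub, ← mul_add, ← mul_sub, ← mul_sub]
    congr 4 <;> noncomm_ring
  rw [hexp, norm_mul]
  have hn : ‖-Complex.I * (1 / 4)‖ = 1 / 4 := by simp
  rw [hn]
  refine (mul_le_mul_of_nonneg_left ((norm_sub_le _ _).trans
    (add_le_add_left ((norm_sub_le _ _).trans
      (add_le_add_left (norm_add_le _ _) _)) _)) (by norm_num)).trans ?_
  linarith

theorem norm_trace_mul_bivMat_le {W G : Op n} (hW : W ∈ Matrix.unitaryGroup (Basis n) ℂ)
    (hG : G.PosSemidef) {X : Matrix (MajIdx n) (MajIdx n) ℝ} (hX : Xᵀ = -X) :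
    ‖(W * bivMat X G).trace‖ ≤ 1 / 2 * schattenNorm 1 (X.map ((↑) : ℝ → ℂ)) * G.trace.re := by
  obtain ⟨Q, hQ, lam, rfl⟩ := exists_orthogonal_eq_conj_blockMat hX
  have hQQ : Qᵀ * Q = 1 := (Matrix.mem_orthogonalGroup_iff' _ _).mp hQ
  have hunit : ∀ μ, (fun a => Q a μ) ⬝ᵥ (fun a => Q a μ) = 1 := by
    intro μ
    have := congrFun (congrFun hQQ μ) μ
    rwa [Matrix.mul_apply, Matrix.one_apply_eq] at this
  rw [schattenNorm_one_conj_blockMat hQQ, bivMat_conj_blockMat, LinearMap.sum_apply,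
    Finset.mul_sum, Matrix.trace_sum, ← mul_assoc, show (1 / 2 * 2 : ℝ) = 1 by norm_num, one_mul,
    Finset.sum_mul]
  refine (norm_sum_le _ _).trans (Finset.sum_le_sum fun j _ => ?_)
  rw [LinearMap.smul_apply, mul_smul_comm, Matrix.trace_smul, norm_smul, Complex.norm_real,
    Real.norm_eq_abs]
  exact mul_le_mul_of_nonneg_left (norm_trace_mul_biv_le hW hG (hunit _) (hunit _)) (abs_nonneg _)

theorem schattenNorm_gaussian_sub_le {K L : Matrix (MajIdx n) (MajIdx n) ℝ} (hK : Kᵀ = -K)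
    (hL : Lᵀ = -L) (hKc : IsContraction K) (hLc : IsContraction L) :
    schattenNorm 1 (gaussian K - gaussian L) ≤
      1 / 2 * schattenNorm 1 ((K - L).map ((↑) : ℝ → ℂ)) := by
  have hX : (K - L)ᵀ = -(K - L) := by rw [Matrix.transpose_sub, hK, hL]; abel
  have hherm : (gaussian K - gaussian L).IsHermitian :=
    (gaussian_posSemidef_and_trace hK hKc).1.isHermitian.sub
      (gaussian_posSemidef_and_trace hL hLc).1.isHermitian
  obtain ⟨W, hW, hWt⟩ := exists_unitary_trace_mul_eq_schattenNorm hherm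
  have hWu : W ∈ Matrix.unitaryGroup (Basis n) ℂ := Matrix.mem_unitaryGroup_iff'.mpr hW
  let f : Op n →ₗ[ℂ] ℂ := Matrix.traceLinearMap (Basis n) ℂ ℂ ∘ₗ LinearMap.mulLeft ℂ W
  have hf : ∀ A, f A = (W * A).trace := fun A => rfl
  have hderiv := fun t : ℝ => hasDerivAt_gaussian L (K - L) f t
  have hbound := norm_image_sub_le_of_norm_deriv_le_segment_01'
    (f := fun t : ℝ => f (gaussian (t • (K - L) + L)))
    (C := 1 / 2 * schattenNorm 1 ((K - L).map ((↑) : ℝ → ℂ)))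
    (fun t _ => (hderiv t).hasDerivWithinAt) (by
      intro t ht
      -- The point on the segment is again a state of trace one, so the derivative bound does not
      -- depend on `t`.
      have hc := hKc.convex_combination hLc ht.1 ht.2.le
      have ha : (t • (K - L) + L)ᵀ = -(t • (K - L) + L) := by
        rw [Matrix.transpose_add, Matrix.transpose_smul, hX, hL, smul_neg, neg_add]
      obtain ⟨hp, ht1⟩ := gaussian_posSemidef_and_trace ha hc
      have := norm_trace_mul_bivMat_le hWu hp hX
      rwa [ht1, Complex.one_re, mul_one] at this)
  simp only [one_smul, sub_add_cancel, zero_smul, zero_add] at hbound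
  rw [← map_sub, hf] at hbound
  rw [← hWt]
  exact (Complex.re_le_norm _).trans hbound

end TraceNorm

/-! ### Rank-one states and their correlation matrices -/

section PureStates

open Matrix

variable {n : ℕ}

theorem ketbra_mul_ketbra (u v : Basis n → ℂ) :
    ketbra u * ketbra v = (star u ⬝ᵥ v) • Matrix.vecMulVec u (star v) := by
  rw [ketbra, ketbra, Matrix.vecMulVec_mul_vecMulVec, Matrix.vecMulVec_smul]

theorem ketbra_conjTranspose (u : Basis n → ℂ) : (ketbra u)ᴴ = ketbra u := by
  ext x y; simp [ketbra, Matrix.vecMulVec_apply, mul_comm]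

theorem trace_ketbra_mul_ketbra (u v : Basis n → ℂ) :
    (ketbra u * ketbra v).trace = ((‖star u ⬝ᵥ v‖ ^ 2 : ℝ) : ℂ) := by
  rw [ketbra_mul_ketbra, Matrix.trace_smul, Matrix.trace_vecMulVec, smul_eq_mul]
  have : u ⬝ᵥ star v = star (star u ⬝ᵥ v) := by
    rw [Matrix.star_dotProduct, star_star, dotProduct_comm]
  rw [this, Complex.star_def, Complex.mul_conj']
  push_cast; rfl

theorem ketbra_mul_self {u : Basis n → ℂ} (hu : (ketbra u).trace = 1) :
    ketbra u * ketbra u = ketbra u := by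
  rw [ketbra, Matrix.trace_vecMulVec, dotProduct_comm] at hu
  rw [ketbra_mul_ketbra, hu, one_smul]; rfl

theorem ketbra_mul_ketbra_mul_ketbra (u v : Basis n → ℂ) :
    ketbra u * ketbra v * ketbra u = ((‖star u ⬝ᵥ v‖ ^ 2 : ℝ) : ℂ) • ketbra u := by
  rw [← trace_ketbra_mul_ketbra, ketbra_mul_ketbra, Matrix.trace_smul, Matrix.trace_vecMulVec,
    smul_mul_assoc, ketbra, Matrix.vecMulVec_mul_vecMulVec, Matrix.vecMulVec_smul, smul_smul,
    smul_eq_mul, dotProduct_comm u]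

/-- With overlap `F`, the difference `A` of the projections satisfies `A³ = (1 - F) A`, whence `|A|
= A²/√(1 - F)` unless `F = 1`, and then `A = 0`. -/
theorem schattenNorm_ketbra_sub {u v : Basis n → ℂ} (hu : (ketbra u).trace = 1)
    (hv : (ketbra v).trace = 1) :
    schattenNorm 1 (ketbra u - ketbra v) = 2 * √(1 - ‖star u ⬝ᵥ v‖ ^ 2) := by
  have hF := trace_ketbra_mul_ketbra u v
  have hF' := trace_ketbra_mul_ketbra v u
  have hpqp := ketbra_mul_ketbra_mul_ketbra u v
  have hqpq := ketbra_mul_ketbra_mul_ketbra v u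
  have hpp := ketbra_mul_self hu
  have hqq := ketbra_mul_self hv
  have hsymm : ‖star v ⬝ᵥ u‖ ^ 2 = ‖star u ⬝ᵥ v‖ ^ 2 := by
    rw [Matrix.trace_mul_comm, hF] at hF'
    exact_mod_cast hF'.symm
  rw [hsymm] at hqpq hF'
  set F : ℝ := ‖star u ⬝ᵥ v‖ ^ 2
  have hA : (ketbra u - ketbra v)ᴴ = ketbra u - ketbra v := by
    rw [Matrix.conjTranspose_sub, ketbra_conjTranspose, ketbra_conjTranspose]
  set p := ketbra u
  set q := ketbra v
  have hcube : (p - q) * (p - q) * (p - q) = ((1 - F : ℝ) : ℂ) • (p - q) := by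
    calc (p - q) * (p - q) * (p - q)
        = p * p * p - p * p * q - p * q * p + p * (q * q) - q * (p * p) + q * p * q + q * q * p
          - q * q * q := by noncomm_ring
      _ = p - q - p * q * p + q * p * q := by
        rw [hpp, hqq, hpp, hqq]; abel
      _ = _ := by
        rw [hpqp, hqpq, Complex.ofReal_sub, Complex.ofReal_one, sub_smul, one_smul, smul_sub]
        abel
  have htr : ((p - q) * (p - q)).trace = ((2 * (1 - F) : ℝ) : ℂ) := by
    have : (p - q) * (p - q) = p * p - p * q - q * p + q * q := by noncomm_ring
    rw [this, hpp, hqq, Matrix.trace_add, Matrix.trace_sub, Matrix.trace_sub, hu, hv, hF, hF']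
    push_cast; ring
  have hF1 : 0 ≤ 1 - F := by
    have := trace_conjTranspose_mul_self_re_nonneg (p - q)
    rw [hA, htr, Complex.ofReal_re] at this
    linarith
  set A := p - q
  have hs := Real.sq_sqrt hF1
  by_cases h0 : √(1 - F) = 0
  · have hF0 : 1 - F = 0 := by rw [← hs, h0]; ring
    have hAz : A = 0 := by
      rw [← Matrix.trace_conjTranspose_mul_self_eq_zero_iff, hA, htr, hF0]; simp
    rw [h0, mul_zero, schattenNorm_one_of_sq (S := 0) Matrix.PosSemidef.zero (by rw [hAz]; simp)]
    simp
  · have hAA : (A * A).PosSemidef := by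
      have := Matrix.posSemidef_conjTranspose_mul_self A
      rwa [hA] at this
    rw [schattenNorm_one_of_sq (S := (((√(1 - F))⁻¹ : ℝ) : ℂ) • (A * A))]
    · rw [Matrix.trace_smul, htr, smul_eq_mul, ← Complex.ofReal_mul, Complex.ofReal_re]
      field_simp
      rw [hs]
    · exact hAA.smul (by rw [Complex.zero_le_real]; positivity)
    · rw [hA, smul_mul_smul_comm, ← mul_assoc, hcube, smul_mul_assoc, smul_smul,
        ← Complex.ofReal_mul, ← Complex.ofReal_mul]
      have : (√(1 - F))⁻¹ * (√(1 - F))⁻¹ * (1 - F) = 1 := by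
        nth_rewrite 3 [← hs]; field_simp
      rw [this, Complex.ofReal_one, one_smul]

/-- The signs `λ_j = ±1` of the computational basis state `b`. -/
noncomputable def signs (b : Basis n) (j : Fin n) : ℝ := (-1) ^ (b j : ℕ)

theorem signs_mul_self (b : Basis n) (j : Fin n) : signs b j * signs b j = 1 := by
  rw [signs, ← pow_add, ← two_mul, pow_mul]; simp

theorem abs_signs (b : Basis n) (j : Fin n) : |signs b j| = 1 := by simp [signs]

theorem half_one_add_signs_mul (b x : Basis n) (j : Fin n) :
    (1 + signs b j * (-1) ^ (x j : ℕ)) / 2 = if x j = b j then 1 else 0 := by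
  unfold signs
  generalize x j = a
  generalize b j = c
  fin_cases a <;> fin_cases c <;> norm_num

theorem zState_signs (b : Basis n) :
    zState (signs b) = Matrix.diagonal fun x => if x = b then 1 else 0 := by
  rw [zState_eq_diagonal]
  congr 1; ext x
  simp only [half_one_add_signs_mul]
  split_ifs with h
  · subst h; simp
  · obtain ⟨j, hj⟩ := Function.ne_iff.mp h
    rw [Finset.prod_eq_zero (Finset.mem_univ j) (by rw [if_neg hj]), Complex.ofReal_zero]

/-- The string `b` picks the larger factor `(1 + |λ_j|)/2` in every mode. The resulting diagonal
entry is positive, so idempotence makes it `1`, and then every factor is `1`. -/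
theorem exists_signs_of_zState_mul_self {lam : Fin n → ℝ} (hlam : ∀ j, |lam j| ≤ 1)
    (h : zState lam * zState lam = zState lam) : ∃ b : Basis n, lam = signs b := by
  set b : Basis n := fun j => if 0 ≤ lam j then 0 else 1
  have hfac : ∀ j, (1 + lam j * (-1) ^ (b j : ℕ)) / 2 = (1 + |lam j|) / 2 := by
    intro j
    by_cases hj : 0 ≤ lam j
    · simp [b, hj, abs_of_nonneg hj]
    · simp [b, hj, abs_of_neg (not_le.mp hj)]
  have hb := congrFun (congrFun h b) b
  rw [zState_eq_diagonal, Matrix.diagonal_mul_diagonal, Matrix.diagonal_apply_eq,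
    Matrix.diagonal_apply_eq, ← Complex.ofReal_mul, Complex.ofReal_inj] at hb
  simp only [hfac] at hb
  have hpos : 0 < ∏ j, (1 + |lam j|) / 2 := Finset.prod_pos fun j _ => by positivity
  have h1 : ∏ j, (1 + |lam j|) / 2 = 1 := mul_left_cancel₀ hpos.ne' (by rw [hb, mul_one])
  have habs : ∀ k, |lam k| = 1 := by
    intro k
    refine le_antisymm (hlam k) ?_
    rw [← Finset.mul_prod_erase _ _ (Finset.mem_univ k)] at h1
    have h2 : ∏ j ∈ Finset.univ.erase k, (1 + |lam j|) / 2 ≤ 1 :=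
      Finset.prod_le_one (fun j _ => by positivity) fun j _ => by linarith [hlam j]
    have h3 : 0 ≤ |lam k| := abs_nonneg _
    nlinarith
  refine ⟨b, funext fun j => ?_⟩
  rcases (abs_eq zero_le_one).mp (habs j) with hj | hj
  · simp [signs, b, hj]
  · simp [signs, b, hj]; norm_num

theorem IsFreeFermionicState.exists_signs {u : Basis n → ℂ}
    (h : IsFreeFermionicState (ketbra u)) :
    ∃ (Q : Matrix (MajIdx n) (MajIdx n) ℝ) (U : Op n) (b : Basis n),
      IsFreeFermionicUnitary Q U ∧ ketbra u = U * zState (signs b) * Uᴴ ∧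
        (ketbra u).trace = 1 := by
  obtain ⟨Q, U, lam, hU, hlam, heq⟩ := h
  rw [← zState] at heq
  have htr : (ketbra u).trace = 1 := by
    rw [heq, Matrix.trace_mul_cycle, hU.conjTranspose_mul_self, one_mul, trace_zState]
  have hsq := ketbra_mul_self htr
  have hz : zState lam = Uᴴ * ketbra u * U := by
    rw [heq]
    calc zState lam = 1 * zState lam * 1 := by rw [one_mul, mul_one]
      _ = _ := by rw [← hU.conjTranspose_mul_self]; noncomm_ring
  have hzz : zState lam * zState lam = zState lam := by
    rw [hz]
    calc Uᴴ * ketbra u * U * (Uᴴ * ketbra u * U) = Uᴴ * ketbra u * (U * Uᴴ) * ketbra u * U := by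
          noncomm_ring
      _ = Uᴴ * (ketbra u * ketbra u) * U := by rw [hU.mul_conjTranspose_self]; noncomm_ring
      _ = _ := by rw [hsq]
  obtain ⟨b, rfl⟩ := exists_signs_of_zState_mul_self hlam hzz
  exact ⟨Q, U, b, hU, heq, htr⟩

theorem blockMat_signs_mul_self (b : Basis n) :
    blockMat (signs b) * blockMat (signs b) = -1 := by
  ext ⟨j, a⟩ ⟨k, c⟩
  rw [Matrix.mul_apply, Fintype.sum_prod_type, Finset.sum_eq_single j]
  · by_cases h : j = k
    · subst h
      have := signs_mul_self b j
      fin_cases a <;> fin_cases c <;> simp [blockMat, this]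
    · simp [blockMat, h]
  · intro l _ hl; simp [blockMat, hl.symm]
  · simp

theorem conj_blockMat_signs_mul_self {Q : Matrix (MajIdx n) (MajIdx n) ℝ} (hQ : Qᵀ * Q = 1)
    (b : Basis n) :
    (Q * blockMat (signs b) * Qᵀ) * (Q * blockMat (signs b) * Qᵀ) = -1 := by
  have hQ' : Q * Qᵀ = 1 := mul_eq_one_comm.mp hQ
  calc _ = Q * blockMat (signs b) * (Qᵀ * Q) * blockMat (signs b) * Qᵀ := by noncomm_ring
    _ = Q * (blockMat (signs b) * blockMat (signs b)) * Qᵀ := by rw [hQ]; noncomm_ring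
    _ = _ := by rw [blockMat_signs_mul_self, mul_neg, mul_one, neg_mul, hQ']

end PureStates

/-! ### Parity of pure states and its constancy -/

section Parity

open Matrix

variable {n : ℕ}

theorem parity_eq_diagonal :
    parity n = Matrix.diagonal fun x => ((∏ j, (-1) ^ (x j : ℕ) : ℝ) : ℂ) := by
  rw [parity, pauliZ_eq_diagonal, tensor_diagonal]
  congr 1; ext x; push_cast; rfl

theorem trace_parity_mul_zState (lam : Fin n → ℝ) :
    (parity n * zState lam).trace = ((∏ j, lam j : ℝ) : ℂ) := by
  rw [parity, zState, tensor_mul, trace_tensor, Complex.ofReal_prod]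
  exact Finset.prod_congr rfl fun j _ => trace_pauliZ_mul_half_one_add_pauliZ _

theorem IsFreeFermionicUnitary.parity_conj {Q : Matrix (MajIdx n) (MajIdx n) ℝ} {U : Op n}
    (h : IsFreeFermionicUnitary Q U) :
    ∃ ε : ℝ, (ε = 1 ∨ ε = -1) ∧ ∀ A : Op n,
      parity n * (U * A * Uᴴ) = U * ((ε : ℂ) • (parity n * A)) * Uᴴ := by
  obtain ⟨ε, hε, hP⟩ := h.conj_parity
  have key : ∀ δ : ℂ, δ * δ = 1 → U * parity n * Uᴴ = δ • parity n → ∀ A : Op n,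
      parity n * (U * A * Uᴴ) = U * (δ • (parity n * A)) * Uᴴ := by
    intro δ hδ hP A
    rw [mul_smul_comm, smul_mul_assoc, h.conj_mul, hP, smul_mul_assoc, smul_smul, hδ, one_smul]
  rcases hε with rfl | rfl
  · exact ⟨1, Or.inl rfl, by simpa using key 1 (by norm_num) hP⟩
  · exact ⟨-1, Or.inr rfl, by simpa using key (-1) (by norm_num) hP⟩

/-- The trace is `±∏ λ_j`, the Pfaffian of `K` up to sign. A vanishing `λ_j` would put a column of
`Q` into the kernel of `K`. -/
theorem trace_parity_mul_gaussian_re_ne_zero {K : Matrix (MajIdx n) (MajIdx n) ℝ} (hK : Kᵀ = -K)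
    (hinj : ∀ x, K *ᵥ x = 0 → x = 0) : (parity n * gaussian K).trace.re ≠ 0 := by
  obtain ⟨Q, hQ, lam, rfl⟩ := exists_orthogonal_eq_conj_blockMat hK
  obtain ⟨U, hU⟩ := exists_isFreeFermionicUnitary hQ
  obtain ⟨ε, hε, hP⟩ := hU.parity_conj
  have hQQ := hU.transpose_mul_self
  rw [hU.gaussian_eq lam, ← zState, hP, Matrix.trace_mul_cycle, hU.conjTranspose_mul_self, one_mul,
    Matrix.trace_smul, trace_parity_mul_zState, smul_eq_mul, ← Complex.ofReal_mul,
    Complex.ofReal_re]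
  refine mul_ne_zero (by rcases hε with rfl | rfl <;> norm_num) ?_
  rw [Finset.prod_ne_zero_iff]
  intro j _ hj
  have h1 := hinj (Q *ᵥ Pi.single (j, 0) 1) (by
    rw [Matrix.mulVec_mulVec, mul_assoc, hQQ, mul_one, ← Matrix.mulVec_mulVec]
    have : blockMat lam *ᵥ Pi.single (j, 0) 1 = 0 := by
      ext ⟨k, a⟩
      fin_cases a
      · exact (blockMat_mulVec_zero lam _ k).trans (by simp)
      · refine (blockMat_mulVec_one lam _ k).trans ?_
        by_cases hk : k = j
        · subst hk; simp [hj]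
        · simp [hk]
    rw [this, Matrix.mulVec_zero])
  have h2 := orthogonal_mulVec_dotProduct hQQ (Pi.single (j, 0) 1) (Pi.single (j, 0) 1)
  rw [h1] at h2
  simp at h2

/-- A continuous function without zeros on the segment keeps its sign. -/
theorem trace_parity_mul_gaussian_pos {K L : Matrix (MajIdx n) (MajIdx n) ℝ} (hK : Kᵀ = -K)
    (hL : Lᵀ = -L)
    (hinj : ∀ t ∈ Set.Icc (0 : ℝ) 1, ∀ x, (t • (K - L) + L) *ᵥ x = 0 → x = 0) :
    0 < (parity n * gaussian L).trace.re * (parity n * gaussian K).trace.re := by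
  let f : Op n →ₗ[ℂ] ℂ := Matrix.traceLinearMap (Basis n) ℂ ℂ ∘ₗ LinearMap.mulLeft ℂ (parity n)
  let g : ℝ → ℝ := fun t => (f (gaussian (t • (K - L) + L))).re
  have hg : Continuous g := Complex.continuous_re.comp
    (continuous_iff_continuousAt.mpr fun t => (hasDerivAt_gaussian L (K - L) f t).continuousAt)
  have hne : ∀ t ∈ Set.Icc (0 : ℝ) 1, g t ≠ 0 := by
    intro t ht
    refine trace_parity_mul_gaussian_re_ne_zero ?_ (hinj t ht)
    rw [Matrix.transpose_add, Matrix.transpose_smul, Matrix.transpose_sub, hK, hL]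
    module
  have h0 : g 0 = (parity n * gaussian L).trace.re := by simp [g, f]
  have h1 : g 1 = (parity n * gaussian K).trace.re := by simp [g, f]
  rw [← h0, ← h1]
  by_contra hneg
  have hmem : (0 : ℝ) ∈ Set.uIcc (g 0) (g 1) := by
    rw [Set.mem_uIcc]
    rcases le_total (g 0) 0 with h | h
    · rcases le_total (g 1) 0 with h' | h'
      · exact absurd (mul_pos_of_neg_of_neg (lt_of_le_of_ne h (hne 0 (by simp)))
          (lt_of_le_of_ne h' (hne 1 (by simp)))) hneg
      · exact Or.inl ⟨h, h'⟩
    · rcases le_total (g 1) 0 with h' | h'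
      · exact Or.inr ⟨h', h⟩
      · exact absurd (mul_pos (lt_of_le_of_ne h (hne 0 (by simp)).symm)
          (lt_of_le_of_ne h' (hne 1 (by simp)).symm)) hneg
  obtain ⟨t, ht, hgt⟩ := intermediate_value_uIcc hg.continuousOn hmem
  rw [Set.uIcc_of_le zero_le_one] at ht
  exact hne t ht hgt

theorem exists_parity_mul_eq {Q : Matrix (MajIdx n) (MajIdx n) ℝ} {U : Op n}
    (h : IsFreeFermionicUnitary Q U) (b : Basis n) :
    ∃ δ : ℝ, (δ = 1 ∨ δ = -1) ∧
      parity n * (U * zState (signs b) * Uᴴ) = (δ : ℂ) • (U * zState (signs b) * Uᴴ) := by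
  obtain ⟨ε, hε, hP⟩ := h.parity_conj
  have hz : parity n * zState (signs b) = ((∏ j, signs b j : ℝ) : ℂ) • zState (signs b) := by
    rw [parity_eq_diagonal, zState_signs, Matrix.diagonal_mul_diagonal, ← Matrix.diagonal_smul]
    congr 1; ext x
    by_cases hx : x = b
    · subst hx; simp [signs]
    · simp [hx]
  refine ⟨ε * ∏ j, signs b j, ?_, ?_⟩
  · have h1 : |ε * ∏ j, signs b j| = 1 := by
      rw [abs_mul, Finset.abs_prod]
      simp only [abs_signs, Finset.prod_const_one, mul_one]
      rcases hε with rfl | rfl <;> simp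
    exact (abs_eq zero_le_one).mp h1
  · rw [hP, hz, smul_smul, mul_smul_comm, smul_mul_assoc, Complex.ofReal_mul]

end Parity

/-! ### Overlap and the expected number of excitations -/

section Overlap

open Matrix

variable {n : ℕ}

/-- Orthogonality makes the product half a commutator, which is what the correlation matrix records.
-/
theorem trace_gam_mul_gam {ρ : Op n} {K : Matrix (MajIdx n) (MajIdx n) ℝ}
    (hK : corrMatrix ρ = K.map ((↑) : ℝ → ℂ)) {x y : MajIdx n → ℝ} (hxy : x ⬝ᵥ y = 0) :
    ((-Complex.I • (gam x * gam y)) * ρ).trace = ((x ⬝ᵥ K *ᵥ y : ℝ) : ℂ) := by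
  have h1 : -Complex.I • (gam x * gam y) =
      (-(Complex.I / 2)) • (gam x * gam y - gam y * gam x) := by
    rw [← neg_eq_iff_eq_neg.mpr (gam_anticommute hxy), sub_neg_eq_add, ← two_smul ℂ, smul_smul]
    congr 1; ring
  have h2 : gam x * gam y - gam y * gam x = ∑ a, ∑ b, ((x a * y b : ℝ) : ℂ) •
      (majorana a * majorana b - majorana b * majorana a) := by
    have h3 : gam y * gam x = ∑ a, ∑ b, ((x a * y b : ℝ) : ℂ) • (majorana b * majorana a) := by
      simp only [gam, Finset.sum_mul_sum, smul_mul_smul_comm]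
      rw [Finset.sum_comm]
      refine Finset.sum_congr rfl fun a _ => Finset.sum_congr rfl fun b _ => ?_
      rw [mul_comm (y b : ℂ), Complex.ofReal_mul]
    rw [h3]
    simp only [gam, Finset.sum_mul_sum, smul_mul_smul_comm, smul_sub, Finset.sum_sub_distrib,
      Complex.ofReal_mul]
  have h4 : ∀ a b, ((K a b : ℝ) : ℂ) = -(Complex.I / 2) *
      ((majorana a * majorana b - majorana b * majorana a) * ρ).trace :=
    fun a b => (congrFun (congrFun hK a) b).symm
  rw [h1, h2]
  simp only [smul_mul_assoc, Finset.sum_mul, Matrix.trace_smul, Matrix.trace_sum, smul_eq_mul,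
    dotProduct, Matrix.mulVec, Finset.mul_sum, Complex.ofReal_sum]
  refine Finset.sum_congr rfl fun a _ => Finset.sum_congr rfl fun b _ => ?_
  rw [Complex.ofReal_mul, Complex.ofReal_mul, Complex.ofReal_mul, h4]
  ring

theorem IsFreeFermionicUnitary.col_dotProduct {Q : Matrix (MajIdx n) (MajIdx n) ℝ} {U : Op n}
    (h : IsFreeFermionicUnitary Q U) {μ ν : MajIdx n} (hμν : μ ≠ ν) :
    (fun a => Q a μ) ⬝ᵥ (fun a => Q a ν) = 0 := by
  have := congrFun (congrFun h.transpose_mul_self μ) ν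
  rwa [Matrix.mul_apply, Matrix.one_apply_ne hμν] at this

theorem IsFreeFermionicUnitary.trace_pauliZAt_conj {Q : Matrix (MajIdx n) (MajIdx n) ℝ} {U : Op n}
    (h : IsFreeFermionicUnitary Q U) {ρ : Op n} {K : Matrix (MajIdx n) (MajIdx n) ℝ}
    (hK : corrMatrix ρ = K.map ((↑) : ℝ → ℂ)) (j : Fin n) :
    (pauliZAt j * (Uᴴ * ρ * U)).trace =
      (((fun a => Q a (j, 0)) ⬝ᵥ K *ᵥ (fun a => Q a (j, 1)) : ℝ) : ℂ) := by
  rw [← trace_gam_mul_gam hK (h.col_dotProduct (by simp)), ← h.conj_majorana, ← h.conj_majorana,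
    ← h.conj_mul, ← smul_mul_assoc, ← mul_smul_comm, ← pauliZAt_eq, ← mul_assoc,
    Matrix.trace_mul_comm]
  congr 1; noncomm_ring

theorem sum_signs_mul_dotProduct (Q : Matrix (MajIdx n) (MajIdx n) ℝ) (lam : Fin n → ℝ)
    {K : Matrix (MajIdx n) (MajIdx n) ℝ} (hK : Kᵀ = -K) :
    2 * ∑ j, lam j * ((fun a => Q a (j, 0)) ⬝ᵥ K *ᵥ (fun a => Q a (j, 1))) =
      ∑ a, ∑ b, (Q * blockMat lam * Qᵀ) a b * K a b := by
  have h1 := sum_blockMat (RingHom.id ℝ) lam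
    fun μ ν => (fun a => Q a μ) ⬝ᵥ K *ᵥ (fun a => Q a ν)
  have hanti : ∀ x y : MajIdx n → ℝ, y ⬝ᵥ K *ᵥ x = -(x ⬝ᵥ K *ᵥ y) := by
    intro x y
    rw [Matrix.dotProduct_mulVec, ← Matrix.mulVec_transpose, hK, Matrix.neg_mulVec,
      neg_dotProduct, dotProduct_comm]
  simp only [RingHom.id_apply, smul_eq_mul] at h1
  have h2 : ∑ μ, ∑ ν, blockMat lam μ ν * ((fun a => Q a μ) ⬝ᵥ K *ᵥ (fun a => Q a ν)) =
      ∑ a, ∑ b, (Q * blockMat lam * Qᵀ) a b * K a b := by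
    calc ∑ μ, ∑ ν, blockMat lam μ ν * ((fun a => Q a μ) ⬝ᵥ K *ᵥ (fun a => Q a ν))
        = ∑ q : MajIdx n × MajIdx n, ∑ p : MajIdx n × MajIdx n,
        blockMat lam q.1 q.2 * (Q p.1 q.1 * (K p.1 p.2 * Q p.2 q.2)) := by
          refine Eq.trans ?_ (Fintype.sum_prod_type _).symm
          refine Finset.sum_congr rfl fun μ _ => Finset.sum_congr rfl fun ν _ => ?_
          rw [Fintype.sum_prod_type]
          simp only [dotProduct, Matrix.mulVec, Finset.mul_sum]
      _ = ∑ a, ∑ b, (Q * blockMat lam * Qᵀ) a b * K a b := by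
          rw [Finset.sum_comm, Fintype.sum_prod_type]
          refine Finset.sum_congr rfl fun a _ => Finset.sum_congr rfl fun b _ => ?_
          rw [Fintype.sum_prod_type, mul_mul_transpose_apply, Finset.sum_mul]
          refine Finset.sum_congr rfl fun μ _ => ?_
          rw [Finset.sum_mul]
          refine Finset.sum_congr rfl fun ν _ => ?_
          ring
  rw [← h2, h1, Finset.mul_sum]
  refine Finset.sum_congr rfl fun j _ => ?_
  rw [hanti (fun a => Q a (j, 0)) fun a => Q a (j, 1)]
  ring

theorem map_ofReal_conjTranspose (A : Matrix (MajIdx n) (MajIdx n) ℝ) :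
    (A.map ((↑) : ℝ → ℂ))ᴴ = Aᵀ.map ((↑) : ℝ → ℂ) := by
  ext i j; simp [Matrix.conjTranspose_apply]

theorem map_ofReal_mul (A B : Matrix (MajIdx n) (MajIdx n) ℝ) :
    (A * B).map ((↑) : ℝ → ℂ) = A.map ((↑) : ℝ → ℂ) * B.map ((↑) : ℝ → ℂ) :=
  map_mul Complex.ofRealHom.mapMatrix A B

theorem schattenNorm_two_sq_map_ofReal (A : Matrix (MajIdx n) (MajIdx n) ℝ) :
    schattenNorm 2 (A.map ((↑) : ℝ → ℂ)) ^ 2 = ∑ a, ∑ b, A a b ^ 2 := by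
  rw [schattenNorm_two_sq, map_ofReal_conjTranspose, ← map_ofReal_mul]
  have : ((Aᵀ * A).map ((↑) : ℝ → ℂ)).trace = ((Aᵀ * A).trace : ℝ) := by simp [Matrix.trace]
  rw [this, Complex.ofReal_re, Finset.sum_comm]
  simp only [Matrix.trace, Matrix.diag, Matrix.mul_apply, Matrix.transpose_apply, pow_two]

theorem sum_sq_of_skew_of_mul_self {K : Matrix (MajIdx n) (MajIdx n) ℝ} (hK : Kᵀ = -K)
    (hK2 : K * K = -1) : ∑ a, ∑ b, K a b ^ 2 = 2 * n := by
  have h1 : (Kᵀ * K).trace = 2 * n := by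
    rw [hK, neg_mul, hK2, neg_neg, Matrix.trace_one]
    simp [mul_comm]
  rw [← h1, Finset.sum_comm]
  simp only [Matrix.trace, Matrix.diag, Matrix.mul_apply, Matrix.transpose_apply, pow_two]

theorem schattenNorm_two_sq_sub {K L : Matrix (MajIdx n) (MajIdx n) ℝ} (hK : Kᵀ = -K)
    (hK2 : K * K = -1) (hL : Lᵀ = -L) (hL2 : L * L = -1) :
    schattenNorm 2 ((K - L).map ((↑) : ℝ → ℂ)) ^ 2 = 4 * n - 2 * ∑ a, ∑ b, K a b * L a b := by
  have h1 := sum_sq_of_skew_of_mul_self hK hK2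
  have h2 := sum_sq_of_skew_of_mul_self hL hL2
  have h3 : ∑ a, ∑ b, (K - L) a b ^ 2 = ∑ a, ∑ b, K a b ^ 2 + ∑ a, ∑ b, L a b ^ 2 -
      2 * ∑ a, ∑ b, K a b * L a b := by
    simp only [Finset.mul_sum, ← Finset.sum_add_distrib, ← Finset.sum_sub_distrib,
      Matrix.sub_apply]
    exact Finset.sum_congr rfl fun a _ => Finset.sum_congr rfl fun b _ => by ring
  rw [schattenNorm_two_sq_map_ofReal, h3, h1, h2]
  ring

/-- Two distinct computational basis states of equal parity differ on at least two qubits. -/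
theorem two_le_sum_half_one_sub_signs {b x : Basis n} (hx : x ≠ b)
    (hpar : (∏ j, (-1 : ℝ) ^ (x j : ℕ)) = ∏ j, (-1 : ℝ) ^ (b j : ℕ)) :
    2 ≤ ∑ j, (1 - signs b j * (-1) ^ (x j : ℕ)) / 2 := by
  have hterm : ∀ j, (1 - signs b j * (-1) ^ (x j : ℕ)) / 2 = if x j ≠ b j then 1 else 0 := by
    intro j
    have h := half_one_add_signs_mul b x j
    by_cases hj : x j = b j
    · rw [if_pos hj] at h
      rw [if_neg (not_not.mpr hj)]; linarith
    · rw [if_neg hj] at h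
      rw [if_pos hj]; linarith
  simp only [hterm]
  rw [Finset.sum_boole]
  obtain ⟨k, hk⟩ := Function.ne_iff.mp hx
  by_contra hlt
  have hcard : (Finset.univ.filter fun j => x j ≠ b j).card ≤ 1 := by
    by_contra h
    exact hlt (by exact_mod_cast (not_le.mp h))
  have hk' : ∀ j ≠ k, x j = b j := by
    intro j hj
    by_contra hne
    exact hj (Finset.card_le_one.mp hcard j (by simpa using hne) k (by simpa using hk))
  -- If only qubit `k` differed, all other factors would cancel from the equal parities and leave
  -- equal signs at `k`.
  rw [← Finset.mul_prod_erase _ _ (Finset.mem_univ k),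
    ← Finset.mul_prod_erase Finset.univ (fun j => (-1 : ℝ) ^ (b j : ℕ)) (Finset.mem_univ k),
    Finset.prod_congr rfl fun j hj => by rw [hk' j (Finset.ne_of_mem_erase hj)]] at hpar
  have hne : (∏ j ∈ Finset.univ.erase k, (-1 : ℝ) ^ (b j : ℕ)) ≠ 0 :=
    Finset.prod_ne_zero_iff.mpr fun j _ => pow_ne_zero _ (by norm_num)
  have h2 := mul_right_cancel₀ hne hpar
  generalize x k = c at hk h2
  generalize b k = d at hk h2
  fin_cases c <;> fin_cases d <;> first | exact hk rfl | norm_num at h2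

/-- The overlap of a pure free-fermionic state with a state of the same parity is controlled by the
expected number of excitations. -/
theorem overlap_lower_bound {Q : Matrix (MajIdx n) (MajIdx n) ℝ} {U : Op n}
    (hU : IsFreeFermionicUnitary Q U) (b : Basis n) {ρ : Op n} (hρ : ρ.PosSemidef)
    (hρ1 : ρ.trace = 1) {K : Matrix (MajIdx n) (MajIdx n) ℝ} (hK : Kᵀ = -K)
    (hKρ : corrMatrix ρ = K.map ((↑) : ℝ → ℂ)) {δ : ℂ} (hδ : parity n * ρ = δ • ρ)
    (hδ' : parity n * (U * zState (signs b) * Uᴴ) = δ • (U * zState (signs b) * Uᴴ)) :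
    2 * (1 - ((U * zState (signs b) * Uᴴ) * ρ).trace.re) ≤
      n / 2 - 1 / 4 * ∑ a, ∑ c, (Q * blockMat (signs b) * Qᵀ) a c * K a c := by
  obtain ⟨ε, hε, hP⟩ := hU.parity_conj
  have hε0 : (ε : ℂ) ≠ 0 := by rcases hε with rfl | rfl <;> norm_num
  have hinj : ∀ A B : Op n, U * A * Uᴴ = U * B * Uᴴ → A = B := by
    intro A B hAB
    have h1 : ∀ A : Op n, Uᴴ * (U * A * Uᴴ) * U = A := by
      intro A
      calc Uᴴ * (U * A * Uᴴ) * U = (Uᴴ * U) * A * (Uᴴ * U) := by noncomm_ring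
        _ = A := by rw [hU.conjTranspose_mul_self, one_mul, mul_one]
    rw [← h1 A, hAB, h1]
  -- In the frame of `U` the pure state is the basis vector `b`, and the diagonal of `τ` is a
  -- probability distribution on bit strings.
  set τ := Uᴴ * ρ * U with hτ
  have hτρ : U * τ * Uᴴ = ρ := by
    calc U * τ * Uᴴ = (U * Uᴴ) * ρ * (U * Uᴴ) := by rw [hτ]; noncomm_ring
      _ = ρ := by rw [hU.mul_conjTranspose_self, one_mul, mul_one]
  have hsc : ∀ A : Op n, parity n * (U * A * Uᴴ) = δ • (U * A * Uᴴ) →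
      (ε : ℂ) • (parity n * A) = δ • A := by
    intro A hA
    apply hinj
    rw [← hP, hA, mul_smul_comm, smul_mul_assoc]
  have hτP := hsc τ (by rw [hτρ, hδ])
  have hzP := hsc _ hδ'
  have hτpos : τ.PosSemidef := hρ.conjTranspose_mul_mul_same U
  have hw : ∀ x, 0 ≤ (τ x x).re ∧ τ x x = ((τ x x).re : ℂ) := fun x =>
    ⟨(Complex.le_def.mp (hτpos.diag_nonneg (i := x))).1,
      Complex.eq_re_of_ofReal_le (hτpos.diag_nonneg (i := x))⟩
  have hτ1 : ∑ x, (τ x x).re = 1 := by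
    have : τ.trace = 1 := by rw [hτ, Matrix.trace_mul_cycle, hU.mul_conjTranspose_self, one_mul, hρ1]
    rw [← Complex.re_sum]
    change τ.trace.re = 1
    rw [this, Complex.one_re]
  have hover : ((U * zState (signs b) * Uᴴ) * ρ).trace.re = (τ b b).re := by
    have : ((U * zState (signs b) * Uᴴ) * ρ).trace = (zState (signs b) * τ).trace := by
      rw [mul_assoc U, mul_assoc U, Matrix.trace_mul_comm, hτ]
      congr 1; noncomm_ring
    rw [this, zState_signs]
    simp [Matrix.trace, Matrix.diagonal_mul]
  have hparity : ∀ x, (τ x x).re ≠ 0 →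
      (∏ j, (-1 : ℝ) ^ (x j : ℕ)) = ∏ j, (-1 : ℝ) ^ (b j : ℕ) := by
    intro x hx
    have h1 := congrFun (congrFun hτP x) x
    have h2 := congrFun (congrFun hzP b) b
    rw [Matrix.smul_apply, Matrix.smul_apply, parity_eq_diagonal, Matrix.diagonal_mul, smul_eq_mul,
      smul_eq_mul, ← mul_assoc] at h1
    rw [Matrix.smul_apply, Matrix.smul_apply, parity_eq_diagonal, Matrix.diagonal_mul, smul_eq_mul,
      smul_eq_mul, zState_signs, Matrix.diagonal_apply_eq, if_pos rfl, mul_one, mul_one] at h2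
    have h3 : τ x x ≠ 0 := fun h => hx (by rw [h, Complex.zero_re])
    have h4 := mul_right_cancel₀ h3 h1
    rw [← h2] at h4
    exact_mod_cast mul_left_cancel₀ hε0 h4
  have hZ : ∀ j, ∑ x, (τ x x).re * (-1 : ℝ) ^ (x j : ℕ) =
      (fun a => Q a (j, 0)) ⬝ᵥ K *ᵥ (fun a => Q a (j, 1)) := by
    intro j
    have h1 := hU.trace_pauliZAt_conj hKρ j
    rw [← hτ, pauliZAt_eq_diagonal] at h1
    rw [← Complex.ofReal_inj, ← h1, Matrix.trace]
    push_cast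
    refine Finset.sum_congr rfl fun x _ => ?_
    rw [Matrix.diag, Matrix.diagonal_mul, ← (hw x).2, mul_comm]
  -- The expected number of places where `x` differs from `b`, computed from the expectations of the
  -- `Z_j`.
  have hsum : ∑ x, (τ x x).re * ∑ j, (1 - signs b j * (-1) ^ (x j : ℕ)) / 2 =
      n / 2 - 1 / 4 * ∑ a, ∑ c, (Q * blockMat (signs b) * Qᵀ) a c * K a c := by
    rw [← sum_signs_mul_dotProduct Q (signs b) hK]
    simp only [← hZ]
    have h1 : ∀ x, (τ x x).re * ∑ j, (1 - signs b j * (-1) ^ (x j : ℕ)) / 2 =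
        (τ x x).re * (n / 2) - ∑ j, 1 / 2 * (signs b j * ((τ x x).re * (-1) ^ (x j : ℕ))) := by
      intro x
      have : ∑ j, (1 - signs b j * (-1) ^ (x j : ℕ)) / 2 =
          (n : ℝ) / 2 - ∑ j, signs b j * (-1) ^ (x j : ℕ) / 2 := by
        simp only [sub_div, Finset.sum_sub_distrib]
        simp [div_eq_mul_inv]
      rw [this, mul_sub, Finset.mul_sum]
      congr 1
      exact Finset.sum_congr rfl fun j _ => by ring
    simp only [h1]
    rw [Finset.sum_sub_distrib, ← Finset.sum_mul, hτ1, one_mul, Finset.sum_comm]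
    simp only [← Finset.mul_sum]
    ring
  rw [hover, ← hsum]
  -- The claim is now pointwise on the support: `0` differences for `x = b`, at least `2` otherwise.
  have h1 : 2 * (1 - (τ b b).re) = ∑ x, (τ x x).re * (if x = b then 0 else 2) := by
    have : ∀ x, (τ x x).re * (if x = b then (0 : ℝ) else 2) =
        2 * (τ x x).re - (if x = b then 2 * (τ x x).re else 0) := by
      intro x; split_ifs <;> ring
    simp only [this]
    rw [Finset.sum_sub_distrib, ← Finset.mul_sum, hτ1]
    simp; ring
  rw [h1]
  refine Finset.sum_le_sum fun x _ => ?_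
  by_cases h0 : (τ x x).re = 0
  · rw [h0, zero_mul, zero_mul]
  · refine mul_le_mul_of_nonneg_left ?_ (hw x).1
    split_ifs with hxb
    · refine Finset.sum_nonneg fun j _ => ?_
      have h2 : |signs b j * (-1) ^ (x j : ℕ)| = 1 := by rw [abs_mul, abs_signs]; simp
      linarith [(abs_le.mp h2.le).2]
    · exact two_le_sum_half_one_sub_signs hxb (hparity x h0)

end Overlap

/-! ### Operator norm two and singularity of the sum -/

section OperatorNorm

open Matrix

variable {n : ℕ}

theorem norm_toEuclideanCLM_sq (A : Matrix (MajIdx n) (MajIdx n) ℂ)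
    (x : EuclideanSpace ℂ (MajIdx n)) :
    ‖Matrix.toEuclideanCLM (n := MajIdx n) (𝕜 := ℂ) A x‖ ^ 2 =
      (star x.ofLp ⬝ᵥ (Aᴴ * A) *ᵥ x.ofLp).re := by
  rw [← Complex.ofReal_re (_ ^ 2), Complex.ofReal_pow]
  have h := inner_self_eq_norm_sq_to_K (𝕜 := ℂ)
    (Matrix.toEuclideanCLM (n := MajIdx n) (𝕜 := ℂ) A x)
  rw [EuclideanSpace.inner_eq_star_dotProduct] at h
  change A *ᵥ x.ofLp ⬝ᵥ star (A *ᵥ x.ofLp) = _ at h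
  rw [show (Complex.ofReal ‖Matrix.toEuclideanCLM (n := MajIdx n) (𝕜 := ℂ) A x‖) ^ 2 =
    A *ᵥ x.ofLp ⬝ᵥ star (A *ᵥ x.ofLp) from h.symm, dotProduct_comm, Matrix.star_mulVec,
    ← Matrix.dotProduct_mulVec, Matrix.mulVec_mulVec]

/-- The parallelogram identity for the isometries `K` and `L`. -/
theorem norm_sq_sub_add_norm_sq_add {K L : Matrix (MajIdx n) (MajIdx n) ℝ} (hK : Kᵀ = -K)
    (hK2 : K * K = -1) (hL : Lᵀ = -L) (hL2 : L * L = -1) (x : EuclideanSpace ℂ (MajIdx n)) :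
    ‖Matrix.toEuclideanCLM (n := MajIdx n) (𝕜 := ℂ) ((K - L).map ((↑) : ℝ → ℂ)) x‖ ^ 2 +
      ‖Matrix.toEuclideanCLM (n := MajIdx n) (𝕜 := ℂ) ((K + L).map ((↑) : ℝ → ℂ)) x‖ ^ 2 =
        4 * ‖x‖ ^ 2 := by
  have h1 : (K - L)ᵀ * (K - L) + (K + L)ᵀ * (K + L) = (4 : ℝ) • 1 := by
    rw [Matrix.transpose_sub, Matrix.transpose_add, hK, hL]
    calc (-K - -L) * (K - L) + (-K + -L) * (K + L) = -(K * K) - K * K - L * L - L * L := by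
          noncomm_ring
      _ = _ := by rw [hK2, hL2]; module
  have h2 : ((K - L).map ((↑) : ℝ → ℂ))ᴴ * (K - L).map ((↑) : ℝ → ℂ) +
      ((K + L).map ((↑) : ℝ → ℂ))ᴴ * (K + L).map ((↑) : ℝ → ℂ) = (4 : ℂ) • 1 := by
    rw [map_ofReal_conjTranspose, map_ofReal_conjTranspose, ← map_ofReal_mul, ← map_ofReal_mul]
    ext a b
    have := congrArg ((↑) : ℝ → ℂ) (congrFun (congrFun h1 a) b)
    by_cases hab : a = b <;> simpa [hab] using this
  have h3 := norm_toEuclideanCLM_sq 1 x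
  rw [map_one, one_apply_eq_self, Matrix.conjTranspose_one, mul_one,
    Matrix.one_mulVec] at h3
  rw [norm_toEuclideanCLM_sq, norm_toEuclideanCLM_sq, ← Complex.add_re, ← dotProduct_add,
    ← Matrix.add_mulVec, h2, Matrix.smul_mulVec, Matrix.one_mulVec, dotProduct_smul, h3]
  simp

theorem opNorm_sub_le_two {K L : Matrix (MajIdx n) (MajIdx n) ℝ} (hK : Kᵀ = -K)
    (hK2 : K * K = -1) (hL : Lᵀ = -L) (hL2 : L * L = -1) :
    opNorm ((K - L).map ((↑) : ℝ → ℂ)) ≤ 2 := by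
  refine ContinuousLinearMap.opNorm_le_bound _ (by norm_num) fun x => ?_
  have h := norm_sq_sub_add_norm_sq_add hK hK2 hL hL2 x
  refine abs_le_of_sq_le_sq' ?_ (by positivity) |>.2
  nlinarith [sq_nonneg ‖Matrix.toEuclideanCLM (n := MajIdx n) (𝕜 := ℂ)
    ((K + L).map ((↑) : ℝ → ℂ)) x‖]

theorem map_ofReal_mulVec (A : Matrix (MajIdx n) (MajIdx n) ℝ) (x : MajIdx n → ℝ) :
    A.map ((↑) : ℝ → ℂ) *ᵥ (fun i => (x i : ℂ)) = fun i => ((A *ᵥ x) i : ℂ) := by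
  ext i; simp [Matrix.mulVec, dotProduct]

theorem add_mulVec_injective_of_opNorm_lt {K L : Matrix (MajIdx n) (MajIdx n) ℝ} (hK : Kᵀ = -K)
    (hK2 : K * K = -1) (hL : Lᵀ = -L) (hL2 : L * L = -1)
    (hlt : opNorm ((K - L).map ((↑) : ℝ → ℂ)) < 2) {x : MajIdx n → ℝ}
    (hx : (K + L) *ᵥ x = 0) : x = 0 := by
  set y : EuclideanSpace ℂ (MajIdx n) := WithLp.toLp 2 fun i => (x i : ℂ)
  have h := norm_sq_sub_add_norm_sq_add hK hK2 hL hL2 y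
  have h0 : Matrix.toEuclideanCLM (n := MajIdx n) (𝕜 := ℂ) ((K + L).map ((↑) : ℝ → ℂ)) y = 0 := by
    ext i
    change ((K + L).map ((↑) : ℝ → ℂ) *ᵥ (fun i => (x i : ℂ))) i = 0
    rw [map_ofReal_mulVec, hx]; simp
  rw [h0, norm_zero] at h
  have hle := ContinuousLinearMap.le_opNorm
    (Matrix.toEuclideanCLM (n := MajIdx n) (𝕜 := ℂ) ((K - L).map ((↑) : ℝ → ℂ))) y
  have hy : y = 0 := by
    by_contra hne
    have hpos := norm_pos_iff.mpr hne
    have h2 : ‖Matrix.toEuclideanCLM (n := MajIdx n) (𝕜 := ℂ) ((K - L).map ((↑) : ℝ → ℂ)) y‖ <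
        2 * ‖y‖ := hle.trans_lt (mul_lt_mul_of_pos_right hlt hpos)
    nlinarith [norm_nonneg
      (Matrix.toEuclideanCLM (n := MajIdx n) (𝕜 := ℂ) ((K - L).map ((↑) : ℝ → ℂ)) y)]
  ext i
  have := congrArg (fun z : EuclideanSpace ℂ (MajIdx n) => z.ofLp i) hy
  simpa [y] using this

/-- An invertible `K + L` is bounded below by some `1/c`, and the parallelogram identity then keeps
the norm of `K - L` below `√(4 - c⁻²) < 2`. -/
theorem exists_add_mulVec_eq_zero_of_opNorm_eq {K L : Matrix (MajIdx n) (MajIdx n) ℝ}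
    (hK : Kᵀ = -K) (hK2 : K * K = -1) (hL : Lᵀ = -L) (hL2 : L * L = -1)
    (heq : opNorm ((K - L).map ((↑) : ℝ → ℂ)) = 2) : ∃ x ≠ 0, (K + L) *ᵥ x = 0 := by
  rw [Matrix.exists_mulVec_eq_zero_iff]
  by_contra hdet
  set C : Matrix (MajIdx n) (MajIdx n) ℂ := (K + L).map ((↑) : ℝ → ℂ) with hC
  have hCdet : IsUnit C.det := by
    have : C.det = ((K + L).det : ℝ) := (RingHom.map_det Complex.ofRealHom (K + L)).symm
    rw [this, isUnit_iff_ne_zero]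
    exact_mod_cast hdet
  set T := Matrix.toEuclideanCLM (n := MajIdx n) (𝕜 := ℂ)
  have hinv : T C⁻¹ * T C = 1 := by rw [← map_mul, Matrix.nonsing_inv_mul _ hCdet, map_one]
  -- The `+ 1` keeps `c` positive even on the zero-dimensional space, `n = 0`.
  set c := ‖T C⁻¹‖ + 1
  have hc : 0 < c := by positivity
  have hxle : ∀ x, ‖x‖ ≤ c * ‖T C x‖ := by
    intro x
    have h1 : T C⁻¹ (T C x) = x := by
      rw [← mul_apply_eq_comp, hinv, one_apply_eq_self]
    calc ‖x‖ = ‖T C⁻¹ (T C x)‖ := by rw [h1]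
      _ ≤ ‖T C⁻¹‖ * ‖T C x‖ := ContinuousLinearMap.le_opNorm _ _
      _ ≤ c * ‖T C x‖ := mul_le_mul_of_nonneg_right (by simp [c]) (norm_nonneg _)
  have hbound : opNorm ((K - L).map ((↑) : ℝ → ℂ)) ≤ √(4 - (c ^ 2)⁻¹) := by
    refine ContinuousLinearMap.opNorm_le_bound _ (Real.sqrt_nonneg _) fun x => ?_
    have h := norm_sq_sub_add_norm_sq_add hK hK2 hL hL2 x
    have h2 : (c ^ 2)⁻¹ * ‖x‖ ^ 2 ≤ ‖T C x‖ ^ 2 := by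
      rw [inv_mul_le_iff₀ (by positivity), ← mul_pow]
      exact pow_le_pow_left₀ (norm_nonneg _) (hxle x) 2
    have h3 : ‖T ((K - L).map ((↑) : ℝ → ℂ)) x‖ ^ 2 ≤ (4 - (c ^ 2)⁻¹) * ‖x‖ ^ 2 := by
      rw [sub_mul, ← h]
      linarith
    have h4 := Real.sqrt_le_sqrt h3
    rwa [Real.sqrt_sq (norm_nonneg _), Real.sqrt_mul' _ (by positivity),
      Real.sqrt_sq (norm_nonneg _)] at h4
  have hlt : √(4 - (c ^ 2)⁻¹) < 2 := by
    rw [Real.sqrt_lt' (by norm_num)]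
    have : 0 < (c ^ 2)⁻¹ := by positivity
    linarith
  linarith

/-- A kernel vector gives `t K x = (t - 1) L x`. As `K` and `L` are isometries, `t² = (t - 1)²`, so
`t = 1/2`, where the matrix is half of `K + L`. -/
theorem interpolation_mulVec_injective {K L : Matrix (MajIdx n) (MajIdx n) ℝ} (hK : Kᵀ = -K)
    (hK2 : K * K = -1) (hL : Lᵀ = -L) (hL2 : L * L = -1)
    (hinj : ∀ x, (K + L) *ᵥ x = 0 → x = 0) {t : ℝ} (x : MajIdx n → ℝ)
    (hx : (t • (K - L) + L) *ᵥ x = 0) : x = 0 := by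
  have hKK : Kᵀ * K = 1 := by rw [hK, neg_mul, hK2, neg_neg]
  have hLL : Lᵀ * L = 1 := by rw [hL, neg_mul, hL2, neg_neg]
  have h1 : t • (K *ᵥ x) = (t - 1) • (L *ᵥ x) := by
    rw [← sub_eq_zero, ← hx, Matrix.add_mulVec, Matrix.smul_mulVec, Matrix.sub_mulVec]
    module
  have h2 := congrArg (fun v => v ⬝ᵥ v) h1
  simp only [smul_dotProduct, dotProduct_smul, smul_eq_mul, orthogonal_mulVec_dotProduct hKK,
    orthogonal_mulVec_dotProduct hLL] at h2
  by_contra hne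
  have hxx : x ⬝ᵥ x ≠ 0 := fun h => hne (dotProduct_self_eq_zero.mp h)
  have h3 : (t * t - (t - 1) * (t - 1)) * (x ⬝ᵥ x) = 0 := by linear_combination h2
  have ht : t = 1 / 2 := by
    have := (mul_eq_zero.mp h3).resolve_right hxx
    linarith
  apply hne
  apply hinj
  have h4 : (K + L) *ᵥ x = (2 : ℝ) • (t • (K *ᵥ x) - (t - 1) • (L *ᵥ x)) := by
    rw [ht, Matrix.add_mulVec]; module
  rw [h4, h1, sub_self, smul_zero]

end OperatorNorm

/-! ### Assembly of the pure and mixed bounds -/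

section Main

open Matrix

variable {n : ℕ}

/-- An extreme expectation value forces an eigenstate: the squared Hilbert–Schmidt norm of `(h +
c)ρ` is `2c Tr(hρ) + 2c² = 0`. The sign of `c` is free, so both extremes are covered. -/
theorem mul_eq_neg_smul_of_trace_eq {h ρ : Op n} {c : ℝ} (hh : hᴴ = h)
    (hh2 : h * h = ((c * c : ℝ) : ℂ) • 1) (hρ : ρᴴ = ρ) (hρ2 : ρ * ρ = ρ) (hρ1 : ρ.trace = 1)
    (htr : (h * ρ).trace = ((-c : ℝ) : ℂ)) : h * ρ = ((-c : ℝ) : ℂ) • ρ := by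
  have hsq : ((h + (c : ℂ) • 1) * ρ)ᴴ * ((h + (c : ℂ) • 1) * ρ) =
      ρ * ((2 * c : ℂ) • (h * ρ) + ((2 * (c * c) : ℝ) : ℂ) • ρ) := by
    have h1 : (h + (c : ℂ) • 1) * (h + (c : ℂ) • 1) =
        (2 * c : ℂ) • h + ((2 * (c * c) : ℝ) : ℂ) • 1 := by
      rw [add_mul, mul_add, mul_add, hh2]
      simp only [mul_smul_comm, smul_mul_assoc, mul_one, one_mul, smul_smul]
      push_cast
      module
    have h2 : ((h + (c : ℂ) • 1) * ρ)ᴴ = ρ * (h + (c : ℂ) • 1) := by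
      rw [Matrix.conjTranspose_mul, hρ, Matrix.conjTranspose_add, hh, Matrix.conjTranspose_smul,
        Matrix.conjTranspose_one, Complex.star_def, Complex.conj_ofReal]
    rw [h2, mul_assoc, ← mul_assoc (h + (c : ℂ) • 1), h1, add_mul, smul_mul_assoc, smul_mul_assoc,
      one_mul]
  have h0 : (h + (c : ℂ) • 1) * ρ = 0 := by
    rw [← Matrix.trace_conjTranspose_mul_self_eq_zero_iff, hsq, Matrix.trace_mul_comm, add_mul,
      smul_mul_assoc, smul_mul_assoc, mul_assoc, hρ2, Matrix.trace_add, Matrix.trace_smul,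
      Matrix.trace_smul, htr, hρ1]
    simp only [smul_eq_mul]
    push_cast
    ring
  rw [add_mul, smul_mul_assoc, one_mul] at h0
  rw [eq_neg_of_add_eq_zero_left h0, Complex.ofReal_neg, neg_smul]

/-- With `y = K x = -L x`, the observable `-i γ(x) γ(y)` has square `c²` and expectation `-c` in
`ρ`, `+c` in `σ`. Eigenprojections for different eigenvalues are orthogonal. -/
theorem mul_eq_zero_of_add_mulVec_eq_zero {ρ σ : Op n} (hρ : ρᴴ = ρ) (hρ2 : ρ * ρ = ρ)
    (hρ1 : ρ.trace = 1) (hσ : σᴴ = σ) (hσ2 : σ * σ = σ) (hσ1 : σ.trace = 1)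
    {K L : Matrix (MajIdx n) (MajIdx n) ℝ} (hK : Kᵀ = -K) (hK2 : K * K = -1)
    (hKρ : corrMatrix ρ = K.map ((↑) : ℝ → ℂ)) (hLσ : corrMatrix σ = L.map ((↑) : ℝ → ℂ))
    {x : MajIdx n → ℝ} (hx : x ≠ 0) (hKL : (K + L) *ᵥ x = 0) (hL2 : L * L = -1) : ρ * σ = 0 := by
  set c := x ⬝ᵥ x
  have hc : c ≠ 0 := fun h => hx (dotProduct_self_eq_zero.mp h)
  have hKK : Kᵀ * K = 1 := by rw [hK, neg_mul, hK2, neg_neg]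
  have hLx : L *ᵥ x = -(K *ᵥ x) := by
    rw [Matrix.add_mulVec] at hKL
    exact eq_neg_of_add_eq_zero_right hKL
  set y := K *ᵥ x
  have hyy : y ⬝ᵥ y = c := orthogonal_mulVec_dotProduct hKK x x
  have hxy : x ⬝ᵥ y = 0 := by
    have : x ⬝ᵥ y = -(x ⬝ᵥ y) := by
      conv_lhs => rw [Matrix.dotProduct_mulVec, ← Matrix.mulVec_transpose, hK, Matrix.neg_mulVec,
        neg_dotProduct, dotProduct_comm]
    exact self_eq_neg.mp this
  have hKy : K *ᵥ y = -x := by rw [Matrix.mulVec_mulVec, hK2, Matrix.neg_mulVec, Matrix.one_mulVec]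
  have hLy : L *ᵥ y = x := by
    rw [← neg_eq_iff_eq_neg.mpr hLx, Matrix.mulVec_neg, Matrix.mulVec_mulVec, hL2,
      Matrix.neg_mulVec, Matrix.one_mulVec, neg_neg]
  have hanti := gam_anticommute hxy
  set h : Op n := -Complex.I • (gam x * gam y) with hdef
  have hh : hᴴ = h := by
    rw [hdef, Matrix.conjTranspose_smul, Matrix.conjTranspose_mul, gam_conjTranspose,
      gam_conjTranspose, ← neg_eq_iff_eq_neg.mpr hanti]
    simp
  have hh2 : h * h = ((c * c : ℝ) : ℂ) • 1 := by
    rw [hdef, smul_mul_smul_comm]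
    have : gam x * gam y * (gam x * gam y) = -((gam x * gam x) * (gam y * gam y)) := by
      calc gam x * gam y * (gam x * gam y) = -(gam x * -(gam y * gam x) * gam y) := by noncomm_ring
        _ = _ := by rw [← hanti]; noncomm_ring
    rw [this, gam_mul_self, gam_mul_self, hyy, smul_mul_smul_comm, mul_one, smul_neg, ← neg_smul]
    change (-(-Complex.I * -Complex.I)) • (((c : ℂ) * (c : ℂ)) • (1 : Op n)) = _
    rw [neg_mul_neg, Complex.I_mul_I, neg_neg, one_smul, Complex.ofReal_mul]
  have htrρ : (h * ρ).trace = ((-c : ℝ) : ℂ) := by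
    rw [trace_gam_mul_gam hKρ hxy, hKy, dotProduct_neg]
  have htrσ : (h * σ).trace = ((c : ℝ) : ℂ) := by rw [trace_gam_mul_gam hLσ hxy, hLy]
  have h1 := mul_eq_neg_smul_of_trace_eq hh hh2 hρ hρ2 hρ1 htrρ
  have h2 := mul_eq_neg_smul_of_trace_eq (c := -c) hh (by rw [hh2]; congr 2; ring) hσ hσ2 hσ1
    (by rw [htrσ, neg_neg])
  have h3 : ρ * h = ((-c : ℝ) : ℂ) • ρ := by
    have := congrArg Matrix.conjTranspose h1
    rwa [Matrix.conjTranspose_mul, hρ, hh, Matrix.conjTranspose_smul, hρ, Complex.star_def,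
      Complex.conj_ofReal] at this
  have h4 : ρ * h * σ = ρ * (h * σ) := mul_assoc _ _ _
  rw [h3, h2, neg_neg, smul_mul_assoc, mul_smul_comm, Complex.ofReal_neg, neg_smul] at h4
  have h5 : (2 * c : ℂ) • (ρ * σ) = 0 := by
    rw [two_mul, add_smul]
    nth_rewrite 1 [← h4]
    exact neg_add_cancel _
  exact (smul_eq_zero.mp h5).resolve_left (mul_ne_zero two_ne_zero (by exact_mod_cast hc))

theorem IsFreeFermionicState.posSemidef_and_trace {ρ : Op n} (h : IsFreeFermionicState ρ) :
    ρ.PosSemidef ∧ ρ.trace = 1 := by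
  obtain ⟨K, hK, hc, rfl, -⟩ := h.exists_gaussian
  exact gaussian_posSemidef_and_trace hK hc

theorem map_ofReal_sub (K L : Matrix (MajIdx n) (MajIdx n) ℝ) :
    K.map ((↑) : ℝ → ℂ) - L.map ((↑) : ℝ → ℂ) = (K - L).map ((↑) : ℝ → ℂ) := by
  ext a b; simp

theorem IsFreeFermionicState.schattenNorm_sub_le {ρ σ : Op n} (hρ : IsFreeFermionicState ρ)
    (hσ : IsFreeFermionicState σ) :
    schattenNorm 1 (ρ - σ) ≤ 1 / 2 * schattenNorm 1 (corrMatrix ρ - corrMatrix σ) := by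
  obtain ⟨K, hK, hKc, hρK, hKρ⟩ := hρ.exists_gaussian
  obtain ⟨L, hL, hLc, hσL, hLσ⟩ := hσ.exists_gaussian
  rw [hKρ, hLσ, map_ofReal_sub, hρK, hσL]
  exact schattenNorm_gaussian_sub_le hK hL hKc hLc

theorem sq_max_zero_le_sq {x y : ℝ} (h : x ≤ y) (hy : 0 ≤ y) : max 0 x ^ 2 ≤ y ^ 2 :=
  pow_le_pow_left₀ (le_max_left _ _) (max_le hy h) 2

theorem one_sub_two_mul_le_sq_max (x : ℝ) : 1 - 2 * x ≤ max 0 (1 - x) ^ 2 := by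
  rcases le_total 0 (1 - x) with h | h
  · rw [max_eq_right h]; nlinarith [sq_nonneg x]
  · rw [max_eq_left h]; linarith

theorem IsFreeFermionicState.sq_max_le_fidelity {ρ σ : Op n} (hρ : IsFreeFermionicState ρ)
    (hσ : IsFreeFermionicState σ) :
    (max 0 (1 - 1 / 4 * schattenNorm 1 (corrMatrix ρ - corrMatrix σ))) ^ 2 ≤ fidelity ρ σ := by
  have h1 := hρ.schattenNorm_sub_le hσ
  have h2 := one_sub_half_schattenNorm_le hρ.posSemidef_and_trace.1 hσ.posSemidef_and_trace.1
    hρ.posSemidef_and_trace.2 hσ.posSemidef_and_trace.2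
  have h3 : 0 ≤ (CFC.sqrt (CFC.sqrt σ * ρ * CFC.sqrt σ)).trace.re :=
    (Complex.le_def.mp (Matrix.nonneg_iff_posSemidef.mp (CFC.sqrt_nonneg _)).trace_nonneg).1
  exact sq_max_zero_le_sq (by linarith) h3

theorem IsFreeFermionicState.overlap_le_of_opNorm_lt {u v : Basis n → ℂ}
    (hu : IsFreeFermionicState (ketbra u)) (hv : IsFreeFermionicState (ketbra v))
    (hlt : opNorm (corrMatrix (ketbra u) - corrMatrix (ketbra v)) < 2) :
    1 - 1 / 16 * schattenNorm 2 (corrMatrix (ketbra u) - corrMatrix (ketbra v)) ^ 2 ≤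
      ‖star u ⬝ᵥ v‖ ^ 2 := by
  obtain ⟨Q, U, b, hU, hueq, -⟩ := hu.exists_signs
  obtain ⟨R, V, d, hV, hveq, hv1⟩ := hv.exists_signs
  have hKu := hU.corrMatrix_eq (signs b)
  have hLv := hV.corrMatrix_eq (signs d)
  rw [← hueq] at hKu
  rw [← hveq] at hLv
  have hGu : ketbra u = gaussian (Q * blockMat (signs b) * Qᵀ) := hueq.trans (hU.gaussian_eq _).symm
  have hGv : ketbra v = gaussian (R * blockMat (signs d) * Rᵀ) := hveq.trans (hV.gaussian_eq _).symm
  have hK := transpose_conj_blockMat Q (signs b)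
  have hL := transpose_conj_blockMat R (signs d)
  have hK2 := conj_blockMat_signs_mul_self hU.transpose_mul_self b
  have hL2 := conj_blockMat_signs_mul_self hV.transpose_mul_self d
  obtain ⟨δ, hδ, hPu⟩ := exists_parity_mul_eq hU b
  obtain ⟨δ', hδ', hPv⟩ := exists_parity_mul_eq hV d
  rw [hKu, hLv, map_ofReal_sub] at hlt
  have hsign := trace_parity_mul_gaussian_pos hK hL fun t _ x hx =>
    interpolation_mulVec_injective hK hK2 hL hL2
      (fun x hx => add_mulVec_injective_of_opNorm_lt hK hK2 hL hL2 hlt hx) x hx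
  rw [← hGu, ← hGv, hueq, hveq, hPu, hPv, ← hueq, ← hveq, Matrix.trace_smul, Matrix.trace_smul,
    hu.posSemidef_and_trace.2, hv1, smul_eq_mul, smul_eq_mul, mul_one, mul_one, Complex.ofReal_re,
    Complex.ofReal_re] at hsign
  -- The two parity expectations are the signs themselves, and their product is positive.
  have hδδ : δ' = δ := by
    rcases hδ with rfl | rfl <;> rcases hδ' with rfl | rfl <;> first | rfl | norm_num at hsign
  rw [hδδ, ← hveq] at hPv
  -- The right side is `‖K - L‖₂²/8`, because `K` and `L` each have squared Hilbert–Schmidt norm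
  -- `2n`.
  have h := overlap_lower_bound hU b hv.posSemidef_and_trace.1 hv1 hL hLv hPv hPu
  rw [← hueq, trace_ketbra_mul_ketbra, Complex.ofReal_re] at h
  rw [hKu, hLv, map_ofReal_sub, schattenNorm_two_sq_sub hK hK2 hL hL2]
  linarith

theorem IsFreeFermionicState.opNorm_corrMatrix_sub_le {u v : Basis n → ℂ}
    (hu : IsFreeFermionicState (ketbra u)) (hv : IsFreeFermionicState (ketbra v)) :
    opNorm (corrMatrix (ketbra u) - corrMatrix (ketbra v)) ≤ 2 := by
  obtain ⟨Q, U, b, hU, hueq, -⟩ := hu.exists_signs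
  obtain ⟨R, V, d, hV, hveq, -⟩ := hv.exists_signs
  rw [hueq, hveq, hU.corrMatrix_eq, hV.corrMatrix_eq, map_ofReal_sub]
  exact opNorm_sub_le_two (transpose_conj_blockMat Q _)
    (conj_blockMat_signs_mul_self hU.transpose_mul_self b) (transpose_conj_blockMat R _)
    (conj_blockMat_signs_mul_self hV.transpose_mul_self d)

theorem IsFreeFermionicState.overlap_eq_zero_of_opNorm_eq {u v : Basis n → ℂ}
    (hu : IsFreeFermionicState (ketbra u)) (hv : IsFreeFermionicState (ketbra v))
    (heq : opNorm (corrMatrix (ketbra u) - corrMatrix (ketbra v)) = 2) :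
    ‖star u ⬝ᵥ v‖ ^ 2 = 0 := by
  obtain ⟨Q, U, b, hU, hueq, hu1⟩ := hu.exists_signs
  obtain ⟨R, V, d, hV, hveq, hv1⟩ := hv.exists_signs
  have hKu := hU.corrMatrix_eq (signs b)
  have hLv := hV.corrMatrix_eq (signs d)
  rw [← hueq] at hKu
  rw [← hveq] at hLv
  have hK := transpose_conj_blockMat Q (signs b)
  have hL := transpose_conj_blockMat R (signs d)
  have hK2 := conj_blockMat_signs_mul_self hU.transpose_mul_self b
  have hL2 := conj_blockMat_signs_mul_self hV.transpose_mul_self d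
  rw [hKu, hLv, map_ofReal_sub] at heq
  obtain ⟨x, hx, hKL⟩ := exists_add_mulVec_eq_zero_of_opNorm_eq hK hK2 hL hL2 heq
  have h0 := mul_eq_zero_of_add_mulVec_eq_zero (ketbra_conjTranspose u) (ketbra_mul_self hu1) hu1
    (ketbra_conjTranspose v) (ketbra_mul_self hv1) hv1 hK hK2 hKu hLv hx hKL hL2
  have h1 := trace_ketbra_mul_ketbra u v
  rw [h0, Matrix.trace_zero] at h1
  exact_mod_cast h1.symm

end Main

end FreeFermion

theorem theorem1 (n : ℕ) :
    -- pure free-fermionic states |u⟩⟨u|, |v⟩⟨v|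
    (∀ u v : FreeFermion.Basis n → ℂ,
      FreeFermion.IsFreeFermionicState (FreeFermion.ketbra u) →
      FreeFermion.IsFreeFermionicState (FreeFermion.ketbra v) →
      FreeFermion.opNorm (FreeFermion.corrMatrix (FreeFermion.ketbra u)
          - FreeFermion.corrMatrix (FreeFermion.ketbra v)) ≤ 2 ∧
      (FreeFermion.opNorm (FreeFermion.corrMatrix (FreeFermion.ketbra u)
          - FreeFermion.corrMatrix (FreeFermion.ketbra v)) < 2 →
        FreeFermion.schattenNorm 1 (FreeFermion.ketbra u - FreeFermion.ketbra v)
            ≤ 1 / 2 * FreeFermion.schattenNorm 2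
              (FreeFermion.corrMatrix (FreeFermion.ketbra u)
                - FreeFermion.corrMatrix (FreeFermion.ketbra v)) ∧
        1 - 1 / 16 * FreeFermion.schattenNorm 2
              (FreeFermion.corrMatrix (FreeFermion.ketbra u)
                - FreeFermion.corrMatrix (FreeFermion.ketbra v)) ^ 2
            ≤ ‖star u ⬝ᵥ v‖ ^ 2) ∧
      (FreeFermion.opNorm (FreeFermion.corrMatrix (FreeFermion.ketbra u)
          - FreeFermion.corrMatrix (FreeFermion.ketbra v)) = 2 →
        FreeFermion.schattenNorm 1 (FreeFermion.ketbra u - FreeFermion.ketbra v) = 2 ∧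
        ‖star u ⬝ᵥ v‖ ^ 2 = 0)) ∧
    -- possibly mixed free-fermionic states
    (∀ ρ σ : FreeFermion.Op n,
      FreeFermion.IsFreeFermionicState ρ →
      FreeFermion.IsFreeFermionicState σ →
      FreeFermion.schattenNorm 1 (ρ - σ)
          ≤ 1 / 2 * FreeFermion.schattenNorm 1
            (FreeFermion.corrMatrix ρ - FreeFermion.corrMatrix σ) ∧
      (max 0 (1 - 1 / 4 * FreeFermion.schattenNorm 1
            (FreeFermion.corrMatrix ρ - FreeFermion.corrMatrix σ))) ^ 2
          ≤ FreeFermion.fidelity ρ σ ∧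
      1 - 1 / 2 * FreeFermion.schattenNorm 1
            (FreeFermion.corrMatrix ρ - FreeFermion.corrMatrix σ)
          ≤ (max 0 (1 - 1 / 4 * FreeFermion.schattenNorm 1
            (FreeFermion.corrMatrix ρ - FreeFermion.corrMatrix σ))) ^ 2) := by
  refine ⟨fun u v hu hv => ⟨hu.opNorm_corrMatrix_sub_le hv, fun hlt => ?_, fun heq => ?_⟩,
    fun ρ σ hρ hσ => ⟨hρ.schattenNorm_sub_le hσ, hρ.sq_max_le_fidelity hσ, ?_⟩⟩
  · have hF := hu.overlap_le_of_opNorm_lt hv hlt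
    refine ⟨?_, hF⟩
    rw [FreeFermion.schattenNorm_ketbra_sub hu.posSemidef_and_trace.2 hv.posSemidef_and_trace.2]
    have h0 := FreeFermion.schattenNorm_two_nonneg
      (FreeFermion.corrMatrix (FreeFermion.ketbra u) - FreeFermion.corrMatrix (FreeFermion.ketbra v))
    have h1 : √(1 - ‖star u ⬝ᵥ v‖ ^ 2) ≤ 1 / 4 * FreeFermion.schattenNorm 2
        (FreeFermion.corrMatrix (FreeFermion.ketbra u)
          - FreeFermion.corrMatrix (FreeFermion.ketbra v)) := by
      refine Real.sqrt_le_iff.mpr ⟨by positivity, ?_⟩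
      rw [mul_pow]
      linarith
    linarith
  · have hF := hu.overlap_eq_zero_of_opNorm_eq hv heq
    refine ⟨?_, hF⟩
    rw [FreeFermion.schattenNorm_ketbra_sub hu.posSemidef_and_trace.2 hv.posSemidef_and_trace.2, hF]
    simp
  · refine le_trans (le_of_eq ?_) (FreeFermion.one_sub_two_mul_le_sq_max _)
    ring
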